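/- Let $R$ be a commutative ring and $A$ a ($\mathbb Z$-graded, homologically graded) DG $R$-algebra. Let $\mathcal M_R$ and $\mathcal M_A$ be the categories of DG $R$-modules and of left DG $A$-modules, $\mathbb F=A\otimes_R-\colon\mathcal M_R\to\mathcal M_A$ extension of scalars, $S^{n}_R$ the complex $R$ concentrated in degree $n$, and $D^n_R$ the complex with $R$ in degrees $n$ and $n-1$ and the identity as differential. Put $$\mathbb F\mathcal I_R=\{\mathbb F S^{n-1}_R\to\mathbb F D^n_R\mid n\in\mathbb Z\},\qquad \mathbb F\mathcal J_R=\{0\to\mathbb F D^n_R\mid n\in\mathbb Z\}.$$ Conventions. For a set $\mathcal I$ of maps of $\mathcal M_A$, a relative $\mathcal I$-cell complex is a map $F_0\to\operatorname{colim}_{n\in\mathbb N}F_n$ where each $F_n\to F_{n+1}$ is a pushout of a set-indexed coproduct of maps in $\mathcal I$; in an enriched relative $\mathcal I$-cell complex one uses instead coproducts of maps $i\otimes_R V$ with $i\in\mathcal I$ and $V$ an (ungraded) $R$-module. The set $\mathcal I$ is compact (resp. compact in the enriched sense) if for each domain $C$ of a map in $\mathcal I$ and each relative (resp. enriched relative)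 $\mathcal I$-cell complex the map $\operatorname{colim}_n\mathcal M_A(C,F_n)\to\mathcal M_A(C,\operatorname{colim}_n F_n)$ is bijective. A map $i\colon W\to X$ has the enriched left lifting property against $p\colon E\to B$ (and $p$ the enriched right lifting property against $i$) if the $R$-linear map from $\mathcal M_A(X,E)$ to the $R$-module of commutative squares from $i$ to $p$ has an $R$-linear section. An enriched weak factorization system (WFS) is a pair $(\mathcal L,\mathcal P)$ of classes of maps such that every map factors as a map in $\mathcal L$ followed by a map in $\mathcal P$, $\mathcal L$ is the class of maps with the enriched left lifting property against $\mathcal P$, and $\mathcal P$ is the class of maps with the enriched right lifting property against $\mathcal L$. Then $\mathcal M_A$ has all small limits and colimits, and the following hold. 1. Every enriched relative $\mathbb F\mathcal J_R$-cell complex is an $r$-equivalence, i.e. a homotopy equivalence of underlying DG $R$-modules. 2. ($r$-model structure.) $\mathcal M_A$ has a model structure whose weak equivalences $\mathcal W_r$ are the $r$-equivalences, whose fibrations $\mathcal F_r$ are the $R$-split epimorphisms (maps with a section as maps of graded $R$-modules), and whose cofibrations $\mathcal C_r$ are the maps with the left lifting property against $\mathcal F_r\cap\mathcal W_r$. It is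 compactly generated in the sense enriched in $R$-modules by $\mathbb F\mathcal I_R$ and $\mathbb F\mathcal J_R$: both sets are compact in the enriched sense; $(\mathcal C_r,\mathcal F_r\cap\mathcal W_r)$ and $(\mathcal C_r\cap\mathcal W_r,\mathcal F_r)$ are enriched WFSs; $\mathcal C_r$ (resp. $\mathcal C_r\cap\mathcal W_r$) is the class of retracts of enriched relative $\mathbb F\mathcal I_R$-cell (resp. $\mathbb F\mathcal J_R$-cell) complexes; and $\mathcal F_r$ (resp. $\mathcal F_r\cap\mathcal W_r$) is the class of maps with the enriched right lifting property against $\mathbb F\mathcal J_R$ (resp. $\mathbb F\mathcal I_R$). 3. ($q$-model structure.) $\mathcal M_A$ has a model structure whose weak equivalences $\mathcal W_q$ are the quasi-isomorphisms, whose fibrations $\mathcal F_q$ are the degreewise surjections, and whose cofibrations $\mathcal C_q$ are the maps with the left lifting property against $\mathcal F_q\cap\mathcal W_q$. It is compactly generated in the ordinary sense by the same sets: $\mathbb F\mathcal I_R$ and $\mathbb F\mathcal J_R$ are compact; $\mathcal C_q$ (resp. $\mathcal C_q\cap\mathcal W_q$) is the class of retracts of relative $\mathbb F\mathcal I_R$-cell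 (resp. $\mathbb F\mathcal J_R$-cell) complexes; and $\mathcal F_q$ (resp. $\mathcal F_q\cap\mathcal W_q$) is the class of maps with the right lifting property against $\mathbb F\mathcal J_R$ (resp. $\mathbb F\mathcal I_R$). -/

import Mathlib

open CategoryTheory Limits HomotopicalAlgebra
open scoped TensorProduct DirectSum ZeroObject

universe u v w

/-! ## DG algebras and DG modules -/

/-- A differential graded algebra over the commutative ring `R`: a `ℤ`-graded complex of
`R`-modules (the differential lowers degrees by one) with an associative unital product of
degree `0` for which the differential is a derivation. -/
structure DGAlgebra (R : Type u) [CommRing R] where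
  /-- the underlying DG `R`-module -/
  X : ChainComplex (ModuleCat.{u} R) ℤ
  /-- the product of elements of degrees `i` and `j` -/
  mul {i j k : ℤ} (h : i + j = k) : X.X i →ₗ[R] X.X j →ₗ[R] X.X k
  /-- the unit -/
  one : X.X 0
  one_mul (n : ℤ) (a : X.X n) : mul (zero_add n) one a = a
  mul_one (n : ℤ) (a : X.X n) : mul (add_zero n) a one = a
  mul_assoc {i j k ij jk ijk : ℤ} (hij : i + j = ij) (hjk : j + k = jk)
    (h₁ : ij + k = ijk) (h₂ : i + jk = ijk) (a : X.X i) (b : X.X j) (c : X.X k) :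
    mul h₁ (mul hij a b) c = mul h₂ a (mul hjk b c)
  d_mul {i j k i' j' k' : ℤ} (hi : i' + 1 = i) (hj : j' + 1 = j) (hk : k' + 1 = k)
    (h : i + j = k) (a : X.X i) (b : X.X j) :
    (X.d k k').hom (mul h a b) =
      mul (by omega : i' + j = k') ((X.d i i').hom a) b +
        i.negOnePow • mul (by omega : i + j' = k') a ((X.d j j').hom b)

/-- A (left) differential graded module over the DG algebra `A`. -/
structure DGModule {R : Type u} [CommRing R] (A : DGAlgebra R) where
  /-- the underlying DG `R`-module -/
  X : ChainComplex (ModuleCat.{u} R) ℤ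
  /-- the action of elements of degree `i` on elements of degree `j` -/
  smul {i j k : ℤ} (h : i + j = k) : A.X.X i →ₗ[R] X.X j →ₗ[R] X.X k
  one_smul (n : ℤ) (x : X.X n) : smul (zero_add n) A.one x = x
  mul_smul {i j k ij jk ijk : ℤ} (hij : i + j = ij) (hjk : j + k = jk)
    (h₁ : ij + k = ijk) (h₂ : i + jk = ijk) (a : A.X.X i) (b : A.X.X j) (x : X.X k) :
    smul h₁ (A.mul hij a b) x = smul h₂ a (smul hjk b x)
  d_smul {i j k i' j' k' : ℤ} (hi : i' + 1 = i) (hj : j' + 1 = j) (hk : k' + 1 = k)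
    (h : i + j = k) (a : A.X.X i) (x : X.X j) :
    (X.d k k').hom (smul h a x) =
      smul (by omega : i' + j = k') ((A.X.d i i').hom a) x +
        i.negOnePow • smul (by omega : i + j' = k') a ((X.d j j').hom x)

namespace DGModule

variable {R : Type u} [CommRing R] {A : DGAlgebra R}

/-- A map of DG `A`-modules: a chain map that commutes with the action of `A`. -/
@[ext]
structure Hom (M N : DGModule A) where
  /-- the underlying map of DG `R`-modules -/
  hom : M.X ⟶ N.X
  map_smul {i j k : ℤ} (h : i + j = k) (a : A.X.X i) (x : M.X.X j) :
    (hom.f k).hom (M.smul h a x) = N.smul h a ((hom.f j).hom x)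

/-- The category of DG `A`-modules. -/
instance : Category (DGModule A) where
  Hom M N := Hom M N
  id M := { hom := 𝟙 M.X, map_smul := by intros; simp }
  comp f g := { hom := f.hom ≫ g.hom, map_smul := by intros; simp [f.map_smul, g.map_smul] }

@[ext]
lemma hom_ext {M N : DGModule A} {f g : M ⟶ N} (h : f.hom = g.hom) : f = g :=
  Hom.ext h

@[simp] lemma id_hom (M : DGModule A) : Hom.hom (𝟙 M) = 𝟙 M.X := rfl

@[simp] lemma comp_hom {M N P : DGModule A} (f : M ⟶ N) (g : N ⟶ P) :
    (f ≫ g).hom = f.hom ≫ g.hom := rfl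

/-- The forgetful functor from DG `A`-modules to DG `R`-modules. -/
@[simps]
def forget (A : DGAlgebra R) : DGModule A ⥤ ChainComplex (ModuleCat.{u} R) ℤ where
  obj M := M.X
  map f := f.hom

/-- The `R`-submodule of the maps of DG `R`-modules that commute with the action of `A`. -/
def homSubmodule (M N : DGModule A) : Submodule R (M.X ⟶ N.X) where
  carrier := {f | ∀ ⦃i j k : ℤ⦄ (h : i + j = k) (a : A.X.X i) (x : M.X.X j),
    (f.f k).hom (M.smul h a x) = N.smul h a ((f.f j).hom x)}
  add_mem' {f g} hf hg i j k h a x := by simp [hf h a x, hg h a x]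
  zero_mem' i j k h a x := by simp
  smul_mem' r f hf i j k h a x := by simp [hf h a x]

/-- Maps of DG `A`-modules as elements of a submodule of the maps of DG `R`-modules. -/
def homEquiv (M N : DGModule A) : (M ⟶ N) ≃ homSubmodule M N where
  toFun f := ⟨f.hom, fun _ _ _ h a x ↦ f.map_smul h a x⟩
  invFun f := { hom := f.1, map_smul := fun h a x ↦ f.2 h a x }

/-- The additive group structure on maps of DG `A`-modules is the pointwise one. -/
instance (M N : DGModule A) : AddCommGroup (M ⟶ N) := (homEquiv M N).addCommGroup

/-- The `R`-module structure on maps of DG `A`-modules is the pointwise one. -/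
instance (M N : DGModule A) : Module R (M ⟶ N) := (homEquiv M N).module R

@[simp] lemma add_hom {M N : DGModule A} (f g : M ⟶ N) : (f + g).hom = f.hom + g.hom := rfl

@[simp] lemma zero_hom {M N : DGModule A} : Hom.hom (0 : M ⟶ N) = 0 := rfl

@[simp] lemma smul_hom {M N : DGModule A} (r : R) (f : M ⟶ N) : (r • f).hom = r • f.hom := rfl

instance : Preadditive (DGModule A) where
  add_comp _ _ _ _ _ _ := by ext1; simp
  comp_add _ _ _ _ _ _ := by ext1; simp

/-- The enrichment of DG `A`-modules in `R`-modules. -/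
instance : Linear R (DGModule A) where
  smul_comp _ _ _ _ _ _ := by ext1; simp
  comp_smul _ _ _ _ _ _ := by ext1; simp

/-! ## Tensors with `R`-modules -/

/-- The tensor `M ⊗ V` of a DG `A`-module `M` with an ungraded `R`-module `V`,
with `A` acting on the left factor. -/
def tensorObj (M : DGModule A) (V : ModuleCat.{u} R) : DGModule A where
  X :=
    { X n := ModuleCat.of R (M.X.X n ⊗[R] V)
      d i j := ModuleCat.ofHom ((M.X.d i j).hom.rTensor V)
      shape i j h := by
        rw [M.X.shape i j h]
        ext : 1
        simp
      d_comp_d' i j k _ _ := by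
        rw [← ModuleCat.ofHom_comp, ← LinearMap.rTensor_comp, ← ModuleCat.hom_comp,
          M.X.d_comp_d]
        ext : 1
        simp }
  smul h := LinearMap.rTensorHom V ∘ₗ M.smul h
  one_smul n x := by
    have : M.smul (zero_add n) A.one = LinearMap.id := LinearMap.ext (M.one_smul n)
    simp [this]
  mul_smul hij hjk h₁ h₂ a b x := by
    have : M.smul h₁ (A.mul hij a b) = M.smul h₂ a ∘ₗ M.smul hjk b :=
      LinearMap.ext (M.mul_smul hij hjk h₁ h₂ a b)
    simp [this, LinearMap.rTensor_comp_apply]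
  d_smul hi hj hk h a x := by
    induction x using TensorProduct.induction_on with
    | zero => simp
    | tmul x v =>
      simp [M.d_smul hi hj hk h a x, TensorProduct.add_tmul, Units.smul_def,
        TensorProduct.smul_tmul']
    | add x y hx hy =>
      simp only [map_add, hx, hy, smul_add]
      abel

/-- The functor `M ↦ M ⊗ V`, which sends `f` to `f ⊗ id`. -/
def tensorRight (V : ModuleCat.{u} R) : DGModule A ⥤ DGModule A where
  obj M := tensorObj M V
  map {M N} f :=
    { hom :=
        { f n := ModuleCat.ofHom ((f.hom.f n).hom.rTensor V)
          comm' i j _ := by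
            dsimp [tensorObj]
            rw [← ModuleCat.ofHom_comp, ← ModuleCat.ofHom_comp, ← LinearMap.rTensor_comp,
              ← LinearMap.rTensor_comp, ← ModuleCat.hom_comp, ← ModuleCat.hom_comp,
              f.hom.comm] }
      map_smul {i j k} h a := by
        have key : (f.hom.f k).hom.rTensor V ∘ₗ (M.smul h a).rTensor V =
            (N.smul h a).rTensor V ∘ₗ (f.hom.f j).hom.rTensor V := by
          rw [← LinearMap.rTensor_comp, ← LinearMap.rTensor_comp]
          exact congrArg _ (LinearMap.ext (f.map_smul h a))
        exact LinearMap.congr_fun key }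
  map_id M := hom_ext (HomologicalComplex.hom_ext _ _ fun n ↦
    congrArg ModuleCat.ofHom (LinearMap.rTensor_id V (M.X.X n)))
  map_comp f g := hom_ext (HomologicalComplex.hom_ext _ _ fun n ↦
    congrArg ModuleCat.ofHom (LinearMap.rTensor_comp V (g.hom.f n).hom (f.hom.f n).hom))

end DGModule

/-! ## Extension of scalars -/

namespace ExtendScalars

variable {R : Type u} [CommRing R] (A : DGAlgebra R) (K : ChainComplex (ModuleCat.{u} R) ℤ)

/-- The degree `n` part of `A ⊗ K`, the direct sum of the `A_i ⊗ K_j` with `i + j = n`. -/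
abbrev Deg (n : ℤ) : Type u :=
  ⨁ p : {p : ℤ × ℤ // p.1 + p.2 = n}, A.X.X p.1.1 ⊗[R] K.X p.1.2

/-- The inclusion of the summand `A_i ⊗ K_j`. -/
noncomputable def ι {i j n : ℤ} (h : i + j = n) : A.X.X i ⊗[R] K.X j →ₗ[R] Deg A K n :=
  DirectSum.lof R {p : ℤ × ℤ // p.1 + p.2 = n}
    (fun p ↦ A.X.X p.1.1 ⊗[R] K.X p.1.2) ⟨(i, j), h⟩

variable {A K} in
lemma deg_hom_ext {n : ℤ} {P : Type v} [AddCommGroup P] [Module R P]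
    {f g : Deg A K n →ₗ[R] P}
    (H : ∀ (i j : ℤ) (h : i + j = n) (a : A.X.X i) (x : K.X j),
      f (ι A K h (a ⊗ₜ x)) = g (ι A K h (a ⊗ₜ x))) : f = g := by
  refine DirectSum.linearMap_ext R ?_
  rintro ⟨⟨i, j⟩, h⟩
  exact TensorProduct.ext' (H i j h)

/-- The differential `d (a ⊗ x) = d a ⊗ x + (-1) ^ (deg a) a ⊗ d x` of `A ⊗ K`. -/
noncomputable def d (n m : ℤ) : Deg A K n →ₗ[R] Deg A K m :=
  if hm : m + 1 = n then
    DirectSum.toModule R _ _ fun p ↦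
      ι A K (by have := p.2; omega : (p.1.1 - 1) + p.1.2 = m) ∘ₗ
          (A.X.d p.1.1 (p.1.1 - 1)).hom.rTensor (K.X p.1.2) +
        p.1.1.negOnePow •
          (ι A K (by have := p.2; omega : p.1.1 + (p.1.2 - 1) = m) ∘ₗ
            (K.d p.1.2 (p.1.2 - 1)).hom.lTensor (A.X.X p.1.1))
  else 0

lemma d_ι {n m i j i' j' : ℤ} (h : i + j = n) (hi : i' + 1 = i) (hj : j' + 1 = j)
    (hm : m + 1 = n) (a : A.X.X i) (x : K.X j) :
    d A K n m (ι A K h (a ⊗ₜ x)) =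
      ι A K (by omega : i' + j = m) ((A.X.d i i').hom a ⊗ₜ x) +
        i.negOnePow • ι A K (by omega : i + j' = m) (a ⊗ₜ (K.d j j').hom x) := by
  obtain rfl : i' = i - 1 := by omega
  obtain rfl : j' = j - 1 := by omega
  rw [d, dif_pos hm]
  conv_lhs => rw [ι]
  rw [DirectSum.toModule_lof]
  simp [Units.smul_def]

/-- The action `a (b ⊗ x) = (a b) ⊗ x` of `A` on `A ⊗ K`. -/
noncomputable def act {i j k : ℤ} (h : i + j = k) :
    A.X.X i →ₗ[R] Deg A K j →ₗ[R] Deg A K k :=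
  LinearMap.flip <| DirectSum.toModule R _ _ fun p ↦
    LinearMap.flip <|
      LinearMap.compRight R (ι A K (by have := p.2; omega : (i + p.1.1) + p.1.2 = k)) ∘ₗ
        LinearMap.rTensorHom (K.X p.1.2) ∘ₗ A.mul rfl

lemma act_ι {i j k p q ip : ℤ} (h : i + j = k) (hpq : p + q = j) (hip : i + p = ip)
    (a : A.X.X i) (b : A.X.X p) (x : K.X q) :
    act A K h a (ι A K hpq (b ⊗ₜ x)) =
      ι A K (by omega : ip + q = k) (A.mul hip a b ⊗ₜ x) := by
  subst hip
  rw [act, LinearMap.flip_apply]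
  conv_lhs => rw [ι]
  rw [DirectSum.toModule_lof]
  simp

lemma zsmul_tmul {M N : Type u} [AddCommGroup M] [AddCommGroup N] [Module R M] [Module R N]
    (z : ℤ) (m : M) (n : N) : z • (m ⊗ₜ[R] n) = (z • m) ⊗ₜ[R] n := rfl

/-- The DG `A`-module `A ⊗ K` for a DG `R`-module `K`. -/
noncomputable def obj : DGModule A where
  X :=
    { X n := ModuleCat.of R (Deg A K n)
      d n m := ModuleCat.ofHom (d A K n m)
      shape n m h := by
        ext : 1
        exact dif_neg h
      d_comp_d' n m l hm hl := by
        replace hm : m + 1 = n := hm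
        replace hl : l + 1 = m := hl
        ext : 1
        refine deg_hom_ext fun i j h a x ↦ ?_
        have hA := ConcreteCategory.congr_hom (A.X.d_comp_d i (i - 1) (i - 1 - 1)) a
        have hK := ConcreteCategory.congr_hom (K.d_comp_d j (j - 1) (j - 1 - 1)) x
        simp only [ModuleCat.hom_comp, LinearMap.comp_apply, ModuleCat.hom_zero,
          LinearMap.zero_apply] at hA hK
        simp only [ModuleCat.hom_comp, ModuleCat.hom_ofHom, LinearMap.comp_apply,
          ModuleCat.hom_zero, LinearMap.zero_apply]
        rw [d_ι A K h (sub_add_cancel i 1) (sub_add_cancel j 1) hm]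
        simp only [map_add, Units.smul_def, map_zsmul]
        rw [d_ι A K _ (sub_add_cancel (i - 1) 1) (sub_add_cancel j 1) hl,
          d_ι A K _ (sub_add_cancel i 1) (sub_add_cancel (j - 1) 1) hl, hA, hK]
        simp [Int.negOnePow_sub, Units.smul_def] }
  smul h := act A K h
  one_smul n := by
    refine LinearMap.congr_fun (deg_hom_ext (f := act A K (zero_add n) A.one)
      (g := LinearMap.id) fun i j h a x ↦ ?_)
    rw [act_ι A K _ h (zero_add i), A.one_mul]
    rfl
  mul_smul {i j k ij jk ijk} hij hjk h₁ h₂ a b := by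
    refine LinearMap.congr_fun (deg_hom_ext (f := act A K h₁ (A.mul hij a b))
      (g := act A K h₂ a ∘ₗ act A K hjk b) fun p q h c y ↦ ?_)
    rw [LinearMap.comp_apply, act_ι A K h₁ h rfl, act_ι A K hjk h rfl,
      act_ι A K h₂ _ (add_assoc i j p ▸ hij ▸ rfl : i + (j + p) = ij + p),
      A.mul_assoc hij rfl rfl (by omega)]
  d_smul {i j k i' j' k'} hi hj hk h a := by
    refine LinearMap.congr_fun (deg_hom_ext (f := d A K k k' ∘ₗ act A K h a)
      (g := act A K (by omega : i' + j = k') ((A.X.d i i').hom a) +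
        i.negOnePow • (act A K (by omega : i + j' = k') a ∘ₗ d A K j j'))
      fun p q hpq b y ↦ ?_)
    simp only [LinearMap.comp_apply, LinearMap.add_apply, LinearMap.smul_apply, Units.smul_def]
    rw [act_ι A K h hpq rfl,
      d_ι A K _ (by omega : (i + p - 1) + 1 = i + p) (sub_add_cancel q 1) hk,
      act_ι A K _ hpq (by omega : i' + p = i + p - 1),
      d_ι A K hpq (sub_add_cancel p 1) (sub_add_cancel q 1) hj,
      A.d_mul hi (sub_add_cancel p 1) (by omega) rfl a b]
    simp only [map_add, Units.smul_def, map_zsmul]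
    rw [act_ι A K _ _ (by omega : i + (p - 1) = i + p - 1), act_ι A K _ _ rfl]
    rw [TensorProduct.add_tmul, map_add, ← zsmul_tmul, map_zsmul, Int.negOnePow_add,
      Units.val_mul, mul_smul, smul_add, add_assoc]

/-- The map `A ⊗ K ⟶ A ⊗ L` induced by a map of DG `R`-modules, in degree `n`. -/
noncomputable def mapDeg {K L : ChainComplex (ModuleCat.{u} R) ℤ} (f : K ⟶ L) (n : ℤ) :
    Deg A K n →ₗ[R] Deg A L n :=
  DirectSum.toModule R _ _ fun p ↦
    ι A L p.2 ∘ₗ (f.f p.1.2).hom.lTensor (A.X.X p.1.1)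

lemma mapDeg_ι {K L : ChainComplex (ModuleCat.{u} R) ℤ} (f : K ⟶ L) {i j n : ℤ}
    (h : i + j = n) (a : A.X.X i) (x : K.X j) :
    mapDeg A f n (ι A K h (a ⊗ₜ x)) = ι A L h (a ⊗ₜ (f.f j).hom x) := by
  rw [mapDeg]
  conv_lhs => rw [ι]
  rw [DirectSum.toModule_lof]
  simp

lemma mapDeg_d {K L : ChainComplex (ModuleCat.{u} R) ℤ} (f : K ⟶ L) {n m : ℤ}
    (hm : m + 1 = n) :
    d A L n m ∘ₗ mapDeg A f n = mapDeg A f m ∘ₗ d A K n m := by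
  refine deg_hom_ext fun i j h a x ↦ ?_
  have hf := ConcreteCategory.congr_hom (f.comm j (j - 1)) x
  simp only [ModuleCat.hom_comp, LinearMap.comp_apply] at hf ⊢
  rw [mapDeg_ι, d_ι A L h (sub_add_cancel i 1) (sub_add_cancel j 1) hm,
    d_ι A K h (sub_add_cancel i 1) (sub_add_cancel j 1) hm]
  simp only [map_add, Units.smul_def, map_zsmul]
  rw [mapDeg_ι, mapDeg_ι]
  exact congrArg (fun y ↦ _ + (i.negOnePow : ℤ) • ι A L _ (a ⊗ₜ[R] y)) hf

lemma mapDeg_act {K L : ChainComplex (ModuleCat.{u} R) ℤ} (f : K ⟶ L) {i j k : ℤ}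
    (h : i + j = k) (a : A.X.X i) :
    mapDeg A f k ∘ₗ act A K h a = act A L h a ∘ₗ mapDeg A f j := by
  refine deg_hom_ext fun p q hpq b y ↦ ?_
  simp only [LinearMap.comp_apply]
  rw [act_ι A K h hpq rfl, mapDeg_ι, mapDeg_ι, act_ι A L h hpq rfl]

lemma mapDeg_id (n : ℤ) : mapDeg A (𝟙 K) n = LinearMap.id :=
  deg_hom_ext fun _ _ h a x ↦ mapDeg_ι A (𝟙 K) h a x

lemma mapDeg_comp {K L P : ChainComplex (ModuleCat.{u} R) ℤ} (f : K ⟶ L) (g : L ⟶ P) (n : ℤ) :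
    mapDeg A (f ≫ g) n = mapDeg A g n ∘ₗ mapDeg A f n := by
  refine deg_hom_ext fun i j h a x ↦ ?_
  rw [LinearMap.comp_apply, mapDeg_ι, mapDeg_ι, mapDeg_ι]
  rfl

end ExtendScalars

/-- The extension of scalars functor `K ↦ A ⊗ K` from DG `R`-modules to DG `A`-modules. -/
noncomputable def extendScalars {R : Type u} [CommRing R] (A : DGAlgebra R) :
    ChainComplex (ModuleCat.{u} R) ℤ ⥤ DGModule A where
  obj K := ExtendScalars.obj A K
  map f :=
    { hom :=
        { f n := ModuleCat.ofHom (ExtendScalars.mapDeg A f n)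
          comm' _ _ hm := ModuleCat.hom_ext (ExtendScalars.mapDeg_d A f hm) }
      map_smul h a := LinearMap.congr_fun (ExtendScalars.mapDeg_act A f h a) }
  map_id K := DGModule.hom_ext (HomologicalComplex.hom_ext _ _ fun n ↦
    congrArg ModuleCat.ofHom (ExtendScalars.mapDeg_id A K n))
  map_comp f g := DGModule.hom_ext (HomologicalComplex.hom_ext _ _ fun n ↦
    congrArg ModuleCat.ofHom (ExtendScalars.mapDeg_comp A f g n))

/-! ## Spheres, disks and the generating maps -/

section Generators

variable (R : Type u) [CommRing R]

/-- The `n`-sphere: `R` concentrated in degree `n`. -/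
noncomputable def sphere (n : ℤ) : ChainComplex (ModuleCat.{u} R) ℤ :=
  (HomologicalComplex.single (ModuleCat.{u} R) (ComplexShape.down ℤ) n).obj (ModuleCat.of R R)

/-- The `n`-disk: `R` in degrees `n` and `n - 1`, with the identity as differential. -/
noncomputable def disk (n : ℤ) : ChainComplex (ModuleCat.{u} R) ℤ :=
  HomologicalComplex.double (𝟙 (ModuleCat.of R R))
    (show (ComplexShape.down ℤ).Rel n (n - 1) from sub_add_cancel n 1)

/-- The inclusion of the `(n - 1)`-sphere as the boundary of the `n`-disk. -/
noncomputable def sphereToDisk (n : ℤ) : sphere R (n - 1) ⟶ disk R n :=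
  HomologicalComplex.mkHomFromSingle
    (HomologicalComplex.doubleXIso₁ (𝟙 (ModuleCat.of R R))
      (show (ComplexShape.down ℤ).Rel n (n - 1) from sub_add_cancel n 1) (by omega)).inv
    (fun k _ ↦ by
      have : (disk R n).d (n - 1) k = 0 :=
        HomologicalComplex.double_d_eq_zero₀ _ _ _ _ (by omega)
      exact (congrArg _ this).trans comp_zero)

variable {R} (A : DGAlgebra R)

/-- The maps `A ⊗ S^{n-1} ⟶ A ⊗ D^n`, for `n : ℤ`. -/
noncomputable def genI : MorphismProperty (DGModule A) :=
  MorphismProperty.ofHoms fun n : ℤ ↦ (extendScalars A).map (sphereToDisk R n)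

/-- The maps `A ⊗ 0 ⟶ A ⊗ D^n`, for `n : ℤ`. -/
noncomputable def genJ : MorphismProperty (DGModule A) :=
  MorphismProperty.ofHoms fun n : ℤ ↦
    (extendScalars A).map (0 : (0 : ChainComplex (ModuleCat.{u} R) ℤ) ⟶ disk R n)

end Generators

/-! ## Model structures and compact generation -/

section ModelStructures

variable {C : Type v} [Category.{u} C]

/-- `W`, `Cof`, `Fib` are the weak equivalences, cofibrations and fibrations of a
model structure. -/
def IsModelStructure (W Cof Fib : MorphismProperty C) : Prop :=
  ∃ m : ModelCategory C,
    m.categoryWithWeakEquivalences.weakEquivalences = W ∧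
    m.categoryWithCofibrations.cofibrations = Cof ∧
    m.categoryWithFibrations.fibrations = Fib

/-- The maps obtained by one step of cell attachment: pushouts of (set-indexed) coproducts
of maps in `I`. -/
def cellAttachments (I : MorphismProperty C) : MorphismProperty C :=
  (MorphismProperty.coproducts.{u} I).pushouts

/-- The relative `I`-cell complexes: composites of sequences, indexed by `ℕ`, of
pushouts of coproducts of maps in `I`. -/
def relativeCellComplexes (I : MorphismProperty C) : MorphismProperty C :=
  (cellAttachments I).transfiniteCompositionsOfShape ℕ

/-- `P` is compact with respect to `I`: for each relative `I`-cell complex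
`F₀ ⟶ Y = colim Fₙ`, the canonical map `colim C(P, Fₙ) ⟶ C(P, Y)` is a bijection. -/
def IsCompactObject (I : MorphismProperty C) (P : C) : Prop :=
  ∀ ⦃X Y : C⦄ (f : X ⟶ Y)
    (c : (cellAttachments I).TransfiniteCompositionOfShape ℕ f),
    Nonempty (IsColimit ((coyoneda.obj (Opposite.op P)).mapCocone (Cocone.mk Y c.incl)))

/-- The domains of the maps in `I` are compact with respect to `I'`. -/
def HasCompactDomains (I I' : MorphismProperty C) : Prop :=
  ∀ ⦃P Q : C⦄ (i : P ⟶ Q), I i → IsCompactObject I' P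

/-- The model structure with weak equivalences `W`, cofibrations `Cof` and fibrations `Fib`
is compactly generated, in the usual sense, by `I` and `J`. -/
structure IsCompactlyGeneratedModel (W Cof Fib I J : MorphismProperty C) : Prop where
  isModelStructure : IsModelStructure W Cof Fib
  compact_I : HasCompactDomains I I
  compact_J : HasCompactDomains J J
  cof_eq : Cof = (relativeCellComplexes I).retracts
  acyclicCof_eq : Cof ⊓ W = (relativeCellComplexes J).retracts
  fib_eq : Fib = J.rlp
  acyclicFib_eq : Fib ⊓ W = I.rlp

end ModelStructures

/-! ## Enriched lifting properties and enriched weak factorization systems -/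

section Enriched

variable (R : Type w) [CommRing R] {C : Type v} [Category.{u} C] [Preadditive C] [Linear R C]

/-- The `R`-module of commutative squares from `i` to `p`. -/
def Sq {W X E B : C} (i : W ⟶ X) (p : E ⟶ B) : Submodule R ((W ⟶ E) × (X ⟶ B)) where
  carrier := {s | s.1 ≫ p = i ≫ s.2}
  add_mem' {s t} hs ht := by
    replace hs : s.1 ≫ p = i ≫ s.2 := hs
    replace ht : t.1 ≫ p = i ≫ t.2 := ht
    change (s.1 + t.1) ≫ p = i ≫ (s.2 + t.2)
    rw [Preadditive.add_comp, Preadditive.comp_add, hs, ht]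
  zero_mem' := by
    change (0 : W ⟶ E) ≫ p = i ≫ (0 : X ⟶ B)
    rw [zero_comp, comp_zero]
  smul_mem' r s hs := by
    replace hs : s.1 ≫ p = i ≫ s.2 := hs
    change (r • s.1) ≫ p = i ≫ (r • s.2)
    rw [Linear.smul_comp, Linear.comp_smul, hs]

/-- The `R`-linear map which sends `l : X ⟶ E` to the square with sides `i ≫ l`
and `l ≫ p`. -/
def toSq {W X E B : C} (i : W ⟶ X) (p : E ⟶ B) : (X ⟶ E) →ₗ[R] Sq R i p where
  toFun l := ⟨(i ≫ l, l ≫ p), Category.assoc _ _ _⟩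
  map_add' _ _ := by ext <;> simp
  map_smul' _ _ := by ext <;> simp

/-- `i` has the enriched left lifting property against `p`: the map from diagonals to
commutative squares is a split epimorphism of `R`-modules. -/
def HasEnrichedLifting {W X E B : C} (i : W ⟶ X) (p : E ⟶ B) : Prop :=
  ∃ η : Sq R i p →ₗ[R] (X ⟶ E), toSq R i p ∘ₗ η = LinearMap.id

/-- The maps with the enriched right lifting property against all maps in `I`. -/
def enrichedRLP (I : MorphismProperty C) : MorphismProperty C := fun _ _ p ↦
  ∀ ⦃W X : C⦄ (i : W ⟶ X), I i → HasEnrichedLifting R i p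

/-- The maps with the enriched left lifting property against all maps in `P`. -/
def enrichedLLP (P : MorphismProperty C) : MorphismProperty C := fun _ _ i ↦
  ∀ ⦃E B : C⦄ (p : E ⟶ B), P p → HasEnrichedLifting R i p

/-- `(L, P)` is an enriched weak factorization system. -/
structure IsEnrichedWFS (L P : MorphismProperty C) : Prop where
  factorization : ∀ ⦃X Y : C⦄ (f : X ⟶ Y), ∃ (Z : C) (l : X ⟶ Z) (p : Z ⟶ Y),
    L l ∧ P p ∧ l ≫ p = f
  llp : L = enrichedLLP R P
  rlp : P = enrichedRLP R L

end Enriched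

namespace DGModule

variable {R : Type u} [CommRing R] {A : DGAlgebra R}

/-- The maps `i ⊗ V`, where `i` is in `I` and `V` is an `R`-module. -/
inductive tensored (I : MorphismProperty (DGModule A)) : MorphismProperty (DGModule A)
  | mk {P Q : DGModule A} (i : P ⟶ Q) (hi : I i) (V : ModuleCat.{u} R) :
      tensored I ((tensorRight V).map i)

/-- The enriched relative `I`-cell complexes: sequential composites of pushouts of
coproducts of maps `i ⊗ V`, where `i` is in `I` and `V` is an `R`-module. -/
def enrichedRelativeCellComplexes (I : MorphismProperty (DGModule A)) :
    MorphismProperty (DGModule A) :=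
  relativeCellComplexes (tensored I)

/-- The model structure on DG `A`-modules with weak equivalences `W`, cofibrations `Cof` and
fibrations `Fib` is compactly generated by `I` and `J` in the sense enriched in `R`-modules. -/
structure IsEnrichedCompactlyGenerated (W Cof Fib I J : MorphismProperty (DGModule A)) :
    Prop where
  isModelStructure : IsModelStructure W Cof Fib
  wfs_cof : IsEnrichedWFS R Cof (Fib ⊓ W)
  wfs_acyclicCof : IsEnrichedWFS R (Cof ⊓ W) Fib
  compact_I : HasCompactDomains I (tensored I)
  compact_J : HasCompactDomains J (tensored J)
  cof_eq : Cof = (enrichedRelativeCellComplexes I).retracts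
  acyclicCof_eq : Cof ⊓ W = (enrichedRelativeCellComplexes J).retracts
  fib_eq : Fib = enrichedRLP R J
  acyclicFib_eq : Fib ⊓ W = enrichedRLP R I

/-! ## The classes of maps of the two model structures -/

variable (A)

/-- The `r`-equivalences: homotopy equivalences of underlying DG `R`-modules. -/
def rEquivalences : MorphismProperty (DGModule A) :=
  (HomologicalComplex.homotopyEquivalences (ModuleCat.{u} R) (ComplexShape.down ℤ)).inverseImage
    (forget A)

/-- The `r`-fibrations: the maps with a section as maps of graded `R`-modules. -/
def rFibrations : MorphismProperty (DGModule A) := fun M N p ↦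
  ∀ n : ℤ, ∃ s : N.X.X n →ₗ[R] M.X.X n, (p.hom.f n).hom ∘ₗ s = LinearMap.id

/-- The `r`-cofibrations: the maps with the left lifting property against `r`-acyclic
`r`-fibrations. -/
def rCofibrations : MorphismProperty (DGModule A) := (rFibrations A ⊓ rEquivalences A).llp

/-- The `q`-equivalences: quasi-isomorphisms. -/
def qEquivalences : MorphismProperty (DGModule A) :=
  (HomologicalComplex.quasiIso (ModuleCat.{u} R) (ComplexShape.down ℤ)).inverseImage (forget A)

/-- The `q`-fibrations: degreewise surjections. -/
def qFibrations : MorphismProperty (DGModule A) := fun _ _ p ↦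
  ∀ n : ℤ, Function.Surjective (p.hom.f n).hom

/-- The `q`-cofibrations: the maps with the left lifting property against `q`-acyclic
`q`-fibrations. -/
def qCofibrations : MorphismProperty (DGModule A) := (qFibrations A ⊓ qEquivalences A).llp

end DGModule

namespace DGModule

variable {R : Type u} [CommRing R] {A : DGAlgebra R}

/-! Limits and colimits are those of underlying DG `R`-modules, since the action of `A` passes to
them by their universal properties. Maps out of the free sphere and the free disk are cycles and
arbitrary elements, linearly in the map. Hence lifting against `genJ` means surjectivity in each
degree, and lifting against `genI` means: given a cycle `z` upstairs and a chain `b` downstairs with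
`p z = d b`, find `e` with `d e = z` and `p e = b`. The enriched properties ask for the same
solutions, but linearly in families; `LiftsCycles` records this for `genI`.

Each model structure then needs three facts: the fibrations that are weak equivalences are exactly
the maps lifting against `genI`; maps lifting against all fibrations are weak equivalences; both
factorizations exist. The retract argument supplies the rest. For the second fact, a retraction
comes from the fibration to zero, and a homotopy from the contractible `pathObj`, which is an
`r`-fibration over its base. In the `q`-case the factorizations come from the ordinary small object
argument, since spheres are compact.

The difficulty is the `r`-factorization through `genI`. Attaching the universal family of cells at
every stage makes each family solvable one stage later, but a linear family of cycles in the colimit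
`Z` need not come from any single stage, so compactness of spheres does not suffice. Instead,
consider the part of the kernel of `p : Z ⟶ Y` that comes from stage `k`. It is a linear direct
summand in each degree: stages are split in `Z` because `envObj` is acyclic and `r`-fibrant, and
from the second stage on the map to `Y` is split. Linear choices of bounding chains give partial
contractions of each stage into a later one. Two such contractions differ by a map that anticommutes
with the differential; since the smaller stage is contractible, this difference is null-homotopic
there and can be corrected away (`exists_contraction_extension`). The corrected contractions agree
on growing stages and glue to a linear contraction on the union (`exists_contraction`), whence
`liftsCycles_of_sequence`. -/

lemma map_d {K L : ChainComplex (ModuleCat.{u} R) ℤ} (f : K ⟶ L) (n m : ℤ) (x : K.X n) :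
    (f.f m).hom ((K.d n m).hom x) = (L.d n m).hom ((f.f n).hom x) :=
  (ConcreteCategory.congr_hom (f.comm n m) x).symm

lemma d_d {K : ChainComplex (ModuleCat.{u} R) ℤ} (i j k : ℤ) (x : K.X i) :
    (K.d j k).hom ((K.d i j).hom x) = 0 :=
  ConcreteCategory.congr_hom (K.d_comp_d i j k) x

lemma hom_ext_apply {M N : DGModule A} {f g : M ⟶ N}
    (h : ∀ n (x : M.X.X n), (f.hom.f n).hom x = (g.hom.f n).hom x) : f = g :=
  hom_ext (HomologicalComplex.hom_ext _ _ fun n ↦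
    ModuleCat.hom_ext (LinearMap.ext (h n)))

/-- A map of DG `A`-modules from its components. -/
def mkHom {M N : DGModule A} (f : ∀ n, M.X.X n →ₗ[R] N.X.X n)
    (hd : ∀ n m (_ : m + 1 = n) (x : M.X.X n),
      (N.X.d n m).hom (f n x) = f m ((M.X.d n m).hom x))
    (hs : ∀ {i j k : ℤ} (h : i + j = k) (a : A.X.X i) (x : M.X.X j),
      f k (M.smul h a x) = N.smul h a (f j x)) : M ⟶ N :=
  Hom.mk
    { f n := ModuleCat.ofHom (f n)
      comm' n m h := ModuleCat.hom_ext (LinearMap.ext (hd n m h)) } hs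

/-! ### Colimits of DG `A`-modules -/

section Colimits

variable {J : Type v} [Category.{w} J] (F : J ⥤ DGModule A)

section

variable (c : Cocone (F ⋙ forget A))
  (hc : ∀ n, IsColimit ((HomologicalComplex.eval _ _ n).mapCocone c))

/-- The components of a cocone of underlying DG `R`-modules. -/
def coconeLeg (l : J) (n : ℤ) : (F.obj l).X.X n →ₗ[R] c.pt.X n := ((c.ι.app l).f n).hom

lemma coconeLeg_d (l : J) (n m : ℤ) (x : (F.obj l).X.X n) :
    (c.pt.d n m).hom (coconeLeg F c l n x) =
      coconeLeg F c l m (((F.obj l).X.d n m).hom x) :=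
  (map_d (c.ι.app l) n m x).symm

lemma coconeLeg_w {j j' : J} (φ : j ⟶ j') (n : ℤ) (x : (F.obj j).X.X n) :
    coconeLeg F c j' n (((F.map φ).hom.f n).hom x) = coconeLeg F c j n x :=
  ConcreteCategory.congr_hom (HomologicalComplex.congr_hom (c.w φ) n) x

include hc in
lemma cocone_hom_ext {n : ℤ} {P : Type u} [AddCommGroup P] [Module R P]
    {f g : c.pt.X n →ₗ[R] P}
    (h : ∀ j (x : (F.obj j).X.X n), f (coconeLeg F c j n x) = g (coconeLeg F c j n x)) :
    f = g := by
  have := (hc n).hom_ext (f := ModuleCat.ofHom f) (f' := ModuleCat.ofHom g)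
    fun j ↦ ModuleCat.hom_ext (LinearMap.ext (h j))
  exact congrArg ModuleCat.Hom.hom this

include hc in
lemma cocone_desc {n : ℤ} {P : Type u} [AddCommGroup P] [Module R P]
    (f : ∀ l, (F.obj l).X.X n →ₗ[R] P)
    (hf : ∀ l l' (φ : l ⟶ l') x, f l' (((F.map φ).hom.f n).hom x) = f l x) :
    ∃ g : c.pt.X n →ₗ[R] P, ∀ l x, g (coconeLeg F c l n x) = f l x :=
  ⟨((hc n).desc (Cocone.mk (ModuleCat.of R P)
      { app l := ModuleCat.ofHom (f l)
        naturality l l' φ := ModuleCat.hom_ext (LinearMap.ext (hf l l' φ)) })).hom,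
    fun l x ↦ ConcreteCategory.congr_hom ((hc n).fac (Cocone.mk (ModuleCat.of R P)
      { app l := ModuleCat.ofHom (f l)
        naturality l l' φ := ModuleCat.hom_ext (LinearMap.ext (hf l l' φ)) }) l) x⟩

include hc in
-- With the module variable placed first, the action is a linear map out of a colimit with values in
-- a module of linear maps from `A_i`, so the universal property applies directly.
lemma exists_colimitAct {i j k : ℤ} (h : i + j = k) :
    ∃ g : c.pt.X j →ₗ[R] A.X.X i →ₗ[R] c.pt.X k, ∀ l x,
      g (coconeLeg F c l j x) = (coconeLeg F c l k) ∘ₗ ((F.obj l).smul h).flip x :=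
  cocone_desc F c hc
    (fun l ↦ LinearMap.compRight R (coconeLeg F c l k) ∘ₗ ((F.obj l).smul h).flip)
    fun l l' φ x ↦ LinearMap.ext fun a ↦ by
      change coconeLeg F c l' k ((F.obj l').smul h a (((F.map φ).hom.f j).hom x)) =
        coconeLeg F c l k ((F.obj l).smul h a x)
      rw [← (F.map φ).map_smul, coconeLeg_w]

/-- The action of `A` on the colimit of the underlying DG `R`-modules. -/
noncomputable def colimitAct {i j k : ℤ} (h : i + j = k) :
    A.X.X i →ₗ[R] c.pt.X j →ₗ[R] c.pt.X k :=
  (exists_colimitAct F c hc h).choose.flip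

lemma colimitAct_leg {i j k : ℤ} (h : i + j = k) (l : J) (a : A.X.X i)
    (x : (F.obj l).X.X j) :
    colimitAct F c hc h a (coconeLeg F c l j x) =
      coconeLeg F c l k ((F.obj l).smul h a x) :=
  LinearMap.congr_fun ((exists_colimitAct F c hc h).choose_spec l x) a

/-- The DG `A`-module structure on the colimit of the underlying DG `R`-modules. -/
noncomputable def colimitObj : DGModule A where
  X := c.pt
  smul h := colimitAct F c hc h
  one_smul n x := by
    refine LinearMap.congr_fun (cocone_hom_ext F c hc
      (f := colimitAct F c hc (zero_add n) A.one) (g := LinearMap.id) fun l x ↦ ?_) x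
    rw [colimitAct_leg, one_smul, LinearMap.id_apply]
  mul_smul {i j k ij jk ijk} hij hjk h₁ h₂ a b x := by
    refine LinearMap.congr_fun (cocone_hom_ext F c hc
      (f := colimitAct F c hc h₁ (A.mul hij a b))
      (g := colimitAct F c hc h₂ a ∘ₗ colimitAct F c hc hjk b) fun l x ↦ ?_) x
    simp only [LinearMap.comp_apply, colimitAct_leg]
    rw [mul_smul (F.obj l) hij hjk h₁ h₂]
  d_smul {i j k i' j' k'} hi hj hk h a x := by
    refine LinearMap.congr_fun (cocone_hom_ext F c hc
      (f := (c.pt.d k k').hom ∘ₗ colimitAct F c hc h a)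
      (g := colimitAct F c hc (by omega : i' + j = k') ((A.X.d i i').hom a) +
        i.negOnePow • (colimitAct F c hc (by omega : i + j' = k') a ∘ₗ
          (c.pt.d j j').hom)) fun l x ↦ ?_) x
    simp only [LinearMap.comp_apply, LinearMap.add_apply, LinearMap.smul_apply,
      Units.smul_def, colimitAct_leg, coconeLeg_d]
    rw [d_smul (F.obj l) hi hj hk h]
    simp [Units.smul_def]

/-- The colimit cocone of DG `A`-modules over a colimit cocone of DG `R`-modules. -/
noncomputable def colimitCocone : Cocone F where
  pt := colimitObj F c hc
  ι :=
    { app l := Hom.mk (N := colimitObj F c hc) (c.ι.app l)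
        fun h a x ↦ (colimitAct_leg F c hc h l a x).symm
      naturality _ _ φ := hom_ext (c.ι.naturality φ) }

lemma desc_coconeLeg (hc' : IsColimit c) (s : Cocone F) (l : J) (n : ℤ)
    (x : (F.obj l).X.X n) :
    ((hc'.desc ((forget A).mapCocone s)).f n).hom (coconeLeg F c l n x) =
      ((s.ι.app l).hom.f n).hom x :=
  ConcreteCategory.congr_hom (HomologicalComplex.congr_hom
    (hc'.fac ((forget A).mapCocone s) l) n) x

/-- The universal property of `colimitCocone`. -/
noncomputable def isColimitColimitCocone (hc' : IsColimit c) :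
    IsColimit (colimitCocone F c hc) where
  desc s := Hom.mk (M := colimitObj F c hc) (hc'.desc ((forget A).mapCocone s))
    fun {i j k} h a x ↦ by
      refine LinearMap.congr_fun (cocone_hom_ext F c hc
        (f := ((hc'.desc ((forget A).mapCocone s)).f k).hom ∘ₗ colimitAct F c hc h a)
        (g := s.pt.smul h a ∘ₗ ((hc'.desc ((forget A).mapCocone s)).f j).hom)
        fun l x ↦ ?_) x
      change ((hc'.desc ((forget A).mapCocone s)).f k).hom
          (colimitAct F c hc h a (coconeLeg F c l j x)) =
        s.pt.smul h a (((hc'.desc ((forget A).mapCocone s)).f j).hom (coconeLeg F c l j x))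
      rw [colimitAct_leg]
      refine (desc_coconeLeg F c hc' s l k _).trans (((s.ι.app l).map_smul h a x).trans ?_)
      exact congrArg _ (desc_coconeLeg F c hc' s l j x).symm
  fac s l := hom_ext (hc'.fac ((forget A).mapCocone s) l)
  uniq s m hm := hom_ext (hc'.uniq ((forget A).mapCocone s) m.hom
    fun l ↦ congrArg Hom.hom (hm l))

end

variable [HasColimitsOfShape J (ModuleCat.{u} R)]

/-- A colimit cocone of `F` which is preserved by `forget A`. -/
noncomputable def colimitCoconeOfForget : ColimitCocone F where
  cocone := colimitCocone F (colimit.cocone _)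
    fun n ↦ isColimitOfPreserves (HomologicalComplex.eval _ _ n) (colimit.isColimit _)
  isColimit := isColimitColimitCocone F _ _ (colimit.isColimit _)

instance : HasColimitsOfShape J (DGModule A) where
  has_colimit F := ⟨⟨colimitCoconeOfForget F⟩⟩

instance : PreservesColimitsOfShape J (forget A) where
  preservesColimit {F} := preservesColimit_of_preserves_colimit_cocone
    (colimitCoconeOfForget F).isColimit (colimit.isColimit (F ⋙ forget A))

end Colimits

/-! ### Limits of DG `A`-modules -/

section Limits

variable {J : Type v} [Category.{w} J] (F : J ⥤ DGModule A)

section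

variable (c : Cone (F ⋙ forget A))
  (hc : ∀ n, IsLimit ((HomologicalComplex.eval _ _ n).mapCone c))

/-- The components of a cone of underlying DG `R`-modules. -/
def coneLeg (l : J) (n : ℤ) : c.pt.X n →ₗ[R] (F.obj l).X.X n := ((c.π.app l).f n).hom

lemma coneLeg_d (l : J) (n m : ℤ) (x : c.pt.X n) :
    coneLeg F c l m ((c.pt.d n m).hom x) = ((F.obj l).X.d n m).hom (coneLeg F c l n x) :=
  map_d (c.π.app l) n m x

lemma coneLeg_w {j j' : J} (φ : j ⟶ j') (n : ℤ) (x : c.pt.X n) :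
    ((F.map φ).hom.f n).hom (coneLeg F c j n x) = coneLeg F c j' n x :=
  ConcreteCategory.congr_hom (HomologicalComplex.congr_hom (c.w φ) n) x

include hc in
lemma cone_hom_ext {n : ℤ} {P : Type u} [AddCommGroup P] [Module R P]
    {f g : P →ₗ[R] c.pt.X n}
    (h : ∀ l (x : P), coneLeg F c l n (f x) = coneLeg F c l n (g x)) : f = g := by
  have := (hc n).hom_ext (f := ModuleCat.ofHom f) (f' := ModuleCat.ofHom g)
    fun j ↦ ModuleCat.hom_ext (LinearMap.ext (h j))
  exact congrArg ModuleCat.Hom.hom this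

include hc in
lemma cone_lift {n : ℤ} {P : Type u} [AddCommGroup P] [Module R P]
    (f : ∀ l, P →ₗ[R] (F.obj l).X.X n)
    (hf : ∀ l l' (φ : l ⟶ l') x, f l' x = ((F.map φ).hom.f n).hom (f l x)) :
    ∃ g : P →ₗ[R] c.pt.X n, ∀ l x, coneLeg F c l n (g x) = f l x :=
  ⟨((hc n).lift (Cone.mk (ModuleCat.of R P)
      { app l := ModuleCat.ofHom (f l)
        naturality l l' φ := ModuleCat.hom_ext (LinearMap.ext (hf l l' φ)) })).hom,
    fun l x ↦ ConcreteCategory.congr_hom ((hc n).fac (Cone.mk (ModuleCat.of R P)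
      { app l := ModuleCat.ofHom (f l)
        naturality l l' φ := ModuleCat.hom_ext (LinearMap.ext (hf l l' φ)) }) l) x⟩

include hc in
-- Dually to colimits, the action must be a map into the limit, so it is written as a linear map out
-- of a tensor product.
lemma exists_limitAct {i j k : ℤ} (h : i + j = k) :
    ∃ g : A.X.X i ⊗[R] c.pt.X j →ₗ[R] c.pt.X k, ∀ l x,
      coneLeg F c l k (g x) =
        TensorProduct.lift (((F.obj l).smul h).compl₂ (coneLeg F c l j)) x :=
  cone_lift F c hc _ fun l l' φ ↦ LinearMap.congr_fun
    (f := TensorProduct.lift (((F.obj l').smul h).compl₂ (coneLeg F c l' j)))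
    (g := ((F.map φ).hom.f k).hom ∘ₗ
      TensorProduct.lift (((F.obj l).smul h).compl₂ (coneLeg F c l j)))
    (TensorProduct.ext' fun a x ↦ by
      change (F.obj l').smul h a (coneLeg F c l' j x) =
        ((F.map φ).hom.f k).hom ((F.obj l).smul h a (coneLeg F c l j x))
      rw [(F.map φ).map_smul, coneLeg_w])

/-- The action of `A` on the limit of the underlying DG `R`-modules. -/
noncomputable def limitAct {i j k : ℤ} (h : i + j = k) :
    A.X.X i →ₗ[R] c.pt.X j →ₗ[R] c.pt.X k :=
  TensorProduct.curry (exists_limitAct F c hc h).choose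

lemma coneLeg_limitAct {i j k : ℤ} (h : i + j = k) (l : J) (a : A.X.X i) (x : c.pt.X j) :
    coneLeg F c l k (limitAct F c hc h a x) = (F.obj l).smul h a (coneLeg F c l j x) :=
  (exists_limitAct F c hc h).choose_spec l (a ⊗ₜ[R] x)

/-- The DG `A`-module structure on the limit of the underlying DG `R`-modules. -/
noncomputable def limitObj : DGModule A where
  X := c.pt
  smul h := limitAct F c hc h
  one_smul n x := by
    refine LinearMap.congr_fun (cone_hom_ext F c hc
      (f := limitAct F c hc (zero_add n) A.one) (g := LinearMap.id) fun l x ↦ ?_) x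
    rw [coneLeg_limitAct, one_smul, LinearMap.id_apply]
  mul_smul {i j k ij jk ijk} hij hjk h₁ h₂ a b x := by
    refine LinearMap.congr_fun (cone_hom_ext F c hc
      (f := limitAct F c hc h₁ (A.mul hij a b))
      (g := limitAct F c hc h₂ a ∘ₗ limitAct F c hc hjk b) fun l x ↦ ?_) x
    simp only [LinearMap.comp_apply, coneLeg_limitAct]
    rw [mul_smul (F.obj l) hij hjk h₁ h₂]
  d_smul {i j k i' j' k'} hi hj hk h a x := by
    refine LinearMap.congr_fun (cone_hom_ext F c hc
      (f := (c.pt.d k k').hom ∘ₗ limitAct F c hc h a)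
      (g := limitAct F c hc (by omega : i' + j = k') ((A.X.d i i').hom a) +
        i.negOnePow • (limitAct F c hc (by omega : i + j' = k') a ∘ₗ (c.pt.d j j').hom))
      fun l x ↦ ?_) x
    simp only [LinearMap.comp_apply, LinearMap.add_apply, LinearMap.smul_apply,
      Units.smul_def, map_add, map_zsmul, coneLeg_d, coneLeg_limitAct]
    rw [d_smul (F.obj l) hi hj hk h, Units.smul_def]

/-- The limit cone of DG `A`-modules over a limit cone of DG `R`-modules. -/
noncomputable def limitCone : Cone F where
  pt := limitObj F c hc
  π :=
    { app l := Hom.mk (M := limitObj F c hc) (c.π.app l)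
        fun h a x ↦ coneLeg_limitAct F c hc h l a x
      naturality _ _ φ := hom_ext (c.π.naturality φ) }

lemma coneLeg_lift (hc' : IsLimit c) (s : Cone F) (l : J) (n : ℤ) (x : s.pt.X.X n) :
    coneLeg F c l n (((hc'.lift ((forget A).mapCone s)).f n).hom x) =
      ((s.π.app l).hom.f n).hom x :=
  ConcreteCategory.congr_hom (HomologicalComplex.congr_hom
    (hc'.fac ((forget A).mapCone s) l) n) x

/-- The universal property of `limitCone`. -/
noncomputable def isLimitLimitCone (hc' : IsLimit c) : IsLimit (limitCone F c hc) where
  lift s := Hom.mk (N := limitObj F c hc) (hc'.lift ((forget A).mapCone s))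
    fun {i j k} h a x ↦ by
      refine LinearMap.congr_fun (cone_hom_ext F c hc
        (f := ((hc'.lift ((forget A).mapCone s)).f k).hom ∘ₗ s.pt.smul h a)
        (g := limitAct F c hc h a ∘ₗ ((hc'.lift ((forget A).mapCone s)).f j).hom)
        fun l x ↦ ?_) x
      refine (coneLeg_lift F c hc' s l k _).trans (((s.π.app l).map_smul h a x).trans ?_)
      refine Eq.trans ?_ (coneLeg_limitAct F c hc h l a _).symm
      exact congrArg _ (coneLeg_lift F c hc' s l j x).symm
  fac s l := hom_ext (hc'.fac ((forget A).mapCone s) l)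
  uniq s m hm := hom_ext (hc'.uniq ((forget A).mapCone s) m.hom
    fun l ↦ congrArg Hom.hom (hm l))

end

instance [HasLimitsOfShape J (ModuleCat.{u} R)] : HasLimitsOfShape J (DGModule A) where
  has_limit F := ⟨⟨{
    cone := limitCone F (limit.cone _)
      fun n ↦ isLimitOfPreserves (HomologicalComplex.eval _ _ n) (limit.isLimit _)
    isLimit := isLimitLimitCone F _ _ (limit.isLimit _) }⟩⟩

end Limits

instance : HasColimits (DGModule A) where

instance : HasLimits (DGModule A) where

end DGModule

/-! ### The universal property of extension of scalars -/

namespace ExtendScalars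

variable {R : Type u} [CommRing R] {A : DGAlgebra R} {K : ChainComplex (ModuleCat.{u} R) ℤ}

lemma obj_d_ι {n m i j i' j' : ℤ} (h : i + j = n) (hi : i' + 1 = i) (hj : j' + 1 = j)
    (hm : m + 1 = n) (a : A.X.X i) (x : K.X j) :
    (((extendScalars A).obj K).X.d n m).hom (ι A K h (a ⊗ₜ x)) =
      ι A K (by omega : i' + j = m) ((A.X.d i i').hom a ⊗ₜ x) +
        i.negOnePow • ι A K (by omega : i + j' = m) (a ⊗ₜ (K.d j j').hom x) :=
  d_ι A K h hi hj hm a x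

lemma obj_smul_ι {i j k p q ip : ℤ} (h : i + j = k) (hpq : p + q = j) (hip : i + p = ip)
    (a : A.X.X i) (b : A.X.X p) (x : K.X q) :
    ((extendScalars A).obj K).smul h a (ι A K hpq (b ⊗ₜ x)) =
      ι A K (by omega : ip + q = k) (A.mul hip a b ⊗ₜ x) :=
  act_ι A K h hpq hip a b x

variable (A) in
/-- The unit `x ↦ 1 ⊗ x` of the extension of scalars. -/
noncomputable def unit (n : ℤ) : K.X n →ₗ[R] ((extendScalars A).obj K).X.X n :=
  ι A K (zero_add n) ∘ₗ TensorProduct.mk R (A.X.X 0) (K.X n) A.one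

/-- The Leibniz rule applied to `1 * 1` gives `d 1 = d 1 + d 1`. -/
lemma _root_.DGAlgebra.d_one (A : DGAlgebra R) (m : ℤ) : (A.X.d 0 m).hom A.one = 0 := by
  by_cases hm : m + 1 = 0
  · have h := A.d_mul hm hm hm (zero_add 0) A.one A.one
    obtain rfl : m = -1 := by omega
    rw [A.one_mul, A.mul_one, A.one_mul, Int.negOnePow_zero, _root_.one_smul] at h
    exact left_eq_add.mp h
  · rw [A.X.shape 0 m hm]
    rfl

lemma d_unit (n m : ℤ) (x : K.X n) :
    (((extendScalars A).obj K).X.d n m).hom (unit A n x) = unit A m ((K.d n m).hom x) := by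
  by_cases hm : m + 1 = n
  · refine (obj_d_ι (zero_add n) (by omega : (-1 : ℤ) + 1 = 0) hm hm A.one x).trans ?_
    rw [A.d_one, TensorProduct.zero_tmul, map_zero, zero_add, Int.negOnePow_zero,
      _root_.one_smul]
    rfl
  · rw [HomologicalComplex.shape _ _ _ hm, K.shape _ _ hm]
    exact (map_zero _).symm

lemma smul_unit {i j k : ℤ} (h : i + j = k) (a : A.X.X i) (x : K.X j) :
    ((extendScalars A).obj K).smul h a (unit A j x) = ι A K h (a ⊗ₜ x) := by
  refine (obj_smul_ι h (zero_add j) (add_zero i) a A.one x).trans ?_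
  rw [A.mul_one]

variable {M : DGModule A}

lemma hom_ext_unit {f g : (extendScalars A).obj K ⟶ M}
    (h : ∀ n (x : K.X n), (f.hom.f n).hom (unit A n x) = (g.hom.f n).hom (unit A n x)) :
    f = g := by
  refine DGModule.hom_ext (HomologicalComplex.hom_ext _ _ fun n ↦ ModuleCat.hom_ext ?_)
  refine deg_hom_ext fun i j hij a x ↦ ?_
  rw [← smul_unit hij a x]
  exact (f.map_smul hij a _).trans ((congrArg _ (h j x)).trans (g.map_smul hij a _).symm)

/-- The map of DG `A`-modules `a ⊗ x ↦ a (g x)` which extends a map `g` of DG `R`-modules,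
in degree `n`. -/
noncomputable def extendDeg (g : K ⟶ M.X) (n : ℤ) : Deg A K n →ₗ[R] M.X.X n :=
  DirectSum.toModule R _ _ fun p ↦
    TensorProduct.lift ((M.smul p.2).compl₂ (g.f p.1.2).hom)

lemma extendDeg_ι (g : K ⟶ M.X) {i j n : ℤ} (h : i + j = n) (a : A.X.X i) (x : K.X j) :
    extendDeg g n (ι A K h (a ⊗ₜ x)) = M.smul h a ((g.f j).hom x) := by
  rw [extendDeg]
  conv_lhs => rw [ι]
  rw [DirectSum.toModule_lof]
  simp

/-- The map of DG `A`-modules which extends a map of DG `R`-modules. -/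
noncomputable def extend (g : K ⟶ M.X) : (extendScalars A).obj K ⟶ M :=
  DGModule.mkHom (M := (extendScalars A).obj K) (fun n ↦ extendDeg g n)
    (fun n m hm x ↦ by
      refine LinearMap.congr_fun (deg_hom_ext (f := (M.X.d n m).hom ∘ₗ extendDeg g n)
        (g := extendDeg g m ∘ₗ d A K n m) fun i j h a x ↦ ?_) x
      rw [LinearMap.comp_apply, LinearMap.comp_apply, extendDeg_ι,
        M.d_smul (sub_add_cancel i 1) (sub_add_cancel j 1) hm,
        d_ι A K h (sub_add_cancel i 1) (sub_add_cancel j 1) hm, map_add, Units.smul_def,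
        Units.smul_def, map_zsmul, extendDeg_ι, extendDeg_ι, DGModule.map_d])
    (fun {i j k} h a x ↦ by
      refine LinearMap.congr_fun (deg_hom_ext (f := extendDeg g k ∘ₗ act A K h a)
        (g := M.smul h a ∘ₗ extendDeg g j)
        fun p q hpq b y ↦ ?_) x
      rw [LinearMap.comp_apply, LinearMap.comp_apply, act_ι A K h hpq rfl,
        extendDeg_ι, extendDeg_ι, M.mul_smul rfl hpq (by omega) h])

lemma extend_unit (g : K ⟶ M.X) (n : ℤ) (x : K.X n) :
    ((extend g).hom.f n).hom (unit A n x) = (g.f n).hom x :=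
  (extendDeg_ι g (zero_add n) A.one x).trans (M.one_smul n _)

/-- The map of DG `R`-modules adjoint to a map of DG `A`-modules. -/
noncomputable def restrict (f : (extendScalars A).obj K ⟶ M) : K ⟶ M.X where
  f n := ModuleCat.ofHom ((f.hom.f n).hom ∘ₗ unit A n)
  comm' n m _ := ModuleCat.hom_ext (LinearMap.ext fun x ↦
    (DGModule.map_d f.hom n m _).symm.trans (congrArg _ (d_unit n m x)))

lemma map_unit {L : ChainComplex (ModuleCat.{u} R) ℤ} (g : K ⟶ L) (n : ℤ) (x : K.X n) :
    (((extendScalars A).map g).hom.f n).hom (unit A n x) = unit A n ((g.f n).hom x) :=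
  mapDeg_ι A g (zero_add n) A.one x

end ExtendScalars

/-! ### Coordinates on spheres and disks -/

section Generators

lemma down_rel (n : ℤ) : (ComplexShape.down ℤ).Rel n (n - 1) := sub_add_cancel n 1

variable (R : Type u) [CommRing R]

/-- The sphere in its only nonzero degree. -/
noncomputable def sphereIso (n : ℤ) : (sphere R n).X n ≅ ModuleCat.of R R :=
  HomologicalComplex.singleObjXSelf (ComplexShape.down ℤ) n (ModuleCat.of R R)

/-- The disk in its upper nonzero degree. -/
noncomputable def diskIso₀ (n : ℤ) : (disk R n).X n ≅ ModuleCat.of R R :=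
  HomologicalComplex.doubleXIso₀ (𝟙 (ModuleCat.of R R)) (down_rel n)

/-- The disk in its lower nonzero degree. -/
noncomputable def diskIso₁ (n : ℤ) : (disk R n).X (n - 1) ≅ ModuleCat.of R R :=
  HomologicalComplex.doubleXIso₁ (𝟙 (ModuleCat.of R R)) (down_rel n) (by omega)

lemma sphereIso_inv_sphereToDisk (n : ℤ) :
    (sphereIso R (n - 1)).inv ≫ (sphereToDisk R n).f (n - 1) = (diskIso₁ R n).inv :=
  (congrArg _ (HomologicalComplex.mkHomFromSingle_f _ _)).trans (Iso.inv_hom_id_assoc _ _)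

lemma diskIso₀_inv_d (n : ℤ) :
    (diskIso₀ R n).inv ≫ (disk R n).d n (n - 1) = (diskIso₁ R n).inv := by
  have h : (disk R n).d n (n - 1) =
      (diskIso₀ R n).hom ≫ 𝟙 (ModuleCat.of R R) ≫ (diskIso₁ R n).inv :=
    HomologicalComplex.double_d _ (down_rel n) (by omega)
  rw [h, Iso.inv_hom_id_assoc, Category.id_comp]

end Generators

/-! ### Maps out of free spheres and disks -/

namespace DGModule

variable {R : Type u} [CommRing R] {A : DGAlgebra R}

/-- Evaluation of maps of DG `A`-modules at an element of the source. -/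
def evalAt {P : DGModule A} {n : ℤ} (x : P.X.X n) (M : DGModule A) :
    (P ⟶ M) →ₗ[R] M.X.X n where
  toFun f := (f.hom.f n).hom x
  map_add' _ _ := rfl
  map_smul' _ _ := rfl

lemma evalAt_comp {P : DGModule A} {n : ℤ} (x : P.X.X n) {M N : DGModule A} (f : P ⟶ M)
    (g : M ⟶ N) : evalAt x N (f ≫ g) = (g.hom.f n).hom (evalAt x M f) := rfl

lemma d_evalAt {P : DGModule A} {n : ℤ} (x : P.X.X n) {M : DGModule A} (f : P ⟶ M) (m : ℤ) :
    (M.X.d n m).hom (evalAt x M f) = evalAt ((P.X.d n m).hom x) M f :=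
  (map_d f.hom n m x).symm

variable (A)

/-- The `n`-sphere of DG `A`-modules. -/
noncomputable abbrev sph (n : ℤ) : DGModule A := (extendScalars A).obj (sphere R n)

/-- The `n`-disk of DG `A`-modules. -/
noncomputable abbrev dsk (n : ℤ) : DGModule A := (extendScalars A).obj (disk R n)

/-- The inclusion of the boundary of the `n`-disk of DG `A`-modules. -/
noncomputable abbrev sphToDsk (n : ℤ) : sph A (n - 1) ⟶ dsk A n :=
  (extendScalars A).map (sphereToDisk R n)

/-- The generator of the `n`-sphere. -/
noncomputable def sphGen (n : ℤ) : (sph A n).X.X n :=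
  ExtendScalars.unit A n ((sphereIso R n).inv.hom (1 : R))

/-- The generator of the `n`-disk. -/
noncomputable def dskGen (n : ℤ) : (dsk A n).X.X n :=
  ExtendScalars.unit A n ((diskIso₀ R n).inv.hom (1 : R))

variable {A}

lemma d_sphGen (n m : ℤ) : ((sph A n).X.d n m).hom (sphGen A n) = 0 := by
  refine (ExtendScalars.d_unit n m _).trans ?_
  have : (sphere R n).d n m = 0 := HomologicalComplex.single_obj_d _ _ _ _ _
  rw [this]
  exact map_zero _

lemma sphToDsk_sphGen (n : ℤ) :
    ((sphToDsk A n).hom.f (n - 1)).hom (sphGen A (n - 1)) =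
      ((dsk A n).X.d n (n - 1)).hom (dskGen A n) := by
  have h : ((sphereToDisk R n).f (n - 1)).hom ((sphereIso R (n - 1)).inv.hom (1 : R)) =
      ((disk R n).d n (n - 1)).hom ((diskIso₀ R n).inv.hom (1 : R)) :=
    ConcreteCategory.congr_hom
      ((sphereIso_inv_sphereToDisk R n).trans (diskIso₀_inv_d R n).symm) (1 : R)
  rw [sphGen, dskGen, ExtendScalars.map_unit, ExtendScalars.d_unit, h]

lemma sph_hom_ext {n : ℤ} {M : DGModule A} {f g : sph A n ⟶ M}
    (h : evalAt (sphGen A n) M f = evalAt (sphGen A n) M g) : f = g := by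
  have key : ExtendScalars.restrict f = ExtendScalars.restrict g :=
    HomologicalComplex.from_single_hom_ext <|
      (cancel_epi (sphereIso R n).inv).1 (ModuleCat.hom_ext (LinearMap.ext_ring h))
  exact ExtendScalars.hom_ext_unit fun m x ↦
    ConcreteCategory.congr_hom (HomologicalComplex.congr_hom key m) x

lemma dsk_hom_ext {n : ℤ} {M : DGModule A} {f g : dsk A n ⟶ M}
    (h : evalAt (dskGen A n) M f = evalAt (dskGen A n) M g) : f = g := by
  have key : ExtendScalars.restrict f = ExtendScalars.restrict g :=
    (HomologicalComplex.evalCompCoyonedaCorepresentableByDoubleId (down_rel n)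
      (by omega) (ModuleCat.of R R)).homEquiv.injective
        (ModuleCat.hom_ext (LinearMap.ext_ring h))
  exact ExtendScalars.hom_ext_unit fun m x ↦
    ConcreteCategory.congr_hom (HomologicalComplex.congr_hom key m) x

lemma exists_sph_hom {n : ℤ} {M : DGModule A} (x : M.X.X n)
    (hx : ∀ m, (M.X.d n m).hom x = 0) : ∃ f, evalAt (sphGen A n) M f = x := by
  let g : sphere R n ⟶ M.X := HomologicalComplex.mkHomFromSingle
    (ModuleCat.ofHom (LinearMap.toSpanSingleton R _ x)) fun k _ ↦
      ModuleCat.hom_ext (LinearMap.ext_ring (by simp [hx k]))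
  have hg : (sphereIso R n).inv ≫ g.f n =
      ModuleCat.ofHom (LinearMap.toSpanSingleton R _ x) :=
    (congrArg _ (HomologicalComplex.mkHomFromSingle_f _ _)).trans (Iso.inv_hom_id_assoc _ _)
  refine ⟨ExtendScalars.extend g, (ExtendScalars.extend_unit g n _).trans ?_⟩
  exact (ConcreteCategory.congr_hom hg (1 : R)).trans (_root_.one_smul R x)

lemma exists_dsk_hom {n : ℤ} {M : DGModule A} (x : M.X.X n) :
    ∃ f, evalAt (dskGen A n) M f = x := by
  let e := (HomologicalComplex.evalCompCoyonedaCorepresentableByDoubleId (down_rel n)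
      (by omega) (ModuleCat.of R R)).homEquiv (Y := M.X)
  let φ : ModuleCat.of R R ⟶ M.X.X n := ModuleCat.ofHom (LinearMap.toSpanSingleton R _ x)
  refine ⟨ExtendScalars.extend (K := disk R n) (e.symm φ),
    (ExtendScalars.extend_unit _ n _).trans ?_⟩
  exact (ConcreteCategory.congr_hom (e.apply_symm_apply φ) (1 : R)).trans (_root_.one_smul R x)

/-! ## Linear families of maps -/

section Families

variable {V : Type v} [AddCommGroup V] [Module R V]

/-- Unique pointwise solutions assemble linearly. With `φ` the evaluation at a generator, this turns
linear families of cycles or chains into linear families of maps out of spheres or disks. -/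
lemma exists_linear_lift {P Q : Type*} [AddCommGroup P] [Module R P] [AddCommGroup Q]
    [Module R Q] {φ : P →ₗ[R] Q} (hφ : Function.Injective φ) (z : V →ₗ[R] Q)
    (hz : ∀ v, ∃ p, φ p = z v) : ∃ ζ : V →ₗ[R] P, ∀ v, φ (ζ v) = z v :=
  ⟨LinearMap.codRestrictOfInjective z φ hφ hz,
    LinearMap.congr_fun (LinearMap.codRestrictOfInjective_comp z φ hφ hz)⟩

lemma exists_linear_sph {n : ℤ} {M : DGModule A} (z : V →ₗ[R] M.X.X n)
    (hz : ∀ v m, (M.X.d n m).hom (z v) = 0) :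
    ∃ ζ : V →ₗ[R] (sph A n ⟶ M), ∀ v, evalAt (sphGen A n) M (ζ v) = z v :=
  exists_linear_lift (fun _ _ h ↦ sph_hom_ext h) z fun v ↦ exists_sph_hom _ (hz v)

lemma exists_linear_dsk {n : ℤ} {M : DGModule A} (z : V →ₗ[R] M.X.X n) :
    ∃ ζ : V →ₗ[R] (dsk A n ⟶ M), ∀ v, evalAt (dskGen A n) M (ζ v) = z v :=
  exists_linear_lift (fun _ _ h ↦ dsk_hom_ext h) z fun _ ↦ exists_dsk_hom _

end Families

lemma evalAt_sphToDsk {n : ℤ} {M : DGModule A} (g : dsk A n ⟶ M) :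
    evalAt (sphGen A (n - 1)) M (sphToDsk A n ≫ g) =
      (M.X.d n (n - 1)).hom (evalAt (dskGen A n) M g) := by
  rw [d_evalAt, ← sphToDsk_sphGen]
  rfl

lemma sphToDsk_comm_iff {n : ℤ} {E B : DGModule A} (p : E ⟶ B) (f : sph A (n - 1) ⟶ E)
    (g : dsk A n ⟶ B) : f ≫ p = sphToDsk A n ≫ g ↔
      (p.hom.f (n - 1)).hom (evalAt (sphGen A (n - 1)) E f) =
        (B.X.d n (n - 1)).hom (evalAt (dskGen A n) B g) := by
  rw [← evalAt_sphToDsk, ← evalAt_comp]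
  exact ⟨fun h ↦ by rw [h], sph_hom_ext⟩

lemma d_evalAt_sphGen {n : ℤ} {M : DGModule A} (f : sph A n ⟶ M) (m : ℤ) :
    (M.X.d n m).hom (evalAt (sphGen A n) M f) = 0 := by
  rw [d_evalAt, d_sphGen]
  exact map_zero (f.hom.f m).hom

/-- Linear families of pairs consisting of a cycle `z` of `E` and a chain `b` of `Y` with
`p z = d b` are, after applying `j`, of the form `(d e, p' e)`. -/
def LiftsCycles {E E' Y : DGModule A} (j : E ⟶ E') (p : E ⟶ Y) (p' : E' ⟶ Y) : Prop :=
  ∀ ⦃n m : ℤ⦄ (_ : m + 1 = n) (V : Type u) [AddCommGroup V] [Module R V]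
    (z : V →ₗ[R] E.X.X m) (b : V →ₗ[R] Y.X.X n),
    (∀ v k, (E.X.d m k).hom (z v) = 0) →
    (∀ v, (p.hom.f m).hom (z v) = (Y.X.d n m).hom (b v)) →
    ∃ e : V →ₗ[R] E'.X.X n, (∀ v, (E'.X.d n m).hom (e v) = (j.hom.f m).hom (z v)) ∧
      ∀ v, (p'.hom.f n).hom (e v) = b v

/-- A pair of families `(z, b)` is the same as a linear map into the module of squares, so a linear
solution on all squares solves every family. Allowing `E'` to differ from `E` covers a single step
of cell attachment. -/
lemma liftsCycles_of_sq {E E' Y : DGModule A} {j : E ⟶ E'} {p : E ⟶ Y} {p' : E' ⟶ Y}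
    (H : ∀ n, ∃ η : Sq R (sphToDsk A n) p →ₗ[R] (dsk A n ⟶ E'), ∀ s,
      sphToDsk A n ≫ η s = s.1.1 ≫ j ∧ η s ≫ p' = s.1.2) : LiftsCycles j p p' := by
  intro n m hm V _ _ z b hz hzb
  obtain rfl : m = n - 1 := by omega
  obtain ⟨ζ, hζ⟩ := exists_linear_sph z hz
  obtain ⟨β, hβ⟩ := exists_linear_dsk b
  obtain ⟨η, hη⟩ := H n
  let σ : V →ₗ[R] Sq R (sphToDsk A n) p := (ζ.prod β).codRestrict _ fun v ↦ by
    refine (sphToDsk_comm_iff p (ζ v) (β v)).2 ?_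
    rw [hζ, hβ, hzb]
  refine ⟨evalAt (dskGen A n) E' ∘ₗ η ∘ₗ σ, fun v ↦ ?_, fun v ↦ ?_⟩
  · refine (evalAt_sphToDsk (η (σ v))).symm.trans ?_
    rw [(hη _).1, evalAt_comp]
    exact congrArg _ (hζ v)
  · exact (congrArg (evalAt (dskGen A n) Y) (hη (σ v)).2).trans (hβ v)

/-! ### Lifting against the generators in terms of elements -/

lemma enrichedRLP_genI_iff {E B : DGModule A} (p : E ⟶ B) :
    enrichedRLP R (genI A) p ↔ LiftsCycles (𝟙 E) p p := by
  constructor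
  · intro H
    refine liftsCycles_of_sq fun n ↦ ?_
    obtain ⟨η, hη⟩ := H (sphToDsk A n) ⟨n⟩
    refine ⟨η, fun s ↦ ?_⟩
    have := congrArg Subtype.val (LinearMap.congr_fun hη s)
    rw [Category.comp_id]
    exact ⟨congrArg Prod.fst this, congrArg Prod.snd this⟩
  · rintro H _ _ _ ⟨n⟩
    -- The tautological family, parametrized by all squares, is the universal one.
    let S := Sq R (sphToDsk A n) p
    obtain ⟨e, he, he'⟩ := H (sub_add_cancel n 1) S
      (evalAt (sphGen A (n - 1)) E ∘ₗ LinearMap.fst R _ _ ∘ₗ S.subtype)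
      (evalAt (dskGen A n) B ∘ₗ LinearMap.snd R _ _ ∘ₗ S.subtype)
      (fun s k ↦ d_evalAt_sphGen s.1.1 k) (fun s ↦ (sphToDsk_comm_iff p s.1.1 s.1.2).1 s.2)
    obtain ⟨η, hη⟩ := exists_linear_dsk e
    refine ⟨η, LinearMap.ext fun s ↦ Subtype.ext (Prod.ext ?_ ?_)⟩
    · refine sph_hom_ext ((evalAt_sphToDsk (η s)).trans ?_)
      rw [hη, he]
      rfl
    · refine dsk_hom_ext ((congrArg (p.hom.f n).hom (hη s)).trans (he' s))

lemma genI_rlp_iff {E B : DGModule A} (p : E ⟶ B) :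
    (genI A).rlp p ↔ ∀ ⦃n m : ℤ⦄ (_ : m + 1 = n) (z : E.X.X m) (b : B.X.X n),
      (∀ k, (E.X.d m k).hom z = 0) → (p.hom.f m).hom z = (B.X.d n m).hom b →
      ∃ e : E.X.X n, (E.X.d n m).hom e = z ∧ (p.hom.f n).hom e = b := by
  constructor
  · intro H n m hm z b hz hzb
    obtain rfl : m = n - 1 := by omega
    obtain ⟨ζ, rfl⟩ := exists_sph_hom z hz
    obtain ⟨β, rfl⟩ := exists_dsk_hom b
    have sq : CommSq ζ (sphToDsk A n) p β := ⟨(sphToDsk_comm_iff p ζ β).2 hzb⟩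
    have := H (sphToDsk A n) ⟨n⟩
    refine ⟨evalAt (dskGen A n) E sq.lift, ?_, ?_⟩
    · rw [← evalAt_sphToDsk, sq.fac_left]
    · rw [← evalAt_comp, sq.fac_right]
  · rintro H _ _ _ ⟨n⟩
    refine ⟨fun {f g} sq ↦ ?_⟩
    obtain ⟨e, he, he'⟩ := H (sub_add_cancel n 1) (evalAt (sphGen A (n - 1)) E f)
      (evalAt (dskGen A n) B g) (d_evalAt_sphGen f) ((sphToDsk_comm_iff p f g).1 sq.w)
    obtain ⟨l, rfl⟩ := exists_dsk_hom e
    exact ⟨⟨l, sph_hom_ext ((evalAt_sphToDsk l).trans he), dsk_hom_ext he'⟩⟩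

lemma extendScalars_zero_hom_ext {M : DGModule A}
    {f g : (extendScalars A).obj (0 : ChainComplex (ModuleCat.{u} R) ℤ) ⟶ M} : f = g := by
  refine ExtendScalars.hom_ext_unit fun n x ↦ ?_
  have h : IsZero ((0 : ChainComplex (ModuleCat.{u} R) ℤ).X n) :=
    (HomologicalComplex.eval _ _ n).map_isZero (isZero_zero _)
  have := ModuleCat.subsingleton_of_isZero h
  rw [Subsingleton.elim x 0]
  simp

/-- The inclusion of zero in the disk of DG `A`-modules. -/
noncomputable abbrev zeroToDsk (n : ℤ) :
    (extendScalars A).obj (0 : ChainComplex (ModuleCat.{u} R) ℤ) ⟶ dsk A n :=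
  (extendScalars A).map (0 : (0 : ChainComplex (ModuleCat.{u} R) ℤ) ⟶ disk R n)

lemma rFibrations_of_sq {E E' B : DGModule A} {p : E ⟶ B} {p' : E' ⟶ B}
    (H : ∀ n, ∃ η : Sq R (zeroToDsk n) p →ₗ[R] (dsk A n ⟶ E'), ∀ s, η s ≫ p' = s.1.2) :
    rFibrations A p' := by
  intro n
  obtain ⟨η, hη⟩ := H n
  obtain ⟨β, hβ⟩ := exists_linear_dsk (M := B) (n := n) LinearMap.id
  -- The source of `zeroToDsk` is zero, so every element of `B` in degree `n` defines a square.
  let σ : B.X.X n →ₗ[R] Sq R (zeroToDsk n) p := ((0 : _ →ₗ[R] _).prod β).codRestrict _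
    fun v ↦ extendScalars_zero_hom_ext
  refine ⟨evalAt (dskGen A n) E' ∘ₗ η ∘ₗ σ, LinearMap.ext fun y ↦ ?_⟩
  exact (congrArg (evalAt (dskGen A n) B) (hη (σ y))).trans (hβ y)

lemma enrichedRLP_genJ : enrichedRLP R (genJ A) = rFibrations A := by
  ext E B p
  constructor
  · intro H
    refine rFibrations_of_sq (p := p) fun n ↦ ?_
    obtain ⟨η, hη⟩ := H (zeroToDsk n) ⟨n⟩
    exact ⟨η, fun s ↦ congrArg (fun s ↦ s.1.2) (LinearMap.congr_fun hη s)⟩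
  · rintro H _ _ _ ⟨n⟩
    let S := Sq R (zeroToDsk n) p
    obtain ⟨s, hs⟩ := H n
    obtain ⟨η, hη⟩ := exists_linear_dsk
      (s ∘ₗ evalAt (dskGen A n) B ∘ₗ LinearMap.snd R _ _ ∘ₗ S.subtype)
    refine ⟨η, LinearMap.ext fun x ↦ Subtype.ext (Prod.ext extendScalars_zero_hom_ext ?_)⟩
    exact dsk_hom_ext ((congrArg (p.hom.f n).hom (hη x)).trans (LinearMap.congr_fun hs _))

lemma genJ_rlp : (genJ A).rlp = qFibrations A := by
  ext E B p
  constructor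
  · intro H n b
    obtain ⟨β, rfl⟩ := exists_dsk_hom b
    have sq : CommSq 0 (zeroToDsk n) p β := ⟨extendScalars_zero_hom_ext⟩
    have := H (zeroToDsk n) ⟨n⟩
    exact ⟨evalAt (dskGen A n) E sq.lift, by rw [← evalAt_comp, sq.fac_right]⟩
  · rintro H _ _ _ ⟨n⟩
    refine ⟨fun {f g} sq ↦ ?_⟩
    obtain ⟨e, he⟩ := H n (evalAt (dskGen A n) B g)
    obtain ⟨l, rfl⟩ := exists_dsk_hom e
    exact ⟨⟨l, extendScalars_zero_hom_ext, dsk_hom_ext he⟩⟩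

/-! ## Tensors and cotensors -/

section Tensor

variable {P M : DGModule A} (V : ModuleCat.{u} R)

/-- The map `P ⊗ V ⟶ M` which corresponds to a linear family of maps `P ⟶ M`, in
degree `n`. -/
noncomputable def tensorDescDeg (φ : V →ₗ[R] (P ⟶ M)) (n : ℤ) :
    P.X.X n ⊗[R] V →ₗ[R] M.X.X n :=
  TensorProduct.lift (LinearMap.mk₂ R (fun x v ↦ ((φ v).hom.f n).hom x)
    (fun _ _ _ ↦ map_add _ _ _) (fun _ _ _ ↦ map_smul _ _ _)
    (fun _ _ _ ↦ by simp) (fun _ _ _ ↦ by simp))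

/-- The map `P ⊗ V ⟶ M` which corresponds to a linear family of maps `P ⟶ M`. -/
noncomputable def tensorDesc (φ : V →ₗ[R] (P ⟶ M)) : (tensorRight V).obj P ⟶ M :=
  mkHom (M := (tensorRight V).obj P) (fun n ↦ tensorDescDeg V φ n)
    (fun n m _ x ↦ LinearMap.congr_fun (f := (M.X.d n m).hom ∘ₗ tensorDescDeg V φ n)
      (g := tensorDescDeg V φ m ∘ₗ (P.X.d n m).hom.rTensor V)
      (TensorProduct.ext' fun x v ↦ (map_d (φ v).hom n m x).symm) x)
    (fun {_ j k} h a x ↦ LinearMap.congr_fun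
      (f := tensorDescDeg V φ k ∘ₗ (P.smul h a).rTensor V)
      (g := M.smul h a ∘ₗ tensorDescDeg V φ j)
      (TensorProduct.ext' fun x v ↦ (φ v).map_smul h a x) x)

variable {V}

lemma tensor_hom_ext {f g : (tensorRight V).obj P ⟶ M}
    (h : ∀ n (x : P.X.X n) (v : V),
      (f.hom.f n).hom (x ⊗ₜ[R] v) = (g.hom.f n).hom (x ⊗ₜ[R] v)) : f = g :=
  hom_ext (HomologicalComplex.hom_ext _ _ fun n ↦
    ModuleCat.hom_ext (TensorProduct.ext' (h n)))

/-- The linear family of maps `P ⟶ M` which corresponds to a map `P ⊗ V ⟶ M`. -/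
noncomputable def tensorCurry (f : (tensorRight V).obj P ⟶ M) : V →ₗ[R] (P ⟶ M) where
  toFun v := mkHom (fun n ↦ (f.hom.f n).hom ∘ₗ (TensorProduct.mk R (P.X.X n) V).flip v)
    (fun n m _ x ↦ (map_d f.hom n m (x ⊗ₜ[R] v)).symm)
    (fun h a x ↦ f.map_smul h a (x ⊗ₜ[R] v))
  map_add' v w := hom_ext_apply fun n x ↦
    (congrArg (f.hom.f n).hom (TensorProduct.tmul_add x v w)).trans (map_add _ _ _)
  map_smul' r v := hom_ext_apply fun n x ↦
    (congrArg (f.hom.f n).hom (TensorProduct.tmul_smul r x v)).trans (map_smul _ _ _)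

end Tensor

/-- Maps out of `P ⊗ V` are linear families of maps out of `P` indexed by `V`; composing such a
family of squares with the linear section gives the diagonal. -/
lemma hasLiftingProperty_tensorRight {W X E B : DGModule A} {i : W ⟶ X} {p : E ⟶ B}
    (H : HasEnrichedLifting R i p) (V : ModuleCat.{u} R) :
    HasLiftingProperty ((tensorRight V).map i) p := by
  obtain ⟨η, hη⟩ := H
  refine ⟨fun {f g} sq ↦ ?_⟩
  let σ : V →ₗ[R] Sq R i p := ((tensorCurry f).prod (tensorCurry g)).codRestrict _ fun v ↦
    hom_ext_apply fun n x ↦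
      ConcreteCategory.congr_hom (HomologicalComplex.congr_hom (congrArg Hom.hom sq.w) n)
        (x ⊗ₜ[R] v)
  have h (v : V) := congrArg Subtype.val (LinearMap.congr_fun hη (σ v))
  refine ⟨⟨tensorDesc V (η ∘ₗ σ), tensor_hom_ext fun n x v ↦ ?_,
    tensor_hom_ext fun n x v ↦ ?_⟩⟩
  · exact ConcreteCategory.congr_hom (HomologicalComplex.congr_hom
      (congrArg Hom.hom (congrArg Prod.fst (h v))) n) x
  · exact ConcreteCategory.congr_hom (HomologicalComplex.congr_hom
      (congrArg Hom.hom (congrArg Prod.snd (h v))) n) x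

/-- The cotensor of a DG `A`-module `M` with an ungraded `R`-module `V`, which consists of the
linear maps from `V` to `M`. -/
def cotensorObj (M : DGModule A) (V : ModuleCat.{u} R) : DGModule A where
  X :=
    { X n := ModuleCat.of R (V →ₗ[R] M.X.X n)
      d i j := ModuleCat.ofHom (LinearMap.compRight R (M.X.d i j).hom)
      shape i j h := by
        rw [M.X.shape i j h]
        ext
        rfl
      d_comp_d' i j k _ _ := by
        refine ModuleCat.hom_ext (LinearMap.ext fun φ ↦ LinearMap.ext fun v ↦ ?_)
        exact d_d i j k (φ v) }
  smul h :=
    { toFun a := LinearMap.compRight R (M.smul h a)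
      map_add' _ _ := by ext; simp
      map_smul' _ _ := by ext; simp }
  one_smul n φ := LinearMap.ext fun v ↦ M.one_smul n (φ v)
  mul_smul hij hjk h₁ h₂ a b φ := LinearMap.ext fun v ↦ M.mul_smul hij hjk h₁ h₂ a b (φ v)
  d_smul hi hj hk h a φ := LinearMap.ext fun v ↦ M.d_smul hi hj hk h a (φ v)

/-- The map of cotensors induced by a map of DG `A`-modules. -/
def cotensorMap {M N : DGModule A} (f : M ⟶ N) (V : ModuleCat.{u} R) :
    cotensorObj M V ⟶ cotensorObj N V :=
  mkHom (M := cotensorObj M V) (N := cotensorObj N V)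
    (fun n ↦ LinearMap.compRight R (f.hom.f n).hom)
    (fun n m _ (φ : V →ₗ[R] M.X.X n) ↦ LinearMap.ext fun v ↦ (map_d f.hom n m (φ v)).symm)
    (fun {_ j _} h a (φ : V →ₗ[R] M.X.X j) ↦ LinearMap.ext fun v ↦ f.map_smul h a (φ v))

/-- The map to the cotensor which corresponds to a linear family of maps, in degree `n`. -/
def cotensorLiftDeg {M N : DGModule A} (V : ModuleCat.{u} R) (φ : V →ₗ[R] (M ⟶ N)) (n : ℤ) :
    M.X.X n →ₗ[R] V →ₗ[R] N.X.X n :=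
  LinearMap.mk₂ R (fun x v ↦ ((φ v).hom.f n).hom x)
    (fun _ _ _ ↦ map_add _ _ _) (fun _ _ _ ↦ map_smul _ _ _)
    (fun _ _ _ ↦ by simp) (fun _ _ _ ↦ by simp)

/-- The map to the cotensor which corresponds to a linear family of maps. -/
def cotensorLift {M N : DGModule A} (V : ModuleCat.{u} R) (φ : V →ₗ[R] (M ⟶ N)) :
    M ⟶ cotensorObj N V :=
  mkHom (N := cotensorObj N V) (fun n ↦ cotensorLiftDeg V φ n)
    (fun n m _ x ↦ (LinearMap.ext fun v ↦ (map_d (φ v).hom n m x).symm :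
      (N.X.d n m).hom ∘ₗ cotensorLiftDeg V φ n x =
        cotensorLiftDeg V φ m ((M.X.d n m).hom x)))
    (fun {_ j k} h a x ↦ (LinearMap.ext fun v ↦ (φ v).map_smul h a x :
      cotensorLiftDeg V φ k (M.smul h a x) = N.smul h a ∘ₗ cotensorLiftDeg V φ j x))

/-- The linear family of maps which corresponds to a map to the cotensor. -/
def cotensorCurry {M N : DGModule A} {V : ModuleCat.{u} R} (f : M ⟶ cotensorObj N V) :
    V →ₗ[R] (M ⟶ N) where
  toFun v := mkHom (fun n ↦ LinearMap.applyₗ v ∘ₗ (f.hom.f n).hom)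
    (fun n m _ x ↦ (LinearMap.congr_fun (M := V) (M₃ := N.X.X m)
      (f := (f.hom.f m).hom ((M.X.d n m).hom x)) (map_d f.hom n m x) v).symm)
    (fun {_ _ k} h a x ↦ LinearMap.congr_fun (M := V) (M₃ := N.X.X k)
      (f := (f.hom.f k).hom (M.smul h a x)) (f.map_smul h a x) v)
  map_add' v w := hom_ext_apply fun n x ↦ map_add (F := V →ₗ[R] N.X.X n) ((f.hom.f n).hom x) v w
  map_smul' r v := hom_ext_apply fun n x ↦ map_smul (F := V →ₗ[R] N.X.X n) ((f.hom.f n).hom x) r v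

/-- The universal family of squares is one square against the cotensor of `p` with `Sq R i p`; an
ordinary diagonal of it is a linear section. -/
lemma hasEnrichedLifting_of_cotensor {W X E B : DGModule A} {i : W ⟶ X} {p : E ⟶ B}
    (H : ∀ V, HasLiftingProperty i (cotensorMap p V)) : HasEnrichedLifting R i p := by
  let S := Sq R i p
  have sq : CommSq (cotensorLift (.of R S) (LinearMap.fst R _ _ ∘ₗ S.subtype)) i
      (cotensorMap p (.of R S))
      (cotensorLift (.of R S) (LinearMap.snd R _ _ ∘ₗ S.subtype)) :=
    ⟨hom_ext_apply fun n x ↦ LinearMap.ext fun s ↦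
      ConcreteCategory.congr_hom (HomologicalComplex.congr_hom (congrArg Hom.hom s.2) n) x⟩
  have := H (.of R S)
  refine ⟨cotensorCurry sq.lift, LinearMap.ext fun s ↦ Subtype.ext (Prod.ext ?_ ?_)⟩
  · exact hom_ext_apply fun n x ↦ LinearMap.congr_fun (ConcreteCategory.congr_hom
      (HomologicalComplex.congr_hom (congrArg Hom.hom sq.fac_left) n) x) s
  · exact hom_ext_apply fun n x ↦ LinearMap.congr_fun (ConcreteCategory.congr_hom
      (HomologicalComplex.congr_hom (congrArg Hom.hom sq.fac_right) n) x) s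

lemma hasLiftingProperty_of_enriched {W X E B : DGModule A} {i : W ⟶ X} {p : E ⟶ B}
    (H : HasEnrichedLifting R i p) : HasLiftingProperty i p := by
  obtain ⟨η, hη⟩ := H
  refine ⟨fun {f g} sq ↦ ?_⟩
  have h := congrArg Subtype.val (LinearMap.congr_fun hη ⟨(f, g), sq.w⟩)
  exact ⟨⟨η ⟨(f, g), sq.w⟩, congrArg Prod.fst h, congrArg Prod.snd h⟩⟩

/-- This lets ordinary left lifting classes, to which the retract argument applies, serve as the
left halves of enriched factorization systems. -/
lemma enrichedLLP_eq_llp {P : MorphismProperty (DGModule A)}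
    (hP : ∀ ⦃E B : DGModule A⦄ (p : E ⟶ B) (V : ModuleCat.{u} R), P p →
      P (cotensorMap p V)) : enrichedLLP R P = P.llp := by
  ext W X i
  exact ⟨fun H _ _ p hp ↦ hasLiftingProperty_of_enriched (H p hp),
    fun H _ _ p hp ↦ hasEnrichedLifting_of_cotensor fun V ↦ H _ (hP p V hp)⟩

lemma rFibrations_cotensorMap {E B : DGModule A} (p : E ⟶ B) (V : ModuleCat.{u} R)
    (hp : rFibrations A p) : rFibrations A (cotensorMap p V) := fun n ↦ by
  obtain ⟨s, hs⟩ := hp n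
  exact ⟨LinearMap.compRight R s, LinearMap.ext fun (φ : V →ₗ[R] B.X.X n) ↦
    LinearMap.ext fun v ↦ LinearMap.congr_fun hs (φ v)⟩

/-- A family in the cotensor indexed by `V'` is a family in the original module indexed by `V' ⊗ V`.
-/
lemma enrichedRLP_genI_cotensorMap {E B : DGModule A} (p : E ⟶ B) (V : ModuleCat.{u} R)
    (hp : enrichedRLP R (genI A) p) : enrichedRLP R (genI A) (cotensorMap p V) := by
  rw [enrichedRLP_genI_iff] at hp ⊢
  intro n m hm V' _ _ z b hz hzb
  obtain ⟨e, he, he'⟩ := hp hm (V' ⊗[R] V) (TensorProduct.lift z) (TensorProduct.lift b)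
    (fun v k ↦ LinearMap.congr_fun (f := (E.X.d m k).hom ∘ₗ TensorProduct.lift z) (g := 0)
      (TensorProduct.ext' fun x y ↦ LinearMap.congr_fun (hz x k) y) v)
    (fun v ↦ LinearMap.congr_fun (f := (p.hom.f m).hom ∘ₗ TensorProduct.lift z)
      (g := (B.X.d n m).hom ∘ₗ TensorProduct.lift b)
      (TensorProduct.ext' fun x y ↦ LinearMap.congr_fun (hzb x) y) v)
  exact ⟨TensorProduct.curry e, fun x ↦ LinearMap.ext fun y ↦ he (x ⊗ₜ y),
    fun x ↦ LinearMap.ext fun y ↦ he' (x ⊗ₜ y)⟩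

/-! ## Contractible DG modules -/

/-- Transport along an equality of degrees. -/
def eqMap (K : ChainComplex (ModuleCat.{u} R) ℤ) {n m : ℤ} (h : n = m) :
    K.X n →ₗ[R] K.X m :=
  (K.XIsoOfEq h).hom.hom

@[simp] lemma eqMap_rfl {K : ChainComplex (ModuleCat.{u} R) ℤ} {n : ℤ} (h : n = n)
    (x : K.X n) : eqMap K h x = x := by
  simp [eqMap]

/-- The differential `(y, w) ↦ (d y, y - d w)` of the path object. -/
def pathD (M : DGModule A) (n m : ℤ) :
    (M.X.X n × M.X.X (n + 1)) →ₗ[R] M.X.X m × M.X.X (m + 1) :=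
  if h : m + 1 = n then
    ((M.X.d n m).hom ∘ₗ LinearMap.fst R _ _).prod
      (eqMap M.X h.symm ∘ₗ LinearMap.fst R _ _ -
        (M.X.d (n + 1) (m + 1)).hom ∘ₗ LinearMap.snd R _ _)
  else 0

lemma pathD_apply (M : DGModule A) (m : ℤ) (x : M.X.X (m + 1) × M.X.X (m + 1 + 1)) :
    pathD M (m + 1) m x = ((M.X.d (m + 1) m).hom x.1, x.1 - (M.X.d _ _).hom x.2) := by
  rw [pathD, dif_pos rfl]
  simp

lemma pathD_fst (M : DGModule A) (m : ℤ) (x : M.X.X (m + 1) × M.X.X (m + 1 + 1)) :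
    (pathD M (m + 1) m x).1 = (M.X.d (m + 1) m).hom x.1 := by
  rw [pathD_apply]

lemma pathD_pathD (M : DGModule A) (n m k : ℤ) (hm : m + 1 = n) (hk : k + 1 = m)
    (x : M.X.X n × M.X.X (n + 1)) : pathD M m k (pathD M n m x) = 0 := by
  subst hm
  subst hk
  rw [pathD_apply, pathD_apply]
  simp [d_d]

/-- The action of `A` on the path object. -/
def pathSmul (M : DGModule A) {i j k : ℤ} (h : i + j = k) :
    A.X.X i →ₗ[R] (M.X.X j × M.X.X (j + 1)) →ₗ[R] M.X.X k × M.X.X (k + 1) :=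
  LinearMap.mk₂ R
    (fun a x ↦ (M.smul h a x.1,
      i.negOnePow • M.smul (by omega : i + (j + 1) = k + 1) a x.2))
    (fun _ _ _ ↦ by simp) (fun c a x ↦ by simpa using smul_comm i.negOnePow c _)
    (fun _ _ _ ↦ by simp) (fun c a x ↦ by simpa using smul_comm i.negOnePow c _)

lemma pathSmul_apply (M : DGModule A) {i j k : ℤ} (h : i + j = k) (a : A.X.X i)
    (x : M.X.X j × M.X.X (j + 1)) : pathSmul M h a x = (M.smul h a x.1,
      i.negOnePow • M.smul (by omega : i + (j + 1) = k + 1) a x.2) := rfl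

lemma one_pathSmul (M : DGModule A) (n : ℤ) (x : M.X.X n × M.X.X (n + 1)) :
    pathSmul M (zero_add n) A.one x = x := by
  simp [pathSmul_apply, M.one_smul]

lemma mul_pathSmul (M : DGModule A) {i j k ij jk ijk : ℤ} (hij : i + j = ij)
    (hjk : j + k = jk) (h₁ : ij + k = ijk) (h₂ : i + jk = ijk) (a : A.X.X i) (b : A.X.X j)
    (x : M.X.X k × M.X.X (k + 1)) :
    pathSmul M h₁ (A.mul hij a b) x = pathSmul M h₂ a (pathSmul M hjk b x) := by
  subst hij
  simp only [pathSmul_apply, Units.smul_def, map_zsmul]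
  rw [M.mul_smul rfl hjk h₁ h₂, M.mul_smul rfl (by omega : j + (k + 1) = jk + 1) (by omega)
    (by omega), smul_smul, Int.negOnePow_add, Units.val_mul]

lemma d_pathSmul (M : DGModule A) {i j k i' j' k' : ℤ} (hi : i' + 1 = i) (hj : j' + 1 = j)
    (hk : k' + 1 = k) (h : i + j = k) (a : A.X.X i) (x : M.X.X j × M.X.X (j + 1)) :
    pathD M k k' (pathSmul M h a x) =
      pathSmul M (by omega : i' + j = k') ((A.X.d i i').hom a) x +
        i.negOnePow • pathSmul M (by omega : i + j' = k') a (pathD M j j' x) := by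
  subst hj
  subst hk
  have h1 := M.d_smul hi rfl rfl h a x.1
  have h2 := M.d_smul hi (rfl : j' + 1 + 1 = _) (rfl : k' + 1 + 1 = _) (by omega) a x.2
  have hs : (i.negOnePow : ℤ) * i.negOnePow = 1 := by
    rw [← Units.val_mul, Int.units_mul_self, Units.val_one]
  have hi' : (i.negOnePow : ℤ) = - (i'.negOnePow : ℤ) := by
    rw [← hi, Int.negOnePow_succ, Units.val_neg]
  simp only [pathSmul_apply, pathD_apply, Units.smul_def, map_zsmul, map_sub, Prod.smul_mk,
    Prod.mk_add_mk, smul_sub, smul_smul, hs, _root_.one_smul] at h1 h2 ⊢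
  rw [h1, h2, smul_add, smul_smul, hs, _root_.one_smul]
  refine Prod.ext rfl ?_
  simp only [hi', neg_smul]
  abel

/-- A contractible DG `A`-module, in degree `n` the product of `M_n` and `M_{n+1}`, such that
the first projection is a map of DG modules to `M`. -/
def pathObj (M : DGModule A) : DGModule A where
  X :=
    { X n := ModuleCat.of R (M.X.X n × M.X.X (n + 1))
      d n m := ModuleCat.ofHom (pathD M n m)
      shape _ _ h := ModuleCat.hom_ext (dif_neg h)
      d_comp_d' n m k hm hk :=
        ModuleCat.hom_ext (LinearMap.ext (pathD_pathD M n m k hm hk)) }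
  smul h := pathSmul M h
  one_smul n x := one_pathSmul M n x
  mul_smul hij hjk h₁ h₂ a b x := mul_pathSmul M hij hjk h₁ h₂ a b x
  d_smul hi hj hk h a x := d_pathSmul M hi hj hk h a x

/-- The first projection of the path object. -/
def pathFst (M : DGModule A) : pathObj M ⟶ M :=
  mkHom (M := pathObj M) (fun n ↦ LinearMap.fst R (M.X.X n) (M.X.X (n + 1)))
    (fun n m hm (x : M.X.X n × M.X.X (n + 1)) ↦ by
      subst hm
      exact (pathD_fst M m x).symm)
    (fun _ _ _ ↦ rfl)

/-- The differential `(x, y) ↦ (y, 0)` of the contractible envelope. -/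
def envD (M : DGModule A) (n m : ℤ) :
    (M.X.X n × M.X.X (n - 1)) →ₗ[R] M.X.X m × M.X.X (m - 1) :=
  if h : m + 1 = n then
    (eqMap M.X (by omega : n - 1 = m) ∘ₗ LinearMap.snd R _ _).prod 0
  else 0

lemma envD_apply (M : DGModule A) (n : ℤ) (x : M.X.X n × M.X.X (n - 1)) :
    envD M n (n - 1) x = (x.2, 0) := by
  rw [envD, dif_pos (by omega)]
  simp

/-- The action of `A` on the contractible envelope. -/
def envSmul (M : DGModule A) {i j k : ℤ} (h : i + j = k) :
    A.X.X i →ₗ[R] (M.X.X j × M.X.X (j - 1)) →ₗ[R] M.X.X k × M.X.X (k - 1) :=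
  LinearMap.mk₂ R
    (fun a x ↦ (M.smul h a x.1,
      M.smul (by omega : (i - 1) + j = k - 1) ((A.X.d i (i - 1)).hom a) x.1 +
      i.negOnePow • M.smul (by omega : i + (j - 1) = k - 1) a x.2))
    (fun _ _ _ ↦ Prod.ext (by simp) (by simp; abel))
    (fun c a x ↦ by simpa using smul_comm i.negOnePow c _)
    (fun _ _ _ ↦ Prod.ext (by simp) (by simp; abel))
    (fun c a x ↦ by simpa using smul_comm i.negOnePow c _)

lemma envSmul_apply (M : DGModule A) {i j k : ℤ} (h : i + j = k) (a : A.X.X i)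
    (x : M.X.X j × M.X.X (j - 1)) : envSmul M h a x = (M.smul h a x.1,
      M.smul (by omega : (i - 1) + j = k - 1) ((A.X.d i (i - 1)).hom a) x.1 +
      i.negOnePow • M.smul (by omega : i + (j - 1) = k - 1) a x.2) := rfl

lemma one_envSmul (M : DGModule A) (n : ℤ) (x : M.X.X n × M.X.X (n - 1)) :
    envSmul M (zero_add n) A.one x = x := by
  simp [envSmul_apply, M.one_smul, A.d_one]

lemma mul_envSmul (M : DGModule A) {i j k ij jk ijk : ℤ} (hij : i + j = ij)
    (hjk : j + k = jk) (h₁ : ij + k = ijk) (h₂ : i + jk = ijk) (a : A.X.X i) (b : A.X.X j)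
    (x : M.X.X k × M.X.X (k - 1)) :
    envSmul M h₁ (A.mul hij a b) x = envSmul M h₂ a (envSmul M hjk b x) := by
  subst hij
  simp only [envSmul_apply, Units.smul_def, map_zsmul, map_add]
  rw [A.d_mul (sub_add_cancel i 1) (sub_add_cancel j 1) (sub_add_cancel (i + j) 1) rfl]
  simp only [Units.smul_def, map_zsmul, map_add, LinearMap.add_apply, LinearMap.smul_apply]
  rw [M.mul_smul rfl hjk h₁ h₂,
    M.mul_smul (by omega) (by omega : j + k = jk) (by omega) (by omega),
    M.mul_smul (by omega) (by omega : (j - 1) + k = jk - 1) (by omega) (by omega),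
    M.mul_smul rfl (by omega : j + (k - 1) = jk - 1) (by omega)
    (by omega), smul_add, smul_smul, Int.negOnePow_add, Units.val_mul, add_assoc]

lemma d_envSmul (M : DGModule A) {i j k i' j' k' : ℤ} (hi : i' + 1 = i) (hj : j' + 1 = j)
    (hk : k' + 1 = k) (h : i + j = k) (a : A.X.X i) (x : M.X.X j × M.X.X (j - 1)) :
    envD M k k' (envSmul M h a x) =
      envSmul M (by omega : i' + j = k') ((A.X.d i i').hom a) x +
        i.negOnePow • envSmul M (by omega : i + j' = k') a (envD M j j' x) := by
  obtain rfl : i' = i - 1 := by omega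
  obtain rfl : j' = j - 1 := by omega
  obtain rfl : k' = k - 1 := by omega
  have hi' : ((i - 1).negOnePow : ℤ) = - (i.negOnePow : ℤ) := by
    rw [Int.negOnePow_sub, Int.negOnePow_one, mul_neg, mul_one, Units.val_neg]
  simp only [envSmul_apply, envD_apply, Units.smul_def, hi', d_d, map_zero,
    LinearMap.zero_apply, Prod.smul_mk, Prod.mk_add_mk]
  refine Prod.ext rfl ?_
  simp

/-- A contractible DG `A`-module, in degree `n` the product of `M_n` and `M_{n-1}`, in which
`M` embeds by `x ↦ (x, d x)`. -/
def envObj (M : DGModule A) : DGModule A where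
  X :=
    { X n := ModuleCat.of R (M.X.X n × M.X.X (n - 1))
      d n m := ModuleCat.ofHom (envD M n m)
      shape n m h := ModuleCat.hom_ext (dif_neg h)
      d_comp_d' n m k hm hk := by
        obtain rfl : m = n - 1 := eq_sub_of_add_eq hm
        obtain rfl : k = n - 1 - 1 := eq_sub_of_add_eq hk
        refine ModuleCat.hom_ext (LinearMap.ext fun x ↦ ?_)
        change envD M (n - 1) (n - 1 - 1) (envD M n (n - 1) x) = 0
        rw [envD_apply, envD_apply]
        rfl }
  smul h := envSmul M h
  one_smul n x := one_envSmul M n x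
  mul_smul hij hjk h₁ h₂ a b x := mul_envSmul M hij hjk h₁ h₂ a b x
  d_smul hi hj hk h a x := d_envSmul M hi hj hk h a x

/-- The embedding of a DG `A`-module in its contractible envelope. -/
def toEnv (M : DGModule A) : M ⟶ envObj M :=
  mkHom (N := envObj M) (fun n ↦ LinearMap.id.prod (M.X.d n (n - 1)).hom)
    (fun n m hm x ↦ by
      obtain rfl : m = n - 1 := by omega
      refine (envD_apply M n (x, _)).trans ?_
      exact Prod.ext rfl (d_d n (n - 1) (n - 1 - 1) x).symm)
    (fun {i j k} h a x ↦
      Prod.ext rfl (M.d_smul (sub_add_cancel i 1) (sub_add_cancel j 1) (sub_add_cancel k 1)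
        h a x))

/-! ## Homotopies -/

section Homotopy

variable {K L : ChainComplex (ModuleCat.{u} R) ℤ}

lemma exists_homotopy {f g : K ⟶ L} (h : ∀ n, K.X n →ₗ[R] L.X (n + 1))
    (H : ∀ n (x : K.X (n + 1)), (L.d (n + 1 + 1) (n + 1)).hom (h (n + 1) x) +
      h n ((K.d (n + 1) n).hom x) + (g.f (n + 1)).hom x = (f.f (n + 1)).hom x) :
    Nonempty (Homotopy f g) := by
  let φ : ∀ i j, (ComplexShape.down ℤ).Rel j i → (K.X i ⟶ L.X j) := fun i j hij ↦
    ModuleCat.ofHom (eqMap L hij ∘ₗ h i)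
  have hφ : ∀ i, φ i (i + 1) rfl = ModuleCat.ofHom (h i) := fun i ↦
    ModuleCat.hom_ext (LinearMap.ext fun x ↦ eqMap_rfl (K := L) rfl (h i x))
  have : f = Homotopy.nullHomotopicMap' φ + g := by
    ext m : 1
    obtain ⟨n, rfl⟩ : ∃ n, m = n + 1 := ⟨m - 1, by omega⟩
    rw [HomologicalComplex.add_f_apply, Homotopy.nullHomotopicMap'_f (rfl : (n + 1) + 1 = _)
      (rfl : n + 1 = _), hφ, hφ]
    refine ModuleCat.hom_ext (LinearMap.ext fun x ↦ ?_)
    rw [← H n x, add_comm ((L.d _ _).hom _)]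
    rfl
  exact ⟨(Homotopy.ofEq this).trans
    (((Homotopy.nullHomotopy' φ).add (Homotopy.refl g)).trans (Homotopy.ofEq (zero_add g)))⟩

lemma homotopy_apply {f g : K ⟶ L} (e : Homotopy f g) {n m k : ℤ} (hm : n + 1 = m)
    (hk : k + 1 = n) (x : K.X n) :
    (L.d m n).hom ((e.hom n m).hom x) + (e.hom k n).hom ((K.d n k).hom x) +
      (g.f n).hom x = (f.f n).hom x := by
  have h := e.comm n
  rw [dNext_eq e.hom (show (ComplexShape.down ℤ).Rel n k from hk),
    prevD_eq e.hom (show (ComplexShape.down ℤ).Rel m n from hm)] at h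
  rw [add_comm ((L.d _ _).hom _)]
  exact (ConcreteCategory.congr_hom h x).symm

lemma homotopyEquivalences_of {f : K ⟶ L} {g : L ⟶ K} (h₁ : Nonempty (Homotopy (𝟙 K) (f ≫ g)))
    (h₂ : Nonempty (Homotopy (𝟙 L) (g ≫ f))) :
    HomologicalComplex.homotopyEquivalences _ _ f :=
  ⟨⟨f, g, h₁.some.symm, h₂.some.symm⟩, rfl⟩

end Homotopy

/-! ## Lifting against `r`-fibrations -/

lemma extendScalars_zero_apply {n : ℤ}
    (x : ((extendScalars A).obj (0 : ChainComplex (ModuleCat.{u} R) ℤ)).X.X n) : x = 0 := by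
  have h : 𝟙 ((extendScalars A).obj (0 : ChainComplex (ModuleCat.{u} R) ℤ)) = 0 :=
    extendScalars_zero_hom_ext
  exact ConcreteCategory.congr_hom (HomologicalComplex.congr_hom (congrArg Hom.hom h) n) x

lemma rFibrations_pathFst (M : DGModule A) : rFibrations A (pathFst M) := fun n ↦
  ⟨LinearMap.inl R (M.X.X n) (M.X.X (n + 1)), LinearMap.ext fun _ ↦ rfl⟩

lemma rFibrations_toZero (M : DGModule A) :
    rFibrations A (0 : M ⟶ (extendScalars A).obj (0 : ChainComplex (ModuleCat.{u} R) ℤ)) :=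
  fun _ ↦ ⟨0, LinearMap.ext fun x ↦ (extendScalars_zero_apply x).symm⟩

lemma pathObj_lift_apply {M N : DGModule A} (f : M ⟶ pathObj N) (n : ℤ) (x : M.X.X (n + 1)) :
    (N.X.d (n + 1 + 1) (n + 1)).hom
        ((f.hom.f (n + 1)).hom x : N.X.X (n + 1) × N.X.X (n + 1 + 1)).2 +
      ((f.hom.f n).hom ((M.X.d (n + 1) n).hom x) : N.X.X n × N.X.X (n + 1)).2 =
      ((f.hom.f (n + 1)).hom x : N.X.X (n + 1) × N.X.X (n + 1 + 1)).1 := by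
  have h : ((f.hom.f n).hom ((M.X.d (n + 1) n).hom x) : N.X.X n × N.X.X (n + 1)) =
      pathD N (n + 1) n ((f.hom.f (n + 1)).hom x) := map_d f.hom (n + 1) n x
  have key (y : N.X.X (n + 1) × N.X.X (n + 1 + 1)) :
      (N.X.d (n + 1 + 1) (n + 1)).hom y.2 + (pathD N (n + 1) n y).2 = y.1 := by
    rw [pathD_apply]
    exact add_sub_cancel _ _
  exact (congrArg (fun y : N.X.X n × N.X.X (n + 1) ↦ _ + y.2) h).trans (key _)

/-- Lifting against `X ⟶ 0` gives a retraction of `f`. The map `1 - f ∘ retraction` vanishes on `X`,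
hence lifts to the contractible `pathObj Y`; the second component of the lift is a homotopy from the
identity of `Y` to `f ∘ retraction`. -/
lemma rFibrations_llp_le : (rFibrations A).llp ≤ rEquivalences A := by
  intro X Y f hf
  have := hf _ (rFibrations_toZero X)
  have := hf _ (rFibrations_pathFst Y)
  have sq : CommSq (𝟙 X) f (0 : X ⟶ (extendScalars A).obj 0) 0 := ⟨by simp⟩
  have sq' : CommSq (0 : X ⟶ pathObj Y) f (pathFst Y) (𝟙 Y - sq.lift ≫ f) := ⟨by simp⟩
  refine homotopyEquivalences_of (g := sq.lift.hom)
    ⟨Homotopy.ofEq (congrArg Hom.hom sq.fac_left).symm⟩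
    (exists_homotopy (fun n ↦ LinearMap.snd R (Y.X.X n) (Y.X.X (n + 1)) ∘ₗ
      (sq'.lift.hom.f n).hom) fun n x ↦ ?_)
  have h := congrArg (fun g ↦ (g.hom.f (n + 1)).hom x) sq'.fac_right
  refine (congrArg (fun y : Y.X.X (n + 1) ↦ y + ((sq.lift ≫ f).hom.f (n + 1)).hom x)
    ((pathObj_lift_apply sq'.lift n x).trans h)).trans ?_
  exact congrArg (fun g : Y ⟶ Y ↦ (g.hom.f (n + 1)).hom x)
    (sub_add_cancel (𝟙 Y) (sq.lift ≫ f))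

/-! ## Acyclic `r`-fibrations -/

lemma cycle_of_succ {K : ChainComplex (ModuleCat.{u} R) ℤ} {V : Type v} {n m : ℤ}
    {z : V → K.X n} (hm : m + 1 = n) (hz : ∀ v, (K.d n m).hom (z v) = 0) (v : V) (k : ℤ) :
    (K.d n k).hom (z v) = 0 := by
  by_cases hk : k + 1 = n
  · obtain rfl : k = m := by omega
    exact hz v
  · rw [K.shape _ _ hk]
    rfl

/-- A section appears after two steps: `(0, d y)` lifts to a cycle over `d y`, and then this cycle
together with `y` lifts to a chain over `y`. -/
lemma rFibrations_of_liftsCycles {E E' E'' Y : DGModule A} {j : E ⟶ E'} {j' : E' ⟶ E''}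
    {p : E ⟶ Y} {p' : E' ⟶ Y} {p'' : E'' ⟶ Y} (H : LiftsCycles j p p')
    (H' : LiftsCycles j' p' p'') : rFibrations A p'' := by
  intro n
  obtain ⟨s, hs, hs'⟩ := H (sub_add_cancel (n - 1) 1) (Y.X.X n) 0 (Y.X.d n (n - 1)).hom
    (by simp) (by simp [d_d])
  obtain ⟨t, -, ht⟩ := H' (sub_add_cancel n 1) (Y.X.X n) s LinearMap.id
    (cycle_of_succ (sub_add_cancel (n - 1) 1) fun v ↦ by simp [hs]) hs'
  exact ⟨t, LinearMap.ext ht⟩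

/-- The pairs of a cycle `z` of `E` and a chain `b` of `Y` with `p z = d b`. -/
def cyclePairs {E Y : DGModule A} (p : E ⟶ Y) (n m : ℤ) :
    Submodule R (E.X.X m × Y.X.X n) :=
  (⨅ k, LinearMap.ker ((E.X.d m k).hom ∘ₗ LinearMap.fst R _ _)) ⊓
    LinearMap.eqLocus ((p.hom.f m).hom ∘ₗ LinearMap.fst R _ _)
      ((Y.X.d n m).hom ∘ₗ LinearMap.snd R _ _)

lemma mem_cyclePairs {E Y : DGModule A} {p : E ⟶ Y} {n m : ℤ} {z : E.X.X m} {b : Y.X.X n} :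
    (z, b) ∈ cyclePairs p n m ↔ (∀ k, (E.X.d m k).hom z = 0) ∧
      (p.hom.f m).hom z = (Y.X.d n m).hom b := by
  simp [cyclePairs]

section

variable {E Y : DGModule A} {p : E ⟶ Y} (H : LiftsCycles (𝟙 E) p p)

-- The module of all pairs is itself a family, and its solution solves every other family by
-- composition.
include H in
lemma exists_lift_cyclePairs (n m : ℤ) (hm : m + 1 = n) :
    ∃ σ : cyclePairs p n m →ₗ[R] E.X.X n,
      ∀ x, (E.X.d n m).hom (σ x) = x.1.1 ∧ (p.hom.f n).hom (σ x) = x.1.2 := by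
  obtain ⟨σ, h₁, h₂⟩ := H hm (cyclePairs p n m)
    (LinearMap.fst R _ _ ∘ₗ (cyclePairs p n m).subtype)
    (LinearMap.snd R _ _ ∘ₗ (cyclePairs p n m).subtype)
    (fun x ↦ (mem_cyclePairs.1 x.2).1) (fun x ↦ (mem_cyclePairs.1 x.2).2)
  exact ⟨σ, fun x ↦ ⟨h₁ x, h₂ x⟩⟩

include H in
/-- Functions which lift pairs of a cycle and a chain, extended to all pairs, such that
the lifts of linear families are linear. -/
lemma exists_linear_lifts : ∃ σ : ∀ n m, E.X.X m → Y.X.X n → E.X.X n,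
    (∀ n m z b, m + 1 = n → (z, b) ∈ cyclePairs p n m →
      (E.X.d n m).hom (σ n m z b) = z ∧ (p.hom.f n).hom (σ n m z b) = b) ∧
    (∀ n m, σ n m 0 0 = 0) ∧
    ∀ n m (V : Type u) [AddCommGroup V] [Module R V] (z : V →ₗ[R] E.X.X m)
      (b : V →ₗ[R] Y.X.X n), m + 1 = n → (∀ v, (z v, b v) ∈ cyclePairs p n m) →
      ∃ e : V →ₗ[R] E.X.X n, ∀ v, e v = σ n m (z v) (b v) := by
  classical
  choose σ hσ using exists_lift_cyclePairs H
  let τ (n m : ℤ) (z : E.X.X m) (b : Y.X.X n) : E.X.X n :=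
    if h : m + 1 = n ∧ (z, b) ∈ cyclePairs p n m then σ n m h.1 ⟨(z, b), h.2⟩ else 0
  have hτ {n m : ℤ} {z : E.X.X m} {b : Y.X.X n} (hm : m + 1 = n)
      (h : (z, b) ∈ cyclePairs p n m) : τ n m z b = σ n m hm ⟨(z, b), h⟩ := dif_pos ⟨hm, h⟩
  refine ⟨τ, fun n m z b hm h ↦ ?_, fun n m ↦ ?_, fun n m V _ _ z b hm h ↦
    ⟨σ n m hm ∘ₗ (z.prod b).codRestrict (cyclePairs p n m) fun v ↦ by exact h v,
      fun v ↦ (hτ hm (h v)).symm⟩⟩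
  · rw [hτ hm h]
    exact hσ n m hm ⟨(z, b), h⟩
  · by_cases hm : m + 1 = n
    · rw [hτ hm (zero_mem (cyclePairs p n m))]
      exact map_zero (σ n m hm)
    · exact dif_neg fun h ↦ hm h.1

-- With `σ` the linear lifting, `t y = σ (σ (0, d y), y)` is a section of `p` and a chain map
-- because `σ (0, 0) = 0`. Put `u = 1 - t p`, which has values in the kernel of `p`. Then `r x = σ
-- (u (d x), 0)` makes `u x - r x` a cycle, and `h x = σ (u x - r x, 0)` satisfies `d h + h d = u`,
-- since `r` vanishes on boundaries and so `h (d x) = r x`.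
include H in
lemma rEquivalences_of_liftsCycles : rEquivalences A p := by
  obtain ⟨σ, hσ, hσ0, hσl⟩ := exists_linear_lifts H
  have m₁ (n : ℤ) (y : Y.X.X n) :
      ((0 : E.X.X (n - 1 - 1)), (Y.X.d n (n - 1)).hom y) ∈
        cyclePairs p (n - 1) (n - 1 - 1) := by
    simp [mem_cyclePairs, d_d]
  have h₁ (n : ℤ) (y : Y.X.X n) := hσ _ _ _ _ (by omega) (m₁ n y)
  have m₂ (n : ℤ) (y : Y.X.X n) :
      (σ (n - 1) (n - 1 - 1) 0 ((Y.X.d n (n - 1)).hom y), y) ∈ cyclePairs p n (n - 1) :=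
    mem_cyclePairs.2 ⟨cycle_of_succ (sub_add_cancel (n - 1) 1) (fun y ↦ (h₁ n y).1) y,
      (h₁ n y).2⟩
  have h₂ (n : ℤ) (y : Y.X.X n) := hσ _ _ _ _ (by omega) (m₂ n y)
  have hs (n : ℤ) : ∃ s : Y.X.X n →ₗ[R] E.X.X (n - 1),
      ∀ y, s y = σ (n - 1) (n - 1 - 1) 0 ((Y.X.d n (n - 1)).hom y) :=
    hσl _ _ _ 0 (Y.X.d n (n - 1)).hom (by omega) (m₁ n)
  choose s hs using hs
  have ht (n : ℤ) : ∃ t : Y.X.X n →ₗ[R] E.X.X n, ∀ y, t y = σ n (n - 1) (s n y) y :=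
    hσl n _ _ (s n) LinearMap.id (by omega) fun y ↦ by
      rw [hs]
      exact m₂ n y
  choose t ht using ht
  have hpt (n : ℤ) (y : Y.X.X n) : (p.hom.f n).hom (t n y) = y := by
    rw [ht, hs, (h₂ n y).2]
  let T : Y.X ⟶ E.X :=
    { f n := ModuleCat.ofHom (t n)
      comm' n m hm := by
        obtain rfl : m = n - 1 := eq_sub_of_add_eq hm
        refine ModuleCat.hom_ext (LinearMap.ext fun y ↦ ?_)
        change (E.X.d n (n - 1)).hom (t n y) = t (n - 1) ((Y.X.d n (n - 1)).hom y)
        rw [ht, ht, hs, hs, (h₂ n y).1, d_d, hσ0] }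
  let u : E.X ⟶ E.X := 𝟙 E.X - p.hom ≫ T
  have hu (n : ℤ) (x : E.X.X n) :
      (u.f n).hom x + ((p.hom ≫ T).f n).hom x = x := sub_add_cancel x _
  have hpu (n : ℤ) (x : E.X.X n) : (p.hom.f n).hom ((u.f n).hom x) = 0 := by
    change (p.hom.f n).hom (x - t n ((p.hom.f n).hom x)) = 0
    rw [map_sub, hpt, sub_self]
  have m₃ (n : ℤ) (x : E.X.X (n + 1)) :
      ((u.f n).hom ((E.X.d (n + 1) n).hom x), (0 : Y.X.X (n + 1))) ∈
        cyclePairs p (n + 1) n := by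
    simp [mem_cyclePairs, hpu, ← map_d u, d_d]
  have h₃ (n : ℤ) (x : E.X.X (n + 1)) := hσ _ _ _ _ rfl (m₃ n x)
  have m₄ (n : ℤ) (x : E.X.X (n + 1)) : ((u.f (n + 1)).hom x -
      σ (n + 1) n ((u.f n).hom ((E.X.d (n + 1) n).hom x)) 0, (0 : Y.X.X (n + 1 + 1))) ∈
        cyclePairs p (n + 1 + 1) (n + 1) :=
    mem_cyclePairs.2 ⟨cycle_of_succ (z := fun x : E.X.X (n + 1) ↦ (u.f (n + 1)).hom x -
      σ (n + 1) n ((u.f n).hom ((E.X.d (n + 1) n).hom x)) 0) rfl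
        (fun x ↦ by rw [map_sub, (h₃ n x).1, map_d, sub_self]) x, by
        rw [map_sub, (h₃ n x).2, hpu, sub_zero, map_zero]⟩
  have h₄ (n : ℤ) (x : E.X.X (n + 1)) := hσ _ _ _ _ rfl (m₄ n x)
  have hr (n : ℤ) : ∃ r : E.X.X (n + 1) →ₗ[R] E.X.X (n + 1),
      ∀ x, r x = σ (n + 1) n ((u.f n).hom ((E.X.d (n + 1) n).hom x)) 0 :=
    hσl _ _ _ ((u.f n).hom ∘ₗ (E.X.d (n + 1) n).hom) 0 rfl (m₃ n)
  choose r hr using hr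
  have hh (n : ℤ) : ∃ h : E.X.X (n + 1) →ₗ[R] E.X.X (n + 1 + 1),
      ∀ x, h x = σ (n + 1 + 1) (n + 1) ((u.f (n + 1)).hom x - r n x) 0 :=
    hσl _ _ _ ((u.f (n + 1)).hom - r n) 0 rfl fun x ↦ by
      rw [LinearMap.sub_apply, hr]
      exact m₄ n x
  choose h hh using hh
  -- The homotopy `h` is indexed by `n` but starts in degree `n + 1`; `h'` is the same map indexed
  -- by its source degree.
  have hh' (n : ℤ) : ∃ h' : E.X.X n →ₗ[R] E.X.X (n + 1), ∀ k (hk : k + 1 = n) x,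
      h' x = σ (n + 1) n ((u.f n).hom x - σ n k ((u.f k).hom ((E.X.d n k).hom x)) 0) 0 := by
    obtain ⟨k, rfl⟩ : ∃ k, n = k + 1 := ⟨n - 1, by omega⟩
    refine ⟨h k, fun l hl x ↦ ?_⟩
    obtain rfl : l = k := by omega
    rw [hh, hr]
  choose h' hh' using hh'
  have hfin (n : ℤ) (x : E.X.X (n + 1)) : (E.X.d (n + 1 + 1) (n + 1)).hom (h' (n + 1) x) +
      h' n ((E.X.d (n + 1) n).hom x) + ((p.hom ≫ T).f (n + 1)).hom x = x := by
    rw [hh' (n + 1) n rfl, hh' n (n - 1) (by omega), (h₄ n x).1, d_d, map_zero, hσ0,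
      sub_zero, sub_add_cancel]
    exact hu (n + 1) x
  have hpT : HomologicalComplex.homotopyEquivalences _ _ p.hom :=
    homotopyEquivalences_of (g := T) (exists_homotopy h' hfin)
      ⟨Homotopy.ofEq (HomologicalComplex.hom_ext _ _ fun n ↦
        ModuleCat.hom_ext (LinearMap.ext fun y ↦ (hpt n y).symm))⟩
  exact hpT

end

/-- With homotopy inverse `q`, section `τ` and homotopies `h`, `g`, the chain `e₀ = q b + h z` has
boundary `z`. The defect `w = b - p e₀` is a cycle, and adding `q w + d τ g w`, a cycle over `w`,
corrects it. All choices are linear. -/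
lemma liftsCycles_of_r {E Y : DGModule A} {p : E ⟶ Y} (hp : rFibrations A p)
    (hp' : rEquivalences A p) : LiftsCycles (𝟙 E) p p := by
  obtain ⟨e, he⟩ : ∃ e : HomotopyEquiv E.X Y.X, e.hom = p.hom := hp'
  choose τ hτ using hp
  intro n m hm V _ _ z b hz hzb
  have hpf (k : ℤ) (x : E.X.X k) : (p.hom.f k).hom x = (e.hom.f k).hom x :=
    (ConcreteCategory.congr_hom (HomologicalComplex.congr_hom he k) x).symm
  let q (k : ℤ) : Y.X.X k →ₗ[R] E.X.X k := (e.inv.f k).hom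
  have hq (k l : ℤ) (x : Y.X.X k) :
      (E.X.d k l).hom (q k x) = q l ((Y.X.d k l).hom x) := (map_d e.inv k l x).symm
  let h := e.homotopyHomInvId.symm
  let g := e.homotopyInvHomId.symm
  have hH (x : E.X.X m) (hx : ∀ k, (E.X.d m k).hom x = 0) :
      (E.X.d n m).hom ((h.hom m n).hom x) + q m ((p.hom.f m).hom x) = x := by
    have := homotopy_apply h hm (sub_add_cancel m 1) x
    rw [hx, map_zero, add_zero] at this
    rw [hpf]
    exact this
  have hG (x : Y.X.X n) (hx : (Y.X.d n m).hom x = 0) :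
      (Y.X.d (n + 1) n).hom ((g.hom n (n + 1)).hom x) + (p.hom.f n).hom (q n x) = x := by
    have := homotopy_apply g rfl hm x
    rw [hx, map_zero, add_zero] at this
    rw [hpf]
    exact this
  let e₀ : V →ₗ[R] E.X.X n := q n ∘ₗ b + (h.hom m n).hom ∘ₗ z
  let w : V →ₗ[R] Y.X.X n := b - (p.hom.f n).hom ∘ₗ e₀
  have he₀ (v : V) : (E.X.d n m).hom (e₀ v) = z v := by
    have := hH (z v) (hz v)
    rw [hzb] at this
    simp only [e₀, LinearMap.add_apply, LinearMap.comp_apply, map_add, hq]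
    rw [add_comm, this]
  have hw (v : V) : (Y.X.d n m).hom (w v) = 0 := by
    simp only [w, LinearMap.sub_apply, LinearMap.comp_apply, map_sub]
    rw [← map_d, he₀, hzb, sub_self]
  refine ⟨e₀ + (q n ∘ₗ w + (E.X.d (n + 1) n).hom ∘ₗ τ (n + 1) ∘ₗ (g.hom n (n + 1)).hom ∘ₗ w),
    fun v ↦ ?_, fun v ↦ ?_⟩
  · simp only [LinearMap.add_apply, LinearMap.comp_apply, map_add, he₀, hq, hw, d_d, map_zero,
      add_zero]
    rfl
  · have hτ' (y : Y.X.X (n + 1)) : (p.hom.f (n + 1)).hom (τ (n + 1) y) = y :=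
      LinearMap.congr_fun (hτ (n + 1)) y
    simp only [LinearMap.add_apply, LinearMap.comp_apply, map_add, map_d, hτ']
    rw [add_comm ((p.hom.f n).hom (q n (w v))), hG _ (hw v)]
    simp [w]

lemma rFibrations_inf_rEquivalences :
    rFibrations A ⊓ rEquivalences A = enrichedRLP R (genI A) := by
  ext E Y p
  rw [enrichedRLP_genI_iff]
  exact ⟨fun h ↦ liftsCycles_of_r h.1 h.2,
    fun H ↦ ⟨rFibrations_of_liftsCycles H H, rEquivalences_of_liftsCycles H⟩⟩

/-- The map from `envObj W` to zero lifts cycles linearly, so `toEnv W` extends along `i`; the first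
projection of the extension is the retraction. -/
lemma exists_retraction_of_llp {W X : DGModule A} {i : W ⟶ X}
    (hi : (enrichedRLP R (genI A)).llp i) (n : ℤ) :
    ∃ r : X.X.X n →ₗ[R] W.X.X n, ∀ x, r ((i.hom.f n).hom x) = x := by
  let p : envObj W ⟶ (extendScalars A).obj (0 : ChainComplex (ModuleCat.{u} R) ℤ) := 0
  have hp : enrichedRLP R (genI A) p := by
    rw [enrichedRLP_genI_iff]
    intro n m hm V _ _ z b hz hzb
    obtain rfl : m = n - 1 := by omega
    refine ⟨LinearMap.inr R (W.X.X n) (W.X.X (n - 1)) ∘ₗ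
      LinearMap.fst R (W.X.X (n - 1)) (W.X.X (n - 1 - 1)) ∘ₗ z, fun v ↦ ?_,
      fun v ↦ (extendScalars_zero_apply _).trans (extendScalars_zero_apply _).symm⟩
    have h (y : W.X.X (n - 1) × W.X.X (n - 1 - 1)) (hy : envD W _ (n - 1 - 1) y = 0) :
        envD W n (n - 1) (0, y.1) = y := by
      rw [envD_apply] at hy ⊢
      exact Prod.ext rfl (congrArg Prod.fst hy).symm
    exact h (z v) (hz v (n - 1 - 1))
  have := hi p hp
  have sq : CommSq (toEnv W) i p 0 := ⟨by simp [p]⟩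
  refine ⟨LinearMap.fst R (W.X.X n) (W.X.X (n - 1)) ∘ₗ (sq.lift.hom.f n).hom, fun x ↦ ?_⟩
  exact congrArg Prod.fst (congrArg (fun g ↦ (g.hom.f n).hom x) sq.fac_left)

/-! ## Compactness of spheres -/

section Compact

variable {J : Type v} [Category.{w} J] [IsFiltered J] [HasColimitsOfShape J (ModuleCat.{u} R)]
  [PreservesColimitsOfShape J (CategoryTheory.forget (ModuleCat.{u} R))]
  {F : J ⥤ DGModule A} {c : Cocone F}

omit [IsFiltered J] in
lemma exists_rep_of_isColimit (hc : IsColimit c) (n : ℤ) (x : c.pt.X.X n) :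
    ∃ j, ∃ y : (F.obj j).X.X n, ((c.ι.app j).hom.f n).hom y = x :=
  Concrete.isColimit_exists_rep _
    (isColimitOfPreserves (forget A ⋙ HomologicalComplex.eval _ _ n) hc) x

lemma exists_map_eq_of_isColimit (hc : IsColimit c) (n : ℤ) {j : J} (x y : (F.obj j).X.X n)
    (h : ((c.ι.app j).hom.f n).hom x = ((c.ι.app j).hom.f n).hom y) :
    ∃ (k : J) (f : j ⟶ k), ((F.map f).hom.f n).hom x = ((F.map f).hom.f n).hom y :=
  (CategoryTheory.Limits.IsColimit.eq_iff'
    (isColimitOfPreserves (forget A ⋙ HomologicalComplex.eval _ _ n) hc) x y).1 h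

/-- A map out of the sphere is one cycle. It is represented by an element at some stage, whose
boundary dies at a later stage. -/
lemma sph_isCompact (n : ℤ) (hc : IsColimit c) :
    Nonempty (IsColimit ((coyoneda.obj (Opposite.op (sph A n))).mapCocone c)) := by
  refine ⟨Types.FilteredColimit.isColimitOf' _ _ (fun f ↦ ?_) fun j f g h ↦ ?_⟩
  · change sph A n ⟶ c.pt at f
    obtain ⟨j, y, hy⟩ := exists_rep_of_isColimit hc n (evalAt (sphGen A n) _ f)
    obtain ⟨k, φ, hφ⟩ := exists_map_eq_of_isColimit hc (n - 1)
      (((F.obj j).X.d n (n - 1)).hom y) 0 (by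
        rw [map_zero]
        exact (map_d (c.ι.app j).hom n (n - 1) y).trans
          ((congrArg _ hy).trans (d_evalAt_sphGen f _)))
    rw [map_zero, map_d] at hφ
    obtain ⟨g, hg⟩ := exists_sph_hom (((F.map φ).hom.f n).hom y) fun m ↦
      cycle_of_succ (z := fun _ : Unit ↦ ((F.map φ).hom.f n).hom y) (sub_add_cancel n 1)
        (fun _ ↦ hφ.symm ▸ rfl) () m
    refine ⟨k, g, sph_hom_ext ?_⟩
    change _ = evalAt (sphGen A n) _ (g ≫ c.ι.app k)
    rw [evalAt_comp, hg, ← hy, ← c.w φ]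
    rfl
  · change sph A n ⟶ F.obj j at f g
    obtain ⟨k, φ, hφ⟩ := exists_map_eq_of_isColimit hc n (evalAt (sphGen A n) _ f)
      (evalAt (sphGen A n) _ g) (congrArg (evalAt (sphGen A n) _) h)
    exact ⟨k, φ, sph_hom_ext hφ⟩

omit [HasColimitsOfShape J (ModuleCat.{u} R)]
  [PreservesColimitsOfShape J (CategoryTheory.forget (ModuleCat.{u} R))] in
lemma extendScalars_zero_isCompact : Nonempty (IsColimit ((coyoneda.obj (Opposite.op
    ((extendScalars A).obj (0 : ChainComplex (ModuleCat.{u} R) ℤ)))).mapCocone c)) :=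
  ⟨Types.FilteredColimit.isColimitOf' _ _
    (fun _ ↦ ⟨IsFiltered.nonempty.some, (0 : (extendScalars A).obj _ ⟶ F.obj _),
      extendScalars_zero_hom_ext⟩)
    fun j _ _ _ ↦ ⟨j, 𝟙 j, extendScalars_zero_hom_ext⟩⟩

instance : PreservesColimitsOfShape ℕ (CategoryTheory.forget (ModuleCat.{u} R)) :=
  have := preservesSmallestFilteredColimits_of_preservesFilteredColimits
    (CategoryTheory.forget (ModuleCat.{u} R))
  inferInstance

lemma hasCompactDomains_genI (I : MorphismProperty (DGModule A)) :
    HasCompactDomains (genI A) I := by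
  rintro _ _ _ ⟨n⟩ E B f c
  exact sph_isCompact (n - 1) c.isColimit

lemma hasCompactDomains_genJ (I : MorphismProperty (DGModule A)) :
    HasCompactDomains (genJ A) I := by
  rintro _ _ _ ⟨n⟩ E B f c
  exact extendScalars_zero_isCompact

end Compact

-- Hypotheses of the ordinary small object argument

attribute [local instance] Cardinal.fact_isRegular_aleph0 Cardinal.orderBotAleph0OrdToType

instance : MorphismProperty.IsSmall.{u} (genI A) :=
  MorphismProperty.isSmall_ofHoms ..

instance : MorphismProperty.IsSmall.{u} (genJ A) :=
  MorphismProperty.isSmall_ofHoms ..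

instance : (genI A).IsCardinalForSmallObjectArgument Cardinal.aleph0.{u} where
  preservesColimit {P Q E B} i hi f hf := by
    obtain ⟨n⟩ := hi
    exact ⟨fun hc ↦ sph_isCompact _ hc⟩

instance : (genJ A).IsCardinalForSmallObjectArgument Cardinal.aleph0.{u} where
  preservesColimit {P Q E B} i hi f hf := by
    obtain ⟨n⟩ := hi
    exact ⟨fun hc ↦ extendScalars_zero_isCompact⟩

instance : MorphismProperty.HasSmallObjectArgument.{u} (genI A) :=
  ⟨.aleph0, inferInstance, inferInstance, inferInstance⟩

instance : MorphismProperty.HasSmallObjectArgument.{u} (genJ A) :=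
  ⟨.aleph0, inferInstance, inferInstance, inferInstance⟩

/-! ## Quasi-isomorphisms -/

section Homology

variable (K : ChainComplex (ModuleCat.{u} R) ℤ) {n m : ℤ}

lemma iCycles_injective (n : ℤ) : Function.Injective (K.iCycles n).hom :=
  (ModuleCat.mono_iff_injective _).1 inferInstance

lemma homologyπ_surjective (n : ℤ) : Function.Surjective (K.homologyπ n).hom :=
  (ModuleCat.epi_iff_surjective _).1 inferInstance

lemma d_iCycles (c : K.cycles n) (k : ℤ) : (K.d n k).hom ((K.iCycles n).hom c) = 0 :=
  ConcreteCategory.congr_hom (K.iCycles_d n k) c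

lemma exists_cycles (x : K.X n) (hx : ∀ k, (K.d n k).hom x = 0) :
    ∃ c, (K.iCycles n).hom c = x :=
  ⟨K.cyclesMk x ((ComplexShape.down ℤ).next n) rfl (hx _), K.i_cyclesMk x _ rfl (hx _)⟩

lemma homologyπ_eq_zero_iff (hn : n + 1 = m) (c : K.cycles n) :
    (K.homologyπ n).hom c = 0 ↔ ∃ y, (K.d m n).hom y = (K.iCycles n).hom c := by
  have h := (ShortComplex.moduleCat_exact_iff _).1 (ShortComplex.exact_of_g_is_cokernel
    (ShortComplex.mk _ _ (K.toCycles_comp_homologyπ m n))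
    (K.homologyIsCokernel m n ((ComplexShape.down ℤ).prev_eq' hn)))
  have hd (y : K.X m) : (K.iCycles n).hom ((K.toCycles m n).hom y) = (K.d m n).hom y :=
    ConcreteCategory.congr_hom (K.toCycles_i m n) y
  constructor
  · intro hc
    obtain ⟨y, hy⟩ := h c hc
    exact ⟨y, (hd y).symm.trans (congrArg _ hy)⟩
  · rintro ⟨y, hy⟩
    rw [← iCycles_injective K n ((hd y).trans hy)]
    exact ConcreteCategory.congr_hom (K.toCycles_comp_homologyπ m n) y

variable {K} {L : ChainComplex (ModuleCat.{u} R) ℤ}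

lemma iCycles_cyclesMap (f : K ⟶ L) (c : K.cycles n) :
    (L.iCycles n).hom ((HomologicalComplex.cyclesMap f n).hom c) =
      (f.f n).hom ((K.iCycles n).hom c) :=
  ConcreteCategory.congr_hom (HomologicalComplex.cyclesMap_i f n) c

lemma homologyMap_homologyπ (f : K ⟶ L) (c : K.cycles n) :
    (HomologicalComplex.homologyMap f n).hom ((K.homologyπ n).hom c) =
      (L.homologyπ n).hom ((HomologicalComplex.cyclesMap f n).hom c) :=
  ConcreteCategory.congr_hom (HomologicalComplex.homologyπ_naturality f n) c

lemma quasiIso_iff_cycles (f : K ⟶ L) : HomologicalComplex.quasiIso _ _ f ↔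
    (∀ n (z : K.X n) (y : L.X (n + 1)), (∀ k, (K.d n k).hom z = 0) →
      (f.f n).hom z = (L.d (n + 1) n).hom y → ∃ x, (K.d (n + 1) n).hom x = z) ∧
    ∀ n (z : L.X n), (∀ k, (L.d n k).hom z = 0) → ∃ (x : K.X n) (y : L.X (n + 1)),
      (∀ k, (K.d n k).hom x = 0) ∧ z = (f.f n).hom x + (L.d (n + 1) n).hom y := by
  rw [HomologicalComplex.mem_quasiIso_iff, quasiIso_iff]
  simp only [quasiIsoAt_iff_isIso_homologyMap, ConcreteCategory.isIso_iff_bijective]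
  rw [← forall_and]
  refine forall_congr' fun n ↦ and_congr ?_ ?_
  · refine (injective_iff_map_eq_zero (HomologicalComplex.homologyMap f n).hom).trans ?_
    constructor
    · intro H z y hz hzy
      obtain ⟨c, rfl⟩ := exists_cycles K z hz
      refine (homologyπ_eq_zero_iff K rfl c).1 (H _ ?_)
      rw [homologyMap_homologyπ, homologyπ_eq_zero_iff L rfl, iCycles_cyclesMap]
      exact ⟨y, hzy.symm⟩
    · intro H a ha
      obtain ⟨c, rfl⟩ := homologyπ_surjective K n a
      rw [homologyMap_homologyπ, homologyπ_eq_zero_iff L rfl, iCycles_cyclesMap] at ha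
      obtain ⟨y, hy⟩ := ha
      exact (homologyπ_eq_zero_iff K rfl c).2 (H _ y (d_iCycles K c) hy.symm)
  · constructor
    · intro H z hz
      obtain ⟨c, rfl⟩ := exists_cycles L z hz
      obtain ⟨a, ha⟩ := H ((L.homologyπ n).hom c)
      obtain ⟨b, rfl⟩ := homologyπ_surjective K n a
      have : (L.homologyπ n).hom (c - (HomologicalComplex.cyclesMap f n).hom b) = 0 := by
        rw [map_sub, ← homologyMap_homologyπ]
        exact sub_eq_zero.2 ha.symm
      obtain ⟨y, hy⟩ := (homologyπ_eq_zero_iff L rfl _).1 this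
      refine ⟨_, y, d_iCycles K b, ?_⟩
      rw [hy, map_sub, iCycles_cyclesMap, add_sub_cancel]
    · intro H a
      obtain ⟨c, rfl⟩ := homologyπ_surjective L n a
      obtain ⟨x, y, hx, hxy⟩ := H _ (d_iCycles L c)
      obtain ⟨b, rfl⟩ := exists_cycles K x hx
      refine ⟨(K.homologyπ n).hom b, (homologyMap_homologyπ f b).trans ?_⟩
      rw [eq_comm, ← sub_eq_zero, ← map_sub, homologyπ_eq_zero_iff L rfl]
      refine ⟨y, ?_⟩
      rw [map_sub, iCycles_cyclesMap, hxy, add_sub_cancel_left]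

end Homology

/-! ### Acyclic `q`-fibrations -/

lemma qFibrations_inf_qEquivalences : qFibrations A ⊓ qEquivalences A = (genI A).rlp := by
  ext E B p
  have hq : qEquivalences A p ↔ _ := quasiIso_iff_cycles p.hom
  rw [genI_rlp_iff]
  constructor
  · rintro ⟨hp, hp'⟩ n m rfl z b hz hzb
    obtain ⟨h₁, h₂⟩ := hq.1 hp'
    -- Injectivity on homology gives `e₀` bounding `z`. The defect `b - p e₀` is a cycle, hence `p`
    -- of a cycle up to a boundary, and the bounding chain lifts because `p` is surjective.
    obtain ⟨e₀, rfl⟩ := h₁ m z b hz hzb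
    obtain ⟨x, y, hx, hxy⟩ := h₂ (m + 1) (b - (p.hom.f (m + 1)).hom e₀) fun k ↦
      cycle_of_succ (z := fun _ : Unit ↦ b - (p.hom.f (m + 1)).hom e₀) rfl
        (fun _ ↦ by rw [map_sub, ← hzb, map_d, sub_self]) () k
    obtain ⟨y, rfl⟩ := hp _ y
    refine ⟨e₀ + (x + (E.X.d (m + 1 + 1) (m + 1)).hom y), ?_, ?_⟩
    · rw [map_add, map_add, hx, d_d, add_zero, add_zero]
    · rw [map_add, map_add, map_d, ← hxy, add_sub_cancel]
  · intro H
    -- Lifting with zero upstairs lifts cycles to cycles. Surjectivity on all chains then follows by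
    -- lifting `d b` to a cycle before lifting `b`.
    have hc (n : ℤ) (z : B.X.X n) (hz : ∀ k, (B.X.d n k).hom z = 0) :
        ∃ x : E.X.X n, (∀ k, (E.X.d n k).hom x = 0) ∧ (p.hom.f n).hom x = z := by
      obtain ⟨x, hx, hx'⟩ := H (sub_add_cancel n 1) 0 z (by simp) (by simp [hz])
      exact ⟨x, cycle_of_succ (z := fun _ : Unit ↦ x) (sub_add_cancel n 1) (fun _ ↦ hx) (),
        hx'⟩
    refine ⟨fun n b ↦ ?_, hq.2 ⟨fun n z y hz hzy ↦ ?_, fun n z hz ↦ ?_⟩⟩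
    · obtain ⟨z, hz, hz'⟩ := hc (n - 1) ((B.X.d n (n - 1)).hom b) (by simp [d_d])
      obtain ⟨e, -, he⟩ := H (sub_add_cancel n 1) z b hz hz'
      exact ⟨e, he⟩
    · obtain ⟨e, he, -⟩ := H rfl z y hz hzy
      exact ⟨e, he⟩
    · obtain ⟨x, hx, hx'⟩ := hc n z hz
      exact ⟨x, 0, hx, by rw [map_zero, add_zero, hx']⟩

lemma rFibrations_le_qFibrations : rFibrations A ≤ qFibrations A := fun _ _ _ hp n b ↦ by
  obtain ⟨s, hs⟩ := hp n
  exact ⟨s b, LinearMap.congr_fun hs b⟩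

lemma rEquivalences_le_qEquivalences : rEquivalences A ≤ qEquivalences A := fun _ _ _ h ↦
  homotopyEquivalences_le_quasiIso _ _ _ h

lemma qFibrations_llp_le : (qFibrations A).llp ≤ qEquivalences A :=
  (MorphismProperty.antitone_llp rFibrations_le_qFibrations).trans
    (rFibrations_llp_le.trans rEquivalences_le_qEquivalences)

end DGModule

/-! ## Contractions of filtered differential modules -/

section Contraction

variable {R : Type u} [CommRing R] {T : Type u} [AddCommGroup T] [Module R T] {D : T →ₗ[R] T}
  {F : ℕ → Submodule R T}

/-- On `F k`, `e₀` bounds `D x` and `e₁` bounds the cycle `x - e₀ x`, so `D e₁ + e₁ D` differs from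
the identity by `e₀ - e₁ D`. This error is a cycle because `e₀ D = 0`, and `c` bounds it with `c D =
0`. Hence `e₁ + c` is a contraction. Each of the three uses of `s` costs one stage of the
filtration. -/
lemma exists_contraction_on (hD : ∀ x, D (D x) = 0) (hDF : ∀ k, ∀ x ∈ F k, D x ∈ F k)
    (hF : Monotone F) (hρ : ∀ k, ∃ ρ : T →ₗ[R] T, ∀ x, ρ x ∈ F k ∧ (x ∈ F k → ρ x = x))
    (hs : ∀ k, ∃ s : ↥(F k ⊓ LinearMap.ker D) →ₗ[R] T, ∀ x, s x ∈ F (k + 1) ∧ D (s x) = x)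
    (k : ℕ) : ∃ g : T →ₗ[R] T, (∀ x, g x ∈ F (k + 3)) ∧ ∀ x ∈ F k, D (g x) + g (D x) = x := by
  obtain ⟨ρ, hρ⟩ := hρ k
  choose s hs hs' using hs
  have m₀ (x : T) : D (ρ x) ∈ F k ⊓ LinearMap.ker D := ⟨hDF k _ (hρ x).1, hD _⟩
  let e₀ : T →ₗ[R] T := s k ∘ₗ (D ∘ₗ ρ).codRestrict _ m₀
  have he₀ (x : T) : D (e₀ x) = D (ρ x) := hs' k _
  have he₀' (x : T) (hx : x ∈ F k) : e₀ (D x) = 0 := by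
    have : (D ∘ₗ ρ).codRestrict _ m₀ (D x) = 0 :=
      Subtype.ext ((congrArg D ((hρ _).2 (hDF k x hx))).trans (hD x))
    exact (congrArg (s k) this).trans (map_zero _)
  have m₁ (x : T) : ρ x - e₀ x ∈ F (k + 1) ⊓ LinearMap.ker D :=
    ⟨sub_mem (hF k.le_succ (hρ x).1) (hs k _), by simp [he₀]⟩
  let e₁ : T →ₗ[R] T := s (k + 1) ∘ₗ (ρ - e₀).codRestrict _ m₁
  have he₁ (x : T) : D (e₁ x) = ρ x - e₀ x := hs' (k + 1) _
  have m₂ (x : T) : e₀ (ρ x) - e₁ (D (ρ x)) ∈ F (k + 2) ⊓ LinearMap.ker D := by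
    refine ⟨sub_mem (hF (by omega) (hs k _)) (hs (k + 1) _), ?_⟩
    change D _ = 0
    rw [map_sub, he₀, he₁, he₀' _ (hρ x).1, (hρ (ρ x)).2 (hρ x).1,
      (hρ (D (ρ x))).2 (m₀ x).1, sub_zero, sub_self]
  let c : T →ₗ[R] T := s (k + 2) ∘ₗ ((e₀ - e₁ ∘ₗ D) ∘ₗ ρ).codRestrict _ m₂
  have hc (x : T) : D (c x) = e₀ (ρ x) - e₁ (D (ρ x)) := hs' (k + 2) _
  have hc' (x : T) (hx : x ∈ F k) : c (D x) = 0 := by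
    have : ((e₀ - e₁ ∘ₗ D) ∘ₗ ρ).codRestrict _ m₂ (D x) = 0 := by
      refine Subtype.ext (?_ : e₀ (ρ (D x)) - e₁ (D (ρ (D x))) = 0)
      rw [(hρ (D x)).2 (hDF k x hx), he₀' x hx, hD, map_zero, sub_zero]
    exact (congrArg (s (k + 2)) this).trans (map_zero _)
  refine ⟨e₁ + c, fun x ↦ add_mem (hF (by omega) (hs (k + 1) _)) (hs (k + 2) _),
    fun x hx ↦ ?_⟩
  rw [LinearMap.add_apply, LinearMap.add_apply, map_add, he₁, hc, hc' x hx, (hρ x).2 hx]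
  abel

/-- The difference `δ = g (k + 2) - h` anticommutes with `D` on `F (k + 1)`. On `F k` it is
null-homotopic through `G = δ ∘ g k`, so subtracting `δ` there amounts to adding `D G - G D`. That
term is defined everywhere thanks to `ρ`, and does not spoil the contraction identity since `D ∘ D =
0`. -/
lemma exists_contraction_extension (hD : ∀ x, D (D x) = 0)
    (hDF : ∀ k, ∀ x ∈ F k, D x ∈ F k) (hF : Monotone F)
    (hρ : ∀ k, ∃ ρ : T →ₗ[R] T, ∀ x, ρ x ∈ F k ∧ (x ∈ F k → ρ x = x))
    (hg : ∀ k, ∃ g : T →ₗ[R] T, (∀ x, g x ∈ F (k + 1)) ∧ ∀ x ∈ F k, D (g x) + g (D x) = x)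
    (k : ℕ) (h : T →ₗ[R] T) (hh : ∀ x, h x ∈ F (k + 2))
    (hh' : ∀ x ∈ F (k + 1), D (h x) + h (D x) = x) :
    ∃ h' : T →ₗ[R] T, (∀ x, h' x ∈ F (k + 3)) ∧
      (∀ x ∈ F (k + 2), D (h' x) + h' (D x) = x) ∧ ∀ x ∈ F k, h' x = h x := by
  obtain ⟨ρ, hρ⟩ := hρ k
  choose g hg hg' using hg
  let δ : T →ₗ[R] T := g (k + 2) - h
  have hδ (x : T) : δ x ∈ F (k + 3) := sub_mem (hg _ x) (hF (by omega) (hh x))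
  have hδ' (x : T) (hx : x ∈ F (k + 1)) : D (δ x) = - δ (D x) := by
    have h₁ := hg' (k + 2) x (hF (by omega) hx)
    have h₂ := hh' x hx
    rw [eq_neg_iff_add_eq_zero]
    simp only [δ, LinearMap.sub_apply, map_sub]
    rw [← sub_eq_zero.2 (h₁.trans h₂.symm)]
    abel
  let G : T →ₗ[R] T := δ ∘ₗ g k ∘ₗ ρ
  refine ⟨g (k + 2) + D ∘ₗ G - G ∘ₗ D, fun x ↦ sub_mem (add_mem (hg _ x)
    (hDF _ _ (hδ _))) (hδ _), fun x hx ↦ ?_, fun x hx ↦ ?_⟩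
  · refine Eq.trans ?_ (hg' (k + 2) x hx)
    simp only [LinearMap.sub_apply, LinearMap.add_apply, LinearMap.comp_apply, map_sub, map_add,
      hD, map_zero]
    abel
  · have h₁ : D (g k x) = x - g k (D x) := eq_sub_of_add_eq (hg' k x hx)
    simp only [LinearMap.sub_apply, LinearMap.add_apply, LinearMap.comp_apply, G, (hρ x).2 hx,
      (hρ (D x)).2 (hDF k x hx), hδ' _ (hg k x), h₁, map_sub]
    simp only [δ, LinearMap.sub_apply]
    abel

/-- Successive extensions leave the values on earlier stages unchanged, so the partial contractions
have a well-defined linear limit on the union. -/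
lemma exists_contraction (hD : ∀ x, D (D x) = 0) (hDF : ∀ k, ∀ x ∈ F k, D x ∈ F k)
    (hF : Monotone F) (hρ : ∀ k, ∃ ρ : T →ₗ[R] T, ∀ x, ρ x ∈ F k ∧ (x ∈ F k → ρ x = x))
    (hs : ∀ k, ∃ s : ↥(F k ⊓ LinearMap.ker D) →ₗ[R] T, ∀ x, s x ∈ F (k + 1) ∧ D (s x) = x) :
    ∃ c : ↥(⨆ k, F k) →ₗ[R] T, ∀ x, c x ∈ ⨆ k, F k ∧ (D x = 0 → D (c x) = x) := by
  -- Keeping every third stage turns the loss of three stages into a loss of one.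
  have hg (k : ℕ) := exists_contraction_on hD hDF hF hρ hs (3 * k)
  have key (k : ℕ) := exists_contraction_extension (F := fun k ↦ F (3 * k)) hD
    (fun k ↦ hDF (3 * k)) (fun a b h ↦ hF (by omega)) (fun k ↦ hρ (3 * k)) hg k
  let P (k : ℕ) := {h : T →ₗ[R] T // (∀ x, h x ∈ F (3 * (k + 2))) ∧
    ∀ x ∈ F (3 * (k + 1)), D (h x) + h (D x) = x}
  choose next hn₁ hn₂ hn₃ using key
  let H : ∀ k, P k := fun k ↦ Nat.rec ⟨(hg 1).choose, (hg 1).choose_spec⟩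
    (fun k h ↦ ⟨next k h.1 h.2.1 h.2.2, hn₁ k h.1 h.2.1 h.2.2, hn₂ k h.1 h.2.1 h.2.2⟩) k
  have hH (k : ℕ) (x : T) (hx : x ∈ F (3 * k)) (l : ℕ) : (H (k + l)).1 x = (H k).1 x := by
    induction l with
    | zero => rfl
    | succ l ih =>
      exact (hn₃ (k + l) (H (k + l)).1 (H (k + l)).2.1 (H (k + l)).2.2 x
        (hF (by omega) hx)).trans ih
  have hH' {k l : ℕ} {x : T} (hk : x ∈ F (3 * k)) (hl : x ∈ F (3 * l)) :
      (H k).1 x = (H l).1 x :=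
    (hH k x hk l).symm.trans (by rw! [add_comm k l]; exact hH l x hl k)
  have hmem (x : ↥(⨆ k, F k)) : ∃ k, x.1 ∈ F (3 * k) := by
    obtain ⟨k, hk⟩ := (Submodule.mem_iSup_of_directed _ hF.directed_le).1 x.2
    exact ⟨k, hF (by omega) hk⟩
  -- Each element is sent to a stage containing it; `hH'` makes the value independent of the stage,
  -- which gives linearity.
  choose κ hκ using hmem
  have hκ' (x : ↥(⨆ k, F k)) {l : ℕ} (hl : κ x ≤ l) : x.1 ∈ F (3 * l) :=
    hF (by omega) (hκ x)
  refine ⟨{ toFun x := (H (κ x)).1 x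
            map_add' x y := ?_
            map_smul' r x := ?_ }, fun x ↦ ⟨?_, fun hx ↦ ?_⟩⟩
  · have hx := hκ' x (le_max_left (κ x) (κ y))
    have hy := hκ' y (le_max_right (κ x) (κ y))
    rw [hH' (hκ (x + y)) (add_mem hx hy), hH' (hκ x) hx, hH' (hκ y) hy]
    exact map_add _ _ _
  · rw [hH' (hκ (r • x)) (Submodule.smul_mem _ r (hκ x))]
    exact map_smul _ _ _
  · exact Submodule.mem_iSup_of_mem _ ((H (κ x)).2.1 x)
  · have := (H (κ x)).2.2 x (hκ' x (Nat.le_succ _))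
    rwa [hx, map_zero, add_zero] at this

end Contraction

/-! ## Sequences of factorizations -/

section Sequences

variable {C : Type v} [Category.{u} C] [HasColimitsOfShape ℕ C] {Y : C}

lemma exists_sequence {W : MorphismProperty C}
    {Q : ∀ ⦃E E' : C⦄, (E ⟶ E') → (E ⟶ Y) → (E' ⟶ Y) → Prop}
    (H : ∀ (E : C) (p : E ⟶ Y), ∃ (E' : C) (j : E ⟶ E') (p' : E' ⟶ Y),
      j ≫ p' = p ∧ W j ∧ Q j p p') {X : C} (f : X ⟶ Y) :
    ∃ (Z : C) (i : X ⟶ Z) (p : Z ⟶ Y) (c : W.TransfiniteCompositionOfShape ℕ i),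
      i ≫ p = f ∧ ∀ k, Q (c.F.map (homOfLE (Nat.le_add_right k 1))) (c.incl.app k ≫ p)
        (c.incl.app (k + 1) ≫ p) := by
  choose E' j p' hp hW hQ using H
  let S : ℕ → Σ E : C, E ⟶ Y := fun n ↦ Nat.rec ⟨X, f⟩ (fun _ s ↦ ⟨E' s.1 s.2, p' s.1 s.2⟩) n
  let F : ℕ ⥤ C := Functor.ofSequence (X := fun n ↦ (S n).1) fun n ↦ j (S n).1 (S n).2
  have hF (n : ℕ) : F.map (homOfLE (Nat.le_add_right n 1)) = j (S n).1 (S n).2 :=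
    Functor.ofSequence_map_homOfLE_succ _ n
  let π : F ⟶ (Functor.const ℕ).obj Y := NatTrans.ofSequence (fun n ↦ (S n).2) fun n ↦ by
    rw [hF]
    exact (hp _ _).trans (Category.comp_id _).symm
  let p : colimit F ⟶ Y := colimit.desc F (Cocone.mk Y π)
  have hπ (n : ℕ) : colimit.ι F n ≫ p = (S n).2 := colimit.ι_desc _ _
  refine ⟨colimit F, colimit.ι F 0, p,
    { F := F
      isoBot := Iso.refl _
      incl := (colimit.cocone F).ι
      isColimit := colimit.isColimit F
      fac := Category.id_comp _
      map_mem := fun n _ ↦ ?_ }, hπ 0, fun n ↦ ?_⟩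
  · exact (hF n).symm ▸ hW _ _
  · change Q (F.map _) (colimit.ι F n ≫ p) (colimit.ι F (n + 1) ≫ p)
    rw [hπ, hπ, hF]
    exact hQ _ _

end Sequences

namespace DGModule

variable {R : Type u} [CommRing R] {A : DGAlgebra R}

/-- One step of the enriched small object argument: tensoring `i n` with the whole module of squares
attaches the universal family of cells, and the cell inclusion is the linear lifting. -/
lemma exists_attachment {P Q : ℤ → DGModule A} (i : ∀ n, P n ⟶ Q n) {E Y : DGModule A}
    (p : E ⟶ Y) : ∃ (E' : DGModule A) (j : E ⟶ E') (p' : E' ⟶ Y), j ≫ p' = p ∧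
      cellAttachments (tensored (MorphismProperty.ofHoms i)) j ∧
      ∀ n, ∃ η : Sq R (i n) p →ₗ[R] (Q n ⟶ E'), ∀ s,
        i n ≫ η s = s.1.1 ≫ j ∧ η s ≫ p' = s.1.2 := by
  let V (n : ℤ) : ModuleCat.{u} R := ModuleCat.of R (Sq R (i n) p)
  let a (n : ℤ) : (tensorRight (V n)).obj (P n) ⟶ E :=
    tensorDesc (V n) (LinearMap.fst R _ _ ∘ₗ (Sq R (i n) p).subtype)
  let b (n : ℤ) : (tensorRight (V n)).obj (Q n) ⟶ Y :=
    tensorDesc (V n) (LinearMap.snd R _ _ ∘ₗ (Sq R (i n) p).subtype)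
  have hab (n : ℤ) : a n ≫ p = (tensorRight (V n)).map (i n) ≫ b n :=
    tensor_hom_ext fun m x s ↦
      ConcreteCategory.congr_hom (HomologicalComplex.congr_hom (congrArg Hom.hom s.2) m) x
  let t : ∐ (fun n ↦ (tensorRight (V n)).obj (P n)) ⟶ ∐ fun n ↦ (tensorRight (V n)).obj (Q n) :=
    Limits.Sigma.map fun n ↦ (tensorRight (V n)).map (i n)
  have ht : MorphismProperty.coproducts.{u} (tensored (MorphismProperty.ofHoms i)) t :=
    MorphismProperty.coproducts_of_small _ _
      (MorphismProperty.colimitsOfShape_colimMap _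
        fun n ↦ tensored.mk (i n.as) ⟨n.as⟩ (V n.as))
  have hw : Sigma.desc a ≫ p = t ≫ Sigma.desc b := by
    refine Sigma.hom_ext _ _ fun n ↦ ?_
    rw [Sigma.ι_desc_assoc, hab, Sigma.ι_map_assoc, Sigma.ι_desc]
  refine ⟨pushout (Sigma.desc a) t, pushout.inl _ _, pushout.desc p (Sigma.desc b) hw,
    pushout.inl_desc _ _ _, MorphismProperty.pushouts_mk _
      (IsPushout.of_hasPushout (Sigma.desc a) t) ht, fun n ↦ ?_⟩
  let q : (tensorRight (V n)).obj (Q n) ⟶ pushout (Sigma.desc a) t :=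
    Sigma.ι (fun n ↦ (tensorRight (V n)).obj (Q n)) n ≫ pushout.inr _ _
  have hι : Sigma.ι (fun n ↦ (tensorRight (V n)).obj (P n)) n ≫ t =
      (tensorRight (V n)).map (i n) ≫ Sigma.ι (fun n ↦ (tensorRight (V n)).obj (Q n)) n :=
    Sigma.ι_map _ _
  have hq₁ : (tensorRight (V n)).map (i n) ≫ q = a n ≫ pushout.inl _ _ := by
    rw [← Category.assoc, ← hι, Category.assoc, ← pushout.condition, Sigma.ι_desc_assoc]
  have hq₂ : q ≫ pushout.desc p (Sigma.desc b) hw = b n := by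
    rw [Category.assoc, pushout.inr_desc, Sigma.ι_desc]
  refine ⟨tensorCurry q, fun s ↦ ⟨hom_ext_apply fun m x ↦ ?_, hom_ext_apply fun m x ↦ ?_⟩⟩
  · exact ConcreteCategory.congr_hom (HomologicalComplex.congr_hom
      (congrArg Hom.hom hq₁) m) (x ⊗ₜ[R] s)
  · exact ConcreteCategory.congr_hom (HomologicalComplex.congr_hom
      (congrArg Hom.hom hq₂) m) (x ⊗ₜ[R] s)

/-! ## Acyclicity of colimits of sequences -/

section Total

/-- The differential on the product of the modules of all degrees. -/
def totalD (M : DGModule A) : (∀ n, M.X.X n) →ₗ[R] ∀ n, M.X.X n :=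
  LinearMap.pi fun n ↦ (M.X.d (n + 1) n).hom ∘ₗ LinearMap.proj (n + 1)

lemma totalD_apply {M : DGModule A} (x : ∀ n, M.X.X n) {n m : ℤ} (h : m + 1 = n) :
    totalD M x m = (M.X.d n m).hom (x n) := by
  subst h
  rfl

/-- The families of elements of the kernel of `p` in the image of `i`. -/
def kerRange {E M Y : DGModule A} (i : E ⟶ M) (p : M ⟶ Y) : Submodule R (∀ n, M.X.X n) :=
  Submodule.pi Set.univ fun n ↦
    LinearMap.ker (p.hom.f n).hom ⊓ LinearMap.range (i.hom.f n).hom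

lemma mem_kerRange {E M Y : DGModule A} {i : E ⟶ M} {p : M ⟶ Y} {x : ∀ n, M.X.X n} :
    x ∈ kerRange i p ↔
      ∀ n, (p.hom.f n).hom (x n) = 0 ∧ ∃ y, (i.hom.f n).hom y = x n := by
  simp [kerRange, Submodule.mem_pi]

variable {E E' Z Y : DGModule A} {i : E ⟶ Z} {i' : E' ⟶ Z} {j : E ⟶ E'} {p : Z ⟶ Y}

lemma totalD_mem_kerRange {x : ∀ n, Z.X.X n} (hx : x ∈ kerRange i p) :
    totalD Z x ∈ kerRange i p := by
  rw [mem_kerRange] at hx ⊢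
  intro n
  obtain ⟨h, y, hy⟩ := hx (n + 1)
  rw [totalD_apply x rfl, map_d, h, map_zero]
  exact ⟨rfl, (E.X.d (n + 1) n).hom y, by rw [map_d, hy]⟩

/-- The retraction `r` projects onto the image of `i`, and `1 - τ (i ≫ p)` projects the source of
`i` onto the kernel of `i ≫ p`. -/
lemma exists_projection_kerRange (hp : rFibrations A (i ≫ p))
    (hi : ∀ n, ∃ r : Z.X.X n →ₗ[R] E.X.X n, ∀ x, r ((i.hom.f n).hom x) = x) :
    ∃ ρ : (∀ n, Z.X.X n) →ₗ[R] ∀ n, Z.X.X n,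
      ∀ x, ρ x ∈ kerRange i p ∧ (x ∈ kerRange i p → ρ x = x) := by
  choose τ hτ using hp
  choose r hr using hi
  have hτ' (n : ℤ) (y : Y.X.X n) : (p.hom.f n).hom ((i.hom.f n).hom (τ n y)) = y :=
    LinearMap.congr_fun (hτ n) y
  let π (n : ℤ) : Z.X.X n →ₗ[R] Z.X.X n := (i.hom.f n).hom ∘ₗ
    (LinearMap.id - τ n ∘ₗ (p.hom.f n).hom ∘ₗ (i.hom.f n).hom) ∘ₗ r n
  have hπ (n : ℤ) (x : Z.X.X n) : π n x = (i.hom.f n).hom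
      (r n x - τ n ((p.hom.f n).hom ((i.hom.f n).hom (r n x)))) := rfl
  refine ⟨LinearMap.pi fun n ↦ π n ∘ₗ LinearMap.proj n, fun x ↦
    ⟨mem_kerRange.2 fun n ↦ ⟨?_, _, rfl⟩, fun hx ↦ funext fun n ↦ ?_⟩⟩
  · change (p.hom.f n).hom (π n (x n)) = 0
    rw [hπ, map_sub, map_sub, hτ', sub_self]
  · obtain ⟨h, y, hy⟩ := mem_kerRange.1 hx n
    change π n (x n) = x n
    rw [hπ, ← hy, hr, hy, h, map_zero, sub_zero, hy]

/-- Cycles of `Z` from the stage `E` pull back along `r` to cycles of `E`, because `i` is injective.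
`LiftsCycles`, applied over the zero chain of `Y`, bounds them one stage later inside the kernel of
`p`. -/
lemma exists_lift_kerRange (hj : j ≫ i' = i) (H : LiftsCycles j (i ≫ p) (i' ≫ p))
    (hi : ∀ n, ∃ r : Z.X.X n →ₗ[R] E.X.X n, ∀ x, r ((i.hom.f n).hom x) = x) :
    ∃ s : ↥(kerRange i p ⊓ LinearMap.ker (totalD Z)) →ₗ[R] ∀ n, Z.X.X n,
      ∀ x, s x ∈ kerRange i' p ∧ totalD Z (s x) = x := by
  choose r hr using hi
  let V := ↥(kerRange i p ⊓ LinearMap.ker (totalD Z))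
  have hV (v : V) (n : ℤ) : (i.hom.f n).hom (r n (v.1 n)) = v.1 n := by
    obtain ⟨-, y, hy⟩ := mem_kerRange.1 v.2.1 n
    rw [← hy, hr]
  have hd (v : V) (n m : ℤ) (hm : m + 1 = n) : (Z.X.d n m).hom (v.1 n) = 0 :=
    (totalD_apply v.1 hm).symm.trans (congrFun (LinearMap.mem_ker.1 v.2.2) m)
  have hj' (n : ℤ) (x : E.X.X n) : (i'.hom.f n).hom ((j.hom.f n).hom x) = (i.hom.f n).hom x :=
    congrArg (fun f : E ⟶ Z ↦ (f.hom.f n).hom x) hj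
  have key (n : ℤ) : ∃ e : V →ₗ[R] E'.X.X n, ∀ m, m + 1 = n → ∀ v,
      (E'.X.d n m).hom (e v) = (j.hom.f m).hom (r m (v.1 m)) ∧
        (p.hom.f n).hom ((i'.hom.f n).hom (e v)) = 0 := by
    obtain ⟨e, he, he'⟩ := H (sub_add_cancel n 1) V
      (r (n - 1) ∘ₗ LinearMap.proj (n - 1) ∘ₗ Submodule.subtype _) 0
      (cycle_of_succ (sub_add_cancel (n - 1) 1) fun v ↦
        ((hr _ _).symm.trans (congrArg (r _) ((map_d i.hom _ _ _).trans
          ((congrArg _ (hV v _)).trans (hd v _ _ (by omega)))))).trans (map_zero _))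
      fun v ↦ ((congrArg (p.hom.f (n - 1)).hom (hV v (n - 1))).trans
        (mem_kerRange.1 v.2.1 (n - 1)).1).trans (map_zero _).symm
    refine ⟨e, fun m hm v ↦ ⟨?_, he' v⟩⟩
    obtain rfl : m = n - 1 := by omega
    exact he v
  choose e he using key
  refine ⟨LinearMap.pi fun n ↦ (i'.hom.f n).hom ∘ₗ e n, fun v ↦ ⟨mem_kerRange.2 fun n ↦
    ⟨(he n (n - 1) (by omega) v).2, e n v, rfl⟩, funext fun n ↦ ?_⟩⟩
  refine (totalD_apply _ rfl).trans ?_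
  change (Z.X.d (n + 1) n).hom ((i'.hom.f (n + 1)).hom (e (n + 1) v)) = v.1 n
  rw [← map_d, (he (n + 1) n rfl v).1, hj', hV]

end Total

lemma liftsCycles_of_sequence {E : ℕ → DGModule A} {Z Y : DGModule A} {j : ∀ k, E k ⟶ E (k + 1)}
    {i : ∀ k, E k ⟶ Z} {p : Z ⟶ Y} (hj : ∀ k, j k ≫ i (k + 1) = i k)
    (hi : ∀ k n, ∃ r : Z.X.X n →ₗ[R] (E k).X.X n, ∀ x, r (((i k).hom.f n).hom x) = x)
    (hZ : ∀ n (z : Z.X.X n), ∃ k x, ((i k).hom.f n).hom x = z)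
    (hp : ∀ k, rFibrations A (i k ≫ p))
    (H : ∀ k, LiftsCycles (j k) (i k ≫ p) (i (k + 1) ≫ p)) : LiftsCycles (𝟙 Z) p p := by
  have hF : Monotone fun k ↦ kerRange (i k) p := monotone_nat_of_le_succ fun k x hx ↦ by
    rw [mem_kerRange] at hx ⊢
    intro n
    obtain ⟨h, y, hy⟩ := hx n
    refine ⟨h, ((j k).hom.f n).hom y, ?_⟩
    rw [← hy, ← hj k]
    rfl
  have hD (x : ∀ n, Z.X.X n) : totalD Z (totalD Z x) = 0 := funext fun n ↦ by
    rw [totalD_apply _ rfl, totalD_apply _ rfl, d_d]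
    rfl
  obtain ⟨c, hc⟩ := exists_contraction hD (fun k x hx ↦ totalD_mem_kerRange hx) hF
    (fun k ↦ exists_projection_kerRange (hp k) (hi k))
    (fun k ↦ exists_lift_kerRange (hj k) (H k) (hi k))
  have hmem {x : ∀ n, Z.X.X n} : x ∈ ⨆ k, kerRange (i k) p ↔ ∃ k, x ∈ kerRange (i k) p :=
    Submodule.mem_iSup_of_directed _ hF.directed_le
  intro n m hm V _ _ z b hz hzb
  subst hm
  obtain ⟨τ, hτ⟩ := hp 0 (m + 1)
  -- A section from stage zero reduces the problem to `b = 0`: `w = z - d t b` is a cycle in the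
  -- kernel of `p`.
  let t : Y.X.X (m + 1) →ₗ[R] Z.X.X (m + 1) := ((i 0).hom.f (m + 1)).hom ∘ₗ τ
  have ht (y : Y.X.X (m + 1)) : (p.hom.f (m + 1)).hom (t y) = y := LinearMap.congr_fun hτ y
  let w : V →ₗ[R] Z.X.X m := z - (Z.X.d (m + 1) m).hom ∘ₗ t ∘ₗ b
  have hw (v : V) : w v = z v - (Z.X.d (m + 1) m).hom (t (b v)) := rfl
  have hpw (v : V) : (p.hom.f m).hom (w v) = 0 := by
    rw [hw, map_sub, map_d, ht, hzb, sub_self]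
  have hdw (v : V) (k : ℤ) : (Z.X.d m k).hom (w v) = 0 := by
    rw [hw, map_sub, hz, d_d, sub_self]
  -- An arbitrary family over all degrees need not come from a single stage, but one concentrated in
  -- degree `m` does. The stage depends on `v`, which is why the contraction is needed on the whole
  -- union.
  have hs (v : V) : LinearMap.single R (fun n ↦ Z.X.X n) m (w v) ∈
      ⨆ k, kerRange (i k) p := by
    obtain ⟨k, y, hy⟩ := hZ m (w v)
    refine hmem.2 ⟨k, mem_kerRange.2 fun n ↦ ?_⟩
    obtain rfl | hn := eq_or_ne n m
    · rw [LinearMap.single_apply, Pi.single_eq_same]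
      exact ⟨hpw v, y, hy⟩
    · rw [LinearMap.single_apply, Pi.single_eq_of_ne hn, map_zero]
      exact ⟨rfl, 0, map_zero _⟩
  have hds (v : V) : totalD Z (LinearMap.single R (fun n ↦ Z.X.X n) m (w v)) = 0 := by
    funext n
    rw [totalD_apply _ rfl, LinearMap.single_apply]
    obtain rfl | hn := eq_or_ne (n + 1) m
    · rw [Pi.single_eq_same, hdw]
      rfl
    · rw [Pi.single_eq_of_ne hn, map_zero]
      rfl
  let C : V →ₗ[R] ∀ n, Z.X.X n :=
    c ∘ₗ (LinearMap.single R (fun n ↦ Z.X.X n) m ∘ₗ w).codRestrict _ hs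
  have hC (v : V) : C v ∈ ⨆ k, kerRange (i k) p := (hc _).1
  have hC' (v : V) : totalD Z (C v) = LinearMap.single R (fun n ↦ Z.X.X n) m (w v) :=
    (hc _).2 (hds v)
  refine ⟨t ∘ₗ b + LinearMap.proj (m + 1) ∘ₗ C, fun v ↦ ?_, fun v ↦ ?_⟩
  · have h : (Z.X.d (m + 1) m).hom (C v (m + 1)) = w v :=
      (totalD_apply _ rfl).symm.trans ((congrFun (hC' v) m).trans 
        (Pi.single_eq_same (M := fun n ↦ Z.X.X n) m (w v)))
    change (Z.X.d (m + 1) m).hom (t (b v) + C v (m + 1)) = z v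
    rw [map_add, h, hw, add_sub_cancel]
  · obtain ⟨k, hk⟩ := hmem.1 (hC v)
    change (p.hom.f (m + 1)).hom (t (b v) + C v (m + 1)) = b v
    rw [map_add, ht, (mem_kerRange.1 hk (m + 1)).1, add_zero]

end DGModule

/-! ## Model structures from factorizations -/

section Factorizations

variable {C : Type v} [Category.{u} C]

lemma llp_eq_retracts {L P : MorphismProperty C} (hL : L ≤ P.llp)
    (hf : ∀ ⦃X Y : C⦄ (f : X ⟶ Y), ∃ (Z : C) (i : X ⟶ Z) (p : Z ⟶ Y), L i ∧ P p ∧ i ≫ p = f) :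
    P.llp = L.retracts := by
  refine le_antisymm (fun X Y f hf' ↦ ?_)
    ((MorphismProperty.retracts_monotone hL).trans P.llp.retracts_le)
  obtain ⟨Z, i, p, hi, hp, fac⟩ := hf f
  have := hf' p hp
  exact ⟨_, _, _, RetractArrow.ofLeftLiftingProperty fac, hi⟩

variable {W Fib P : MorphismProperty C} (hP : Fib ⊓ W = P) (hW : Fib.llp ≤ W)
  (hf : ∀ ⦃X Y : C⦄ (f : X ⟶ Y), ∃ (Z : C) (i : X ⟶ Z) (p : Z ⟶ Y),
    Fib.llp i ∧ Fib p ∧ i ≫ p = f)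

include hP hW hf

/-- Factor `f` as `i ≫ p` with `i` in `Fib.llp` and `p` in `Fib`. By two out of three `p` is
acyclic, so `f` lifts against it and is a retract of `i`. -/
lemma llp_inf_eq [W.HasTwoOutOfThreeProperty] : P.llp ⊓ W = Fib.llp := by
  refine le_antisymm (fun X Y f h ↦ ?_)
    (le_inf (MorphismProperty.antitone_llp (hP.symm.le.trans inf_le_left)) hW)
  obtain ⟨Z, i, p, hi, hp, rfl⟩ := hf f
  have hp' : P p := hP.le _ ⟨hp, W.of_precomp i p (hW _ hi) h.2⟩
  have := h.1 p hp'
  exact MorphismProperty.of_retract (RetractArrow.ofLeftLiftingProperty rfl) hi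

lemma isModelStructure_of_factorizations [HasFiniteLimits C] [HasFiniteColimits C]
    [W.HasTwoOutOfThreeProperty] (hFib : Fib.llp.rlp = Fib) (hP' : P.llp.rlp = P)
    (hf' : ∀ ⦃X Y : C⦄ (f : X ⟶ Y), ∃ (Z : C) (i : X ⟶ Z) (p : Z ⟶ Y),
      P.llp i ∧ P p ∧ i ≫ p = f) : IsModelStructure W P.llp Fib := by
  let _ : CategoryWithFibrations C := ⟨Fib⟩
  let _ : CategoryWithCofibrations C := ⟨P.llp⟩
  let _ : CategoryWithWeakEquivalences C := ⟨W⟩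
  have h₁ : trivialFibrations C = P := hP
  have h₂ : trivialCofibrations C = Fib.llp := llp_inf_eq (W := W) hP hW hf
  have : (weakEquivalences C).HasTwoOutOfThreeProperty :=
    ‹W.HasTwoOutOfThreeProperty›
  have : MorphismProperty.IsWeakFactorizationSystem (cofibrations C) (trivialFibrations C) :=
    { rlp := hP'.trans h₁.symm
      llp := congrArg _ h₁
      hasFactorization := ⟨fun f ↦ by
        obtain ⟨Z, i, p, hi, hp, fac⟩ := hf' f
        exact ⟨⟨Z, i, p, fac, hi, h₁.symm.le _ hp⟩⟩⟩ }
  have : MorphismProperty.IsWeakFactorizationSystem (trivialCofibrations C) (fibrations C) :=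
    { rlp := (congrArg _ h₂).trans hFib
      llp := h₂.symm
      hasFactorization := ⟨fun f ↦ by
        obtain ⟨Z, i, p, hi, hp, fac⟩ := hf f
        exact ⟨⟨Z, i, p, fac, h₂.symm.le _ hi, hp⟩⟩⟩ }
  exact ⟨ModelCategory.mk' C, rfl, rfl, rfl⟩

end Factorizations

/-! ### Enriched lifting classes and enriched weak factorization systems -/

namespace DGModule

variable {R : Type u} [CommRing R] {A : DGAlgebra R}

/-- The enriched right lifting property against `I` is an ordinary one against the larger class
`tensored I`, so the closure properties of ordinary lifting classes apply to it. -/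
lemma tensored_rlp (I : MorphismProperty (DGModule A)) :
    (tensored I).rlp = enrichedRLP R I := by
  refine le_antisymm (fun E B p H W X i hi ↦ ?_) ?_
  · let S := Sq R i p
    have sq : CommSq (tensorDesc (.of R S) (LinearMap.fst R _ _ ∘ₗ S.subtype))
        ((tensorRight (.of R S)).map i) p
        (tensorDesc (.of R S) (LinearMap.snd R _ _ ∘ₗ S.subtype)) :=
      ⟨tensor_hom_ext fun n x s ↦
        ConcreteCategory.congr_hom (HomologicalComplex.congr_hom (congrArg Hom.hom s.2) n) x⟩
    have := H _ (tensored.mk i hi (.of R S))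
    refine ⟨tensorCurry sq.lift, LinearMap.ext fun s ↦ Subtype.ext (Prod.ext
      (hom_ext_apply fun n x ↦ ?_) (hom_ext_apply fun n x ↦ ?_))⟩
    · exact ConcreteCategory.congr_hom (HomologicalComplex.congr_hom
        (congrArg Hom.hom sq.fac_left) n) (x ⊗ₜ[R] s)
    · exact ConcreteCategory.congr_hom (HomologicalComplex.congr_hom
        (congrArg Hom.hom sq.fac_right) n) (x ⊗ₜ[R] s)
  · rintro E B p H _ _ _ ⟨i, hi, V⟩
    exact hasLiftingProperty_tensorRight (H i hi) V

lemma enrichedRelativeCellComplexes_le (I : MorphismProperty (DGModule A)) :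
    enrichedRelativeCellComplexes I ≤ (enrichedRLP R I).llp := by
  rw [← tensored_rlp]
  exact (tensored I).transfiniteCompositionsOfShape_pushouts_coproducts_le_llp_rlp ℕ

lemma enrichedRLP_llp_rlp (I : MorphismProperty (DGModule A)) :
    (enrichedRLP R I).llp.rlp = enrichedRLP R I := by
  rw [← tensored_rlp, MorphismProperty.rlp_llp_rlp]

lemma isEnrichedWFS {I : MorphismProperty (DGModule A)}
    (hI : ∀ ⦃E B : DGModule A⦄ (p : E ⟶ B) (V : ModuleCat.{u} R), enrichedRLP R I p →
      enrichedRLP R I (cotensorMap p V))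
    (hf : ∀ ⦃X Y : DGModule A⦄ (f : X ⟶ Y), ∃ (Z : DGModule A) (i : X ⟶ Z) (p : Z ⟶ Y),
      (enrichedRLP R I).llp i ∧ enrichedRLP R I p ∧ i ≫ p = f) :
    IsEnrichedWFS R (enrichedRLP R I).llp (enrichedRLP R I) where
  factorization := hf
  llp := (enrichedLLP_eq_llp hI).symm
  rlp := by
    rw [← enrichedLLP_eq_llp hI]
    exact le_antisymm (fun _ _ p hp _ _ i hi ↦ hi p hp)
      fun _ _ p hp _ _ i hi ↦ hp i fun _ _ q hq ↦ hq i hi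

/-! ## The factorizations of the `r`-model structure -/

lemma exists_factorization_genI {X Y : DGModule A} (f : X ⟶ Y) :
    ∃ (Z : DGModule A) (i : X ⟶ Z) (p : Z ⟶ Y),
      enrichedRelativeCellComplexes (genI A) i ∧ enrichedRLP R (genI A) p ∧ i ≫ p = f := by
  obtain ⟨Z, i, p, c, fac, hc⟩ := exists_sequence
    (W := cellAttachments (tensored (genI A)))
    (Q := fun _ _ j p p' ↦ LiftsCycles j p p') (fun E p ↦ by
      obtain ⟨E', j, p', fac, hj, H⟩ := exists_attachment (fun n ↦ sphToDsk A n) p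
      exact ⟨E', j, p', fac, hj, liftsCycles_of_sq H⟩) f
  refine ⟨Z, i, p, ⟨c⟩, (enrichedRLP_genI_iff p).2 ?_, fac⟩
  have hle : cellAttachments (tensored (genI A)) ≤ (enrichedRLP R (genI A)).llp := by
    rw [MorphismProperty.le_llp_iff_le_rlp, cellAttachments, MorphismProperty.rlp_pushouts,
      MorphismProperty.rlp_coproducts, tensored_rlp]
  have hw (k l : ℕ) (h : k ≤ l) : c.F.map (homOfLE h) ≫ c.incl.app l = c.incl.app k :=
    (c.incl.naturality _).trans (Category.comp_id _)
  have : MorphismProperty.IsStableUnderTransfiniteComposition.{0}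
      (enrichedRLP R (genI A)).llp := {}
  -- The first two stages are dropped because the map to `Y` acquires its section only after two
  -- attachments.
  refine liftsCycles_of_sequence (E := fun k ↦ c.F.obj (k + 2))
    (j := fun k ↦ c.F.map (homOfLE (Nat.le_add_right (k + 2) 1)))
    (i := fun k ↦ c.incl.app (k + 2)) (fun k ↦ hw _ _ _)
    (fun k n ↦ exists_retraction_of_llp ((c.ofLE hle).mem_incl_app (k + 2)) n)
    (fun n z ↦ ?_) (fun k ↦ rFibrations_of_liftsCycles (hc k) (hc (k + 1))) fun k ↦ hc (k + 2)
  obtain ⟨k, x, hx⟩ := exists_rep_of_isColimit c.isColimit n z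
  refine ⟨k, ((c.F.map (homOfLE (Nat.le_add_right k 2))).hom.f n).hom x, Eq.trans ?_ hx⟩
  exact congrArg (fun g ↦ (g.hom.f n).hom x) (hw k (k + 2) (Nat.le_add_right k 2))

lemma exists_factorization_genJ {X Y : DGModule A} (f : X ⟶ Y) :
    ∃ (Z : DGModule A) (i : X ⟶ Z) (p : Z ⟶ Y),
      enrichedRelativeCellComplexes (genJ A) i ∧ rFibrations A p ∧ i ≫ p = f := by
  obtain ⟨Z, i, p, c, fac, hc⟩ := exists_sequence
    (W := cellAttachments (tensored (genJ A)))
    (Q := fun _ _ _ _ p' ↦ rFibrations A p') (fun E p ↦ by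
      obtain ⟨E', j, p', fac, hj, H⟩ := exists_attachment (fun n ↦ zeroToDsk (A := A) n) p
      refine ⟨E', j, p', fac, hj, rFibrations_of_sq (p := p) fun n ↦ ?_⟩
      obtain ⟨η, hη⟩ := H n
      exact ⟨η, fun s ↦ (hη s).2⟩) f
  refine ⟨Z, i, p, ⟨c⟩, fun n ↦ ?_, fac⟩
  -- A section from the first stage already gives one from the colimit, so no gluing is needed here.
  obtain ⟨s, hs⟩ := hc 0 n
  exact ⟨((c.incl.app 1).hom.f n).hom ∘ₗ s, hs⟩

lemma enrichedRelativeCellComplexes_genJ_le :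
    enrichedRelativeCellComplexes (genJ A) ≤ (rFibrations A).llp :=
  (enrichedRelativeCellComplexes_le _).trans (enrichedRLP_genJ (A := A) ▸ le_rfl)

/-! ### The two model structures -/

instance : (rEquivalences A).HasTwoOutOfThreeProperty :=
  inferInstanceAs ((HomologicalComplex.homotopyEquivalences _ _).inverseImage
    (forget A)).HasTwoOutOfThreeProperty

instance : (qEquivalences A).HasTwoOutOfThreeProperty :=
  inferInstanceAs ((HomologicalComplex.quasiIso _ _).inverseImage
    (forget A)).HasTwoOutOfThreeProperty

variable (A) in
lemma isEnrichedCompactlyGenerated_r : IsEnrichedCompactlyGenerated (rEquivalences A)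
    (rCofibrations A) (rFibrations A) (genI A) (genJ A) := by
  have hI ⦃X Y : DGModule A⦄ (f : X ⟶ Y) : ∃ (Z : DGModule A) (i : X ⟶ Z) (p : Z ⟶ Y),
      (enrichedRLP R (genI A)).llp i ∧ enrichedRLP R (genI A) p ∧ i ≫ p = f := by
    obtain ⟨Z, i, p, hi, hp, fac⟩ := exists_factorization_genI f
    exact ⟨Z, i, p, enrichedRelativeCellComplexes_le _ _ hi, hp, fac⟩
  have hJ ⦃X Y : DGModule A⦄ (f : X ⟶ Y) : ∃ (Z : DGModule A) (i : X ⟶ Z) (p : Z ⟶ Y),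
      (rFibrations A).llp i ∧ rFibrations A p ∧ i ≫ p = f := by
    obtain ⟨Z, i, p, hi, hp, fac⟩ := exists_factorization_genJ f
    exact ⟨Z, i, p, enrichedRelativeCellComplexes_genJ_le _ hi, hp, fac⟩
  have hP := rFibrations_inf_rEquivalences (A := A)
  have hC : rCofibrations A = (enrichedRLP R (genI A)).llp := congrArg _ hP
  have hCW : rCofibrations A ⊓ rEquivalences A = (rFibrations A).llp :=
    hC ▸ llp_inf_eq hP rFibrations_llp_le hJ
  refine ⟨?_, ?_, ?_, hasCompactDomains_genI _, hasCompactDomains_genJ _, ?_, ?_,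
    enrichedRLP_genJ.symm, hP⟩
  · rw [hC]
    refine isModelStructure_of_factorizations hP rFibrations_llp_le hJ ?_
      (enrichedRLP_llp_rlp _) hI
    rw [← enrichedRLP_genJ, enrichedRLP_llp_rlp]
  · rw [hC, hP]
    exact isEnrichedWFS (fun _ _ p V ↦ enrichedRLP_genI_cotensorMap p V) hI
  · rw [hCW]
    rw [← enrichedRLP_genJ] at hJ ⊢
    exact isEnrichedWFS (fun _ _ p V ↦ by
      rw [enrichedRLP_genJ]
      exact rFibrations_cotensorMap p V) hJ
  · rw [hC]
    exact llp_eq_retracts (enrichedRelativeCellComplexes_le _)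
      fun _ _ ↦ exists_factorization_genI
  · rw [hCW]
    exact llp_eq_retracts enrichedRelativeCellComplexes_genJ_le
      fun _ _ ↦ exists_factorization_genJ

lemma exists_factorization_llp_rlp (I : MorphismProperty (DGModule A))
    [MorphismProperty.HasSmallObjectArgument.{u} I] {X Y : DGModule A} (f : X ⟶ Y) :
    ∃ (Z : DGModule A) (i : X ⟶ Z) (p : Z ⟶ Y), I.rlp.llp i ∧ I.rlp p ∧ i ≫ p = f := by
  have h := MorphismProperty.factorizationData I.rlp.llp I.rlp f
  exact ⟨h.Z, h.i, h.p, h.hi, h.hp, h.fac⟩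

attribute [local instance] Cardinal.fact_isRegular_aleph0 Cardinal.orderBotAleph0OrdToType in
variable (A) in
lemma isCompactlyGeneratedModel_q : IsCompactlyGeneratedModel (qEquivalences A)
    (qCofibrations A) (qFibrations A) (genI A) (genJ A) := by
  have hJ ⦃X Y : DGModule A⦄ (f : X ⟶ Y) : ∃ (Z : DGModule A) (i : X ⟶ Z) (p : Z ⟶ Y),
      (qFibrations A).llp i ∧ qFibrations A p ∧ i ≫ p = f := by
    rw [← genJ_rlp]
    exact exists_factorization_llp_rlp _ f
  have hP := qFibrations_inf_qEquivalences (A := A)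
  have hC : qCofibrations A = (genI A).rlp.llp := congrArg _ hP
  have hCW : qCofibrations A ⊓ qEquivalences A = (genJ A).rlp.llp := by
    rw [hC, llp_inf_eq hP qFibrations_llp_le hJ, genJ_rlp]
  refine ⟨?_, hasCompactDomains_genI _, hasCompactDomains_genJ _, ?_, ?_, genJ_rlp.symm, hP⟩
  · rw [hC]
    refine isModelStructure_of_factorizations hP qFibrations_llp_le hJ ?_
      (MorphismProperty.rlp_llp_rlp _) fun _ _ ↦ exists_factorization_llp_rlp _
    rw [← genJ_rlp, MorphismProperty.rlp_llp_rlp]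
  · rw [hC]
    exact SmallObject.llp_rlp_of_isCardinalForSmallObjectArgument_aleph0 _
  · rw [hCW]
    exact SmallObject.llp_rlp_of_isCardinalForSmallObjectArgument_aleph0 _

end DGModule

theorem mainTheorem1 (R : Type u) [CommRing R] (A : DGAlgebra R) :
    (HasLimits (DGModule A) ∧ HasColimits (DGModule A)) ∧
    DGModule.enrichedRelativeCellComplexes (genJ A) ≤ DGModule.rEquivalences A ∧
    DGModule.IsEnrichedCompactlyGenerated (DGModule.rEquivalences A)
      (DGModule.rCofibrations A) (DGModule.rFibrations A) (genI A) (genJ A) ∧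
    IsCompactlyGeneratedModel (DGModule.qEquivalences A)
      (DGModule.qCofibrations A) (DGModule.qFibrations A) (genI A) (genJ A) :=
  ⟨⟨inferInstance, inferInstance⟩,
    DGModule.enrichedRelativeCellComplexes_genJ_le.trans DGModule.rFibrations_llp_le,
    DGModule.isEnrichedCompactlyGenerated_r A, DGModule.isCompactlyGeneratedModel_q A⟩
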